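/- **Doctrines.** Let $\mathcal C$ be a category with a terminal object $1$ and binary products. A doctrine on $\mathcal C$ is a functor $P:\mathcal C^{op}\to\mathbf{InfSL}$ to inf-semilattices with top; write $P_f:P(B)\to P(A)$ for reindexing along $f:A\to B$. It is a *weak hyperdoctrine* if (a) every $A$ has an equality predicate $\delta_A\in P(A\times A)$ such that, for every $X$ and $e=\langle pr_1,pr_2,pr_2\rangle:X\times A\to X\times A\times A$, the assignment $\alpha\mapsto P_{\langle pr_1,pr_2\rangle}(\alpha)\wedge P_{\langle pr_2,pr_3\rangle}(\delta_A)$ is left adjoint to $P_e$; (b) for all $A,B$ there is a *weak evaluation* $ev:W\times A\to B$, i.e. every $f:X\times A\to B$ equals $ev\circ(g\times id_A)$ for some $g:X\to W$; (c) the fibres are Heyting algebras and reindexing preserves the Heyting structure; (d) reindexing along each projection $A\times B\to A$ has a left adjoint $\exists_B$ and a right adjoint $\forall_B$, both satisfying the Beck–Chevalley condition. It has *comprehensive diagonals* if each diagonal $\Delta_A:A\to A\times A$ is a full comprehension of $\delta_A$: $\top\le P_{\Delta_A}(\delta_A)$; every $f:Z\to A\times A$ with $\top\le P_f(\delta_A)$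 factors uniquely through $\Delta_A$; and $\delta_A\le\beta$ whenever $\top\le P_{\Delta_A}(\beta)$. It is *arithmetic* if moreover $\mathcal C$ has a parameterized natural number object $(N,0,s)$ (for all $a:A\to X$, $f:X\to X$ there is a unique $k:A\times N\to X$ with $k\langle id_A,0\rangle=a$ and $k(id_A\times s)=fk$) satisfying induction in $P$: for $\varphi\in P(A\times N)$, if $\top\le P_{\langle id_A,0\rangle}(\varphi)$ and $\varphi\le P_{id_A\times s}(\varphi)$, then $\top\le\varphi$. Formulas are interpreted in the fibres as usual, and $\vdash\sigma$ means $\top\le\sigma$ in $P(1)$. **Church's Thesis.** Let $\{e\}$ be the $e$-th partial recursive function, and let $T$ (ternary) and $U$ (unary) be terms for primitive recursive functions that are a test predicate and output function in Kleene's sense: for all $e,x,z\in\mathbb N$, $\{e\}(x)$ is defined with value $z$ if and only if there is $y$ with $T(e,x,y)=1$ and $U(y)=z$. They are interpreted as arrows $T:N\times N\times N\to N$, $U:N\to N$ by the universal property of $N$. An arithmetic doctrine $P$ with comprehensive diagonals satisfies * *Type-theoretic Church's Thesis* (TCT) if for some weak evaluation $ev:W\times N\to N$, $\vdash\forall f{:}W.\,\exists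 e{:}N.\,\forall x{:}N.\,\exists y{:}N.\,\big(T(e,x,y)=_N s(0)\wedge U(y)=_N ev(f,x)\big)$; * *Church's Thesis* (CT) if for every $R\in P(N\times N)$, $\vdash\big(\forall x{:}N.\,\exists n{:}N.\,R(x,n)\big)\Rightarrow\exists e{:}N.\,\forall x{:}N.\,\exists y{:}N.\,\big(T(e,x,y)=_N s(0)\wedge R(x,U(y))\big)$. **The categories.** An assembly is a set $X$ with a relation $E\subseteq X\times\mathbb N$ such that every $x\in X$ is related to some $n$; an arrow $(X,E)\to(X',E')$ is a function $f:X\to X'$ for which there is $t\in\mathbb N$ such that $x\mathrel{E}n$ implies that $\{t\}(n)$ is defined and $f(x)\mathrel{E'}\{t\}(n)$. This gives the category $\mathbf{Asm}$; $\mathbf{PAsm}$ is its full subcategory on the partitioned assemblies, those with $E$ single-valued. $\mathbf{Eff}$ is Hyland's effective topos: its objects are sets with a $\mathcal P(\mathbb N)$-valued equality predicate for which symmetry and transitivity are recursively realized, and its arrows are the strict, extensional, single-valued and total $\mathcal P(\mathbb N)$-valued relations modulo realized equivalence. These categories have finite products and pullbacks. Consider the doctrine of strong subobjects on $\mathbf{Asm}$,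 the doctrine of subobjects on $\mathbf{Eff}$ (both with reindexing by pullback), and the doctrine of variations on $\mathbf{PAsm}$, whose fibre over $A$ is the poset reflection of the comma category $\mathbf{PAsm}/A$ and whose reindexing is given by pullback. **Statement.** For all such $T$ and $U$: (i) The doctrine of strong subobjects on $\mathbf{Asm}$ and the doctrine of subobjects on $\mathbf{Eff}$ are arithmetic doctrines with comprehensive diagonals and satisfy (TCT). (ii) The doctrine of variations on $\mathbf{PAsm}$ and the doctrine of subobjects on $\mathbf{Eff}$ are arithmetic doctrines with comprehensive diagonals and satisfy (CT). -/

import Mathlib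

open CategoryTheory Limits Opposite MonoidalCategory CartesianMonoidalCategory

universe w v u

namespace ChurchThesis

/-! ## Kleene's first model and realizability entailment -/

/-- Application in Kleene's first model: `app e n` is the value at `n`, if any, of the `e`-th
partial recursive function. -/
def app (e n : ℕ) : Part ℕ := (Denumerable.ofNat Nat.Partrec.Code e).eval n

theorem exists_app_eq {f : ℕ →. ℕ} (hf : Nat.Partrec f) : ∃ e, ∀ n, app e n = f n := by
  obtain ⟨c, hc⟩ := Nat.Partrec.Code.exists_code.1 hf
  exact ⟨Encodable.encode c, fun n => by simp [app, hc]⟩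

theorem partrec_app (e : ℕ) : Nat.Partrec (app e) :=
  Nat.Partrec.Code.exists_code.2 ⟨_, rfl⟩

/-- `φ ⊢ ψ` for predicates with values in sets of realizers: a single number realizes all the
implications `φ i → ψ i`. -/
def Entails {I : Type} (φ ψ : I → Set ℕ) : Prop :=
  ∃ t : ℕ, ∀ i, ∀ n ∈ φ i, ∃ m ∈ app t n, m ∈ ψ i

/-- Conjunction: codes of pairs of realizers. -/
def conj (a b : Set ℕ) : Set ℕ := {n | n.unpair.1 ∈ a ∧ n.unpair.2 ∈ b}

/-- Existential quantification: union of the sets of realizers. -/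
def exis {Y : Type} (a : Y → Set ℕ) : Set ℕ := {n | ∃ y, n ∈ a y}

namespace Entails

variable {I J Y : Type} {φ ψ χ : I → Set ℕ}

theorem of_computable (f : ℕ → ℕ) (hf : Computable f) (h : ∀ i, ∀ n ∈ φ i, f n ∈ ψ i) :
    Entails φ ψ := by
  obtain ⟨e, he⟩ := exists_app_eq (Partrec.nat_iff.1 hf.partrec)
  exact ⟨e, fun i n hn => ⟨f n, by simp [he], h i n hn⟩⟩

theorem refl (φ : I → Set ℕ) : Entails φ φ :=
  of_computable id Computable.id fun _ _ h => h

theorem trans (h₁ : Entails φ ψ) (h₂ : Entails ψ χ) : Entails φ χ := by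
  obtain ⟨s, hs⟩ := h₁
  obtain ⟨t, ht⟩ := h₂
  obtain ⟨e, he⟩ := exists_app_eq (Nat.Partrec.comp (partrec_app t) (partrec_app s))
  refine ⟨e, fun i n hn => ?_⟩
  obtain ⟨m, hm, hm'⟩ := hs i n hn
  obtain ⟨k, hk, hk'⟩ := ht i m hm'
  refine ⟨k, ?_, hk'⟩
  rw [he]
  exact Part.mem_bind hm hk

theorem and (h₁ : Entails φ ψ) (h₂ : Entails φ χ) : Entails φ fun i => conj (ψ i) (χ i) := by
  obtain ⟨s, hs⟩ := h₁
  obtain ⟨t, ht⟩ := h₂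
  obtain ⟨e, he⟩ := exists_app_eq (Nat.Partrec.pair (partrec_app s) (partrec_app t))
  refine ⟨e, fun i n hn => ?_⟩
  obtain ⟨m, hm, hm'⟩ := hs i n hn
  obtain ⟨k, hk, hk'⟩ := ht i n hn
  refine ⟨Nat.pair m k, ?_, by simpa [conj] using ⟨hm', hk'⟩⟩
  rw [he]
  change _ ∈ (Part.map Nat.pair (app s n)).bind fun g => Part.map g (app t n)
  exact Part.mem_bind (Part.mem_map _ hm) (Part.mem_map _ hk)

theorem left (h : Entails φ fun i => conj (ψ i) (χ i)) : Entails φ ψ :=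
  h.trans (of_computable (fun n => n.unpair.1) (Computable.fst.comp Computable.unpair)
    fun _ _ h => h.1)

theorem right (h : Entails φ fun i => conj (ψ i) (χ i)) : Entails φ χ :=
  h.trans (of_computable (fun n => n.unpair.2) (Computable.snd.comp Computable.unpair)
    fun _ _ h => h.2)

theorem comap (h : Entails φ ψ) (f : J → I) : Entails (fun j => φ (f j)) (fun j => ψ (f j)) := by
  obtain ⟨t, ht⟩ := h
  exact ⟨t, fun j => ht (f j)⟩

theorem of_subset (h : ∀ i, φ i ⊆ ψ i) : Entails φ ψ :=
  of_computable id Computable.id fun i _ hn => h i hn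

theorem exis_intro {θ : I → Y → Set ℕ} (y : I → Y) (h : Entails φ fun i => θ i (y i)) :
    Entails φ fun i => exis (θ i) :=
  h.trans (of_subset fun _ _ hn => ⟨_, hn⟩)

theorem exis_elim {θ : I → Y → Set ℕ} (h₁ : Entails φ fun i => exis (θ i))
    (h₂ : Entails (fun p : I × Y => conj (φ p.1) (θ p.1 p.2)) fun p => χ p.1) :
    Entails φ χ := by
  refine ((refl φ).and h₁).trans ?_
  obtain ⟨t, ht⟩ := h₂
  refine ⟨t, fun i n hn => ?_⟩
  obtain ⟨h, y, hy⟩ := hn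
  exact ht (i, y) n ⟨h, hy⟩

end Entails

/-! ## Assemblies and partitioned assemblies -/

/-- Assemblies: a set with a total relation to the natural numbers. -/
structure Asm : Type 1 where
  carrier : Type
  rel : carrier → ℕ → Prop
  total : ∀ x, ∃ n, rel x n

namespace Asm

/-- `t` tracks `f`. -/
def Tracks (X Y : Asm) (t : ℕ) (f : X.carrier → Y.carrier) : Prop :=
  ∀ x n, X.rel x n → ∃ m ∈ app t n, Y.rel (f x) m

/-- Arrows of assemblies: functions that are tracked by some number. -/
@[ext]
structure Hom (X Y : Asm) : Type where
  toFun : X.carrier → Y.carrier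
  tracked : ∃ t, Tracks X Y t toFun

theorem tracked_of_partrec {X Y : Asm} {f : X.carrier → Y.carrier} {g : ℕ →. ℕ}
    (hg : Nat.Partrec g) (h : ∀ x n, X.rel x n → ∃ m ∈ g n, Y.rel (f x) m) :
    ∃ t, Tracks X Y t f := by
  obtain ⟨e, he⟩ := exists_app_eq hg
  exact ⟨e, fun x n hn => by rw [he]; exact h x n hn⟩

theorem tracked_of_computable {X Y : Asm} {f : X.carrier → Y.carrier} {g : ℕ → ℕ}
    (hg : Computable g) (h : ∀ x n, X.rel x n → Y.rel (f x) (g n)) :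
    ∃ t, Tracks X Y t f :=
  tracked_of_partrec (Partrec.nat_iff.1 hg.partrec)
    fun x n hn => ⟨g n, by simp, h x n hn⟩

instance : Category Asm where
  Hom := Hom
  id X := ⟨id, tracked_of_computable Computable.id fun _ _ h => h⟩
  comp f g := ⟨g.toFun ∘ f.toFun, by
    obtain ⟨s, hs⟩ := f.tracked
    obtain ⟨t, ht⟩ := g.tracked
    refine tracked_of_partrec (Nat.Partrec.comp (partrec_app t) (partrec_app s))
      fun x n hn => ?_
    obtain ⟨m, hm, hm'⟩ := hs x n hn
    obtain ⟨k, hk, hk'⟩ := ht _ m hm'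
    exact ⟨k, Part.mem_bind hm hk, hk'⟩⟩

@[ext]
theorem hom_ext {X Y : Asm} {f g : X ⟶ Y} (h : ∀ x, f.toFun x = g.toFun x) : f = g :=
  Hom.ext (funext h)

@[simp] theorem id_toFun (X : Asm) (x : X.carrier) : Hom.toFun (𝟙 X) x = x := rfl

@[simp] theorem comp_toFun {X Y Z : Asm} (f : X ⟶ Y) (g : Y ⟶ Z) (x : X.carrier) :
    (f ≫ g).toFun x = g.toFun (f.toFun x) := rfl

/-- The terminal assembly. -/
def unit : Asm := ⟨Unit, fun _ n => n = 0, fun _ => ⟨0, rfl⟩⟩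

/-- The arrow to the terminal assembly. -/
def toUnit (X : Asm) : X ⟶ unit :=
  ⟨fun _ => (), tracked_of_computable (Computable.const 0) fun _ _ _ => rfl⟩

/-- The product of two assemblies. -/
def prod (X Y : Asm) : Asm where
  carrier := X.carrier × Y.carrier
  rel p n := X.rel p.1 n.unpair.1 ∧ Y.rel p.2 n.unpair.2
  total p := by
    obtain ⟨a, ha⟩ := X.total p.1
    obtain ⟨b, hb⟩ := Y.total p.2
    exact ⟨Nat.pair a b, by simpa using ⟨ha, hb⟩⟩

/-- The first projection. -/
def prodFst (X Y : Asm) : prod X Y ⟶ X :=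
  ⟨Prod.fst, tracked_of_computable (Computable.fst.comp Computable.unpair) fun _ _ h => h.1⟩

/-- The second projection. -/
def prodSnd (X Y : Asm) : prod X Y ⟶ Y :=
  ⟨Prod.snd, tracked_of_computable (Computable.snd.comp Computable.unpair) fun _ _ h => h.2⟩

/-- The pairing of two arrows. -/
def prodLift {X Y Z : Asm} (f : Z ⟶ X) (g : Z ⟶ Y) : Z ⟶ prod X Y :=
  ⟨fun z => (f.toFun z, g.toFun z), by
    obtain ⟨s, hs⟩ := f.tracked
    obtain ⟨t, ht⟩ := g.tracked
    refine tracked_of_partrec (Nat.Partrec.pair (partrec_app s) (partrec_app t))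
      fun x n hn => ?_
    obtain ⟨m, hm, hm'⟩ := hs x n hn
    obtain ⟨k, hk, hk'⟩ := ht x n hn
    refine ⟨Nat.pair m k, ?_, by simpa [prod] using ⟨hm', hk'⟩⟩
    change _ ∈ (Part.map Nat.pair (app s n)).bind fun g => Part.map g (app t n)
    exact Part.mem_bind (Part.mem_map _ hm) (Part.mem_map _ hk)⟩

/-- The subassembly on a subset of the underlying set. -/
def sub (X : Asm) (S : Set X.carrier) : Asm where
  carrier := S
  rel x n := X.rel x n
  total x := X.total x

/-- The inclusion of a subassembly. -/
def subIncl (X : Asm) (S : Set X.carrier) : sub X S ⟶ X :=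
  ⟨Subtype.val, tracked_of_computable Computable.id fun _ _ h => h⟩

/-- Corestriction of an arrow to a subassembly. -/
def subLift {X Z : Asm} (S : Set X.carrier) (f : Z ⟶ X) (h : ∀ z, f.toFun z ∈ S) :
    Z ⟶ sub X S :=
  ⟨fun z => ⟨f.toFun z, h z⟩, f.tracked⟩

instance : CartesianMonoidalCategory Asm :=
  .ofChosenFiniteProducts
    ⟨asEmptyCone unit, IsTerminal.ofUniqueHom toUnit fun _ _ => rfl⟩
    fun X Y => ⟨BinaryFan.mk (prodFst X Y) (prodSnd X Y),
      BinaryFan.IsLimit.mk _ prodLift (fun _ _ => rfl) (fun _ _ => rfl)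
        (by rintro T f g m rfl rfl; rfl)⟩

instance : HasEqualizers Asm :=
  have : ∀ {X Y : Asm} {f g : X ⟶ Y}, HasLimit (parallelPair f g) := fun {X Y f g} =>
    ⟨⟨⟨Fork.ofι (subIncl X {x | f.toFun x = g.toFun x}) (by ext x; exact x.2),
      Fork.IsLimit.mk _
        (fun s => subLift _ s.ι fun z => congrArg (fun h : s.pt ⟶ Y => h.toFun z) s.condition)
        (fun s => rfl)
        (fun s m hm => by
          ext z
          exact Subtype.ext (congrArg (fun h : s.pt ⟶ X => h.toFun z) hm))⟩⟩⟩
  hasEqualizers_of_hasLimit_parallelPair _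

instance : HasPullbacks Asm := hasPullbacks_of_hasBinaryProducts_of_hasEqualizers _

/-- Partitioned assemblies: the realizability relation is single-valued. -/
def IsPartitioned : ObjectProperty Asm := fun X => ∀ x m n, X.rel x m → X.rel x n → m = n

theorem isPartitioned_unit : IsPartitioned unit := by
  rintro _ _ _ rfl rfl
  rfl

theorem isPartitioned_prod {X Y : Asm} (hX : IsPartitioned X) (hY : IsPartitioned Y) :
    IsPartitioned (prod X Y) := by
  rintro x m n ⟨h₁, h₂⟩ ⟨h₃, h₄⟩
  rw [← Nat.pair_unpair m, ← Nat.pair_unpair n, hX _ _ _ h₁ h₃, hY _ _ _ h₂ h₄]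

theorem isPartitioned_sub {X : Asm} (hX : IsPartitioned X) (S : Set X.carrier) :
    IsPartitioned (sub X S) := fun x => hX x.1

end Asm

/-- The full subcategory of `Asm` on the partitioned assemblies. -/
abbrev PAsm : Type 1 := Asm.IsPartitioned.FullSubcategory

namespace PAsm

instance : CartesianMonoidalCategory PAsm :=
  .ofChosenFiniteProducts
    ⟨asEmptyCone ⟨Asm.unit, Asm.isPartitioned_unit⟩,
      IsTerminal.ofUniqueHom (fun X => ObjectProperty.homMk (Asm.toUnit X.obj))
        fun _ _ => rfl⟩
    fun X Y => ⟨BinaryFan.mk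
        (P := (⟨Asm.prod X.obj Y.obj, Asm.isPartitioned_prod X.property Y.property⟩ : PAsm))
        (ObjectProperty.homMk (Asm.prodFst X.obj Y.obj))
        (ObjectProperty.homMk (Asm.prodSnd X.obj Y.obj)),
      BinaryFan.IsLimit.mk _ (fun f g => ObjectProperty.homMk (Asm.prodLift f.hom g.hom))
        (fun _ _ => rfl) (fun _ _ => rfl) (by rintro T f g m rfl rfl; rfl)⟩

instance : HasEqualizers PAsm :=
  have : ∀ {X Y : PAsm} {f g : X ⟶ Y}, HasLimit (parallelPair f g) := fun {X Y f g} =>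
    ⟨⟨⟨Fork.ofι
        (P := (⟨Asm.sub X.obj {x | f.hom.toFun x = g.hom.toFun x},
          Asm.isPartitioned_sub X.property _⟩ : PAsm))
        (ObjectProperty.homMk (Asm.subIncl X.obj {x | f.hom.toFun x = g.hom.toFun x}))
        (by ext x; exact x.2),
      Fork.IsLimit.mk _
        (fun s => ObjectProperty.homMk (Asm.subLift _ s.ι.hom
          fun z => congrArg (fun h : s.pt ⟶ Y => h.hom.toFun z) s.condition))
        (fun s => rfl)
        (fun s m hm => by
          ext z
          exact Subtype.ext (congrArg (fun h : s.pt ⟶ X => h.hom.toFun z) hm))⟩⟩⟩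
  hasEqualizers_of_hasLimit_parallelPair _

instance : HasPullbacks PAsm := hasPullbacks_of_hasBinaryProducts_of_hasEqualizers _

end PAsm

/-! ## The effective topos -/

/-- Objects of the effective topos: a set with an equality predicate valued in sets of numbers,
for which symmetry and transitivity are realized. -/
structure Eff : Type 1 where
  carrier : Type
  eq : carrier → carrier → Set ℕ
  symm : Entails (fun p : carrier × carrier => eq p.1 p.2) fun p => eq p.2 p.1
  trans : Entails
    (fun p : carrier × carrier × carrier => conj (eq p.1 p.2.1) (eq p.2.1 p.2.2))
    fun p => eq p.1 p.2.2

namespace Eff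

/-- Functional relations between objects of the effective topos: strict, extensional,
single-valued and total. -/
structure FunRel (X Y : Eff) : Type where
  rel : X.carrier → Y.carrier → Set ℕ
  strict : Entails (fun p : X.carrier × Y.carrier => rel p.1 p.2)
    fun p => conj (X.eq p.1 p.1) (Y.eq p.2 p.2)
  ext : Entails
    (fun p : (X.carrier × X.carrier) × (Y.carrier × Y.carrier) =>
      conj (rel p.1.1 p.2.1) (conj (X.eq p.1.1 p.1.2) (Y.eq p.2.1 p.2.2)))
    fun p => rel p.1.2 p.2.2
  single : Entails
    (fun p : X.carrier × Y.carrier × Y.carrier => conj (rel p.1 p.2.1) (rel p.1 p.2.2))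
    fun p => Y.eq p.2.1 p.2.2
  total : Entails (fun x : X.carrier => X.eq x x) fun x => exis (rel x)

variable {I : Type} {φ : I → Set ℕ} {X Y Z : Eff}

theorem eq_symm (x x' : I → X.carrier) (h : Entails φ fun i => X.eq (x i) (x' i)) :
    Entails φ fun i => X.eq (x' i) (x i) :=
  h.trans (X.symm.comap fun i => (x i, x' i))

theorem eq_trans (x x' x'' : I → X.carrier) (h : Entails φ fun i => X.eq (x i) (x' i))
    (h' : Entails φ fun i => X.eq (x' i) (x'' i)) : Entails φ fun i => X.eq (x i) (x'' i) :=
  (h.and h').trans (X.trans.comap fun i => (x i, x' i, x'' i))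

theorem eq_left (x x' : I → X.carrier) (h : Entails φ fun i => X.eq (x i) (x' i)) :
    Entails φ fun i => X.eq (x i) (x i) := eq_trans x x' x h (eq_symm x x' h)

theorem eq_right (x x' : I → X.carrier) (h : Entails φ fun i => X.eq (x i) (x' i)) :
    Entails φ fun i => X.eq (x' i) (x' i) := eq_left x' x (eq_symm x x' h)

namespace FunRel

theorem use_left (F : FunRel X Y) (x : I → X.carrier) (y : I → Y.carrier)
    (h : Entails φ fun i => F.rel (x i) (y i)) : Entails φ fun i => X.eq (x i) (x i) :=
  (h.trans (F.strict.comap fun i => (x i, y i))).left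

theorem use_right (F : FunRel X Y) (x : I → X.carrier) (y : I → Y.carrier)
    (h : Entails φ fun i => F.rel (x i) (y i)) : Entails φ fun i => Y.eq (y i) (y i) :=
  (h.trans (F.strict.comap fun i => (x i, y i))).right

theorem use_ext (F : FunRel X Y) (x x' : I → X.carrier) (y y' : I → Y.carrier)
    (h : Entails φ fun i => F.rel (x i) (y i)) (hx : Entails φ fun i => X.eq (x i) (x' i))
    (hy : Entails φ fun i => Y.eq (y i) (y' i)) : Entails φ fun i => F.rel (x' i) (y' i) :=
  (h.and (hx.and hy)).trans (F.ext.comap fun i => ((x i, x' i), (y i, y' i)))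

theorem use_single (F : FunRel X Y) (x : I → X.carrier) (y y' : I → Y.carrier)
    (h : Entails φ fun i => F.rel (x i) (y i)) (h' : Entails φ fun i => F.rel (x i) (y' i)) :
    Entails φ fun i => Y.eq (y i) (y' i) :=
  (h.and h').trans (F.single.comap fun i => (x i, y i, y' i))

theorem use_total (F : FunRel X Y) (x : I → X.carrier)
    (h : Entails φ fun i => X.eq (x i) (x i)) : Entails φ fun i => exis (F.rel (x i)) :=
  h.trans (F.total.comap x)

/-- Functional relations are identified when they entail each other. -/
instance setoid (X Y : Eff) : Setoid (FunRel X Y) where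
  r F G :=
    Entails (fun p : X.carrier × Y.carrier => F.rel p.1 p.2) (fun p => G.rel p.1 p.2) ∧
    Entails (fun p : X.carrier × Y.carrier => G.rel p.1 p.2) (fun p => F.rel p.1 p.2)
  iseqv := ⟨fun _ => ⟨.refl _, .refl _⟩, fun h => ⟨h.2, h.1⟩,
    fun h h' => ⟨h.1.trans h'.1, h'.2.trans h.2⟩⟩

theorem use_equiv {F G : FunRel X Y} (h : F ≈ G) (x : I → X.carrier) (y : I → Y.carrier)
    (h' : Entails φ fun i => F.rel (x i) (y i)) : Entails φ fun i => G.rel (x i) (y i) :=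
  h'.trans (h.1.comap fun i => (x i, y i))

/-- Between functional relations one entailment is enough. -/
theorem equiv_of_entails {F G : FunRel X Y}
    (h : Entails (fun p : X.carrier × Y.carrier => F.rel p.1 p.2) fun p => G.rel p.1 p.2) :
    F ≈ G := by
  refine ⟨h, ?_⟩
  have h₀ := Entails.refl fun p : X.carrier × Y.carrier => G.rel p.1 p.2
  refine (F.use_total _ (G.use_left _ _ h₀)).exis_elim ?_
  have h₁ := Entails.refl fun p : (X.carrier × Y.carrier) × Y.carrier =>
    conj (G.rel p.1.1 p.1.2) (F.rel p.1.1 p.2)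
  have h₂ := h₁.right.trans (h.comap fun p : (X.carrier × Y.carrier) × Y.carrier =>
    (p.1.1, p.2))
  exact F.use_ext _ _ _ _ h₁.right (F.use_left _ _ h₁.right) (G.use_single _ _ _ h₂ h₁.left)

/-- The identity relation is the equality predicate. -/
def id (X : Eff) : FunRel X X where
  rel := X.eq
  strict := by
    have h := Entails.refl fun p : X.carrier × X.carrier => X.eq p.1 p.2
    exact (eq_left _ _ h).and (eq_right _ _ h)
  ext := by
    have h := Entails.refl fun p : (X.carrier × X.carrier) × (X.carrier × X.carrier) =>
      conj (X.eq p.1.1 p.2.1) (conj (X.eq p.1.1 p.1.2) (X.eq p.2.1 p.2.2))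
    exact eq_trans _ _ _ (eq_symm _ _ h.right.left) (eq_trans _ _ _ h.left h.right.right)
  single := by
    have h := Entails.refl fun p : X.carrier × X.carrier × X.carrier =>
      conj (X.eq p.1 p.2.1) (X.eq p.1 p.2.2)
    exact eq_trans _ _ _ (eq_symm _ _ h.left) h.right
  total := (Entails.refl _).exis_intro fun x => x

/-- The relational composite. -/
def comp (F : FunRel X Y) (G : FunRel Y Z) : FunRel X Z where
  rel x z := exis fun y => conj (F.rel x y) (G.rel y z)
  strict := by
    refine (Entails.refl _).exis_elim ?_
    have h := (Entails.refl fun p : (X.carrier × Z.carrier) × Y.carrier =>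
      conj (exis fun y => conj (F.rel p.1.1 y) (G.rel y p.1.2))
        (conj (F.rel p.1.1 p.2) (G.rel p.2 p.1.2))).right
    exact (F.use_left _ _ h.left).and (G.use_right _ _ h.right)
  ext := by
    refine (Entails.refl _).left.exis_elim ?_
    have h := Entails.refl
      fun p : ((X.carrier × X.carrier) × (Z.carrier × Z.carrier)) × Y.carrier =>
      conj (conj (exis fun y => conj (F.rel p.1.1.1 y) (G.rel y p.1.2.1))
        (conj (X.eq p.1.1.1 p.1.1.2) (Z.eq p.1.2.1 p.1.2.2)))
        (conj (F.rel p.1.1.1 p.2) (G.rel p.2 p.1.2.1))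
    refine Entails.exis_intro (fun p => p.2) (.and ?_ ?_)
    · exact F.use_ext _ _ _ _ h.right.left h.left.right.left (F.use_right _ _ h.right.left)
    · exact G.use_ext _ _ _ _ h.right.right (F.use_right _ _ h.right.left) h.left.right.right
  single := by
    refine (Entails.refl _).left.exis_elim ?_
    refine (Entails.refl _).left.right.exis_elim ?_
    have h := Entails.refl
      fun p : ((X.carrier × Z.carrier × Z.carrier) × Y.carrier) × Y.carrier =>
      conj (conj (conj (exis fun y => conj (F.rel p.1.1.1 y) (G.rel y p.1.1.2.1))
          (exis fun y => conj (F.rel p.1.1.1 y) (G.rel y p.1.1.2.2)))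
        (conj (F.rel p.1.1.1 p.1.2) (G.rel p.1.2 p.1.1.2.1)))
        (conj (F.rel p.1.1.1 p.2) (G.rel p.2 p.1.1.2.2))
    have hy := F.use_single _ _ _ h.left.right.left h.right.left
    exact G.use_single _ _ _ (G.use_ext _ _ _ _ h.left.right.right hy
      (G.use_right _ _ h.left.right.right)) h.right.right
  total := by
    refine (F.use_total _ (Entails.refl _)).exis_elim ?_
    have h₀ := (Entails.refl fun p : X.carrier × Y.carrier =>
      conj (X.eq p.1 p.1) (F.rel p.1 p.2)).right
    refine (G.use_total _ (F.use_right _ _ h₀)).exis_elim ?_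
    have h := Entails.refl fun p : (X.carrier × Y.carrier) × Z.carrier =>
      conj (conj (X.eq p.1.1 p.1.1) (F.rel p.1.1 p.1.2)) (G.rel p.1.2 p.2)
    exact Entails.exis_intro (fun p => p.2)
      (Entails.exis_intro (fun p => p.1.2) (h.left.right.and h.right))

theorem comp_entails (F : FunRel X Y) (G : FunRel Y Z) (x : I → X.carrier) (y : I → Y.carrier)
    (z : I → Z.carrier) (h : Entails φ fun i => F.rel (x i) (y i))
    (h' : Entails φ fun i => G.rel (y i) (z i)) :
    Entails φ fun i => (F.comp G).rel (x i) (z i) :=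
  Entails.exis_intro y (h.and h')

/-- To bound a composite it is enough to bound its witnesses. -/
theorem comp_equiv {F : FunRel X Y} {G : FunRel Y Z} {H : FunRel X Z}
    (h : Entails (fun p : (X.carrier × Z.carrier) × Y.carrier =>
      conj (F.rel p.1.1 p.2) (G.rel p.2 p.1.2)) fun p => H.rel p.1.1 p.1.2) :
    F.comp G ≈ H :=
  equiv_of_entails ((Entails.refl _).exis_elim ((Entails.refl _).right.trans h))

theorem comp_congr {F F' : FunRel X Y} {G G' : FunRel Y Z} (hF : F ≈ F') (hG : G ≈ G') :
    F.comp G ≈ F'.comp G' := by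
  refine comp_equiv ?_
  have h := Entails.refl fun p : (X.carrier × Z.carrier) × Y.carrier =>
    conj (F.rel p.1.1 p.2) (G.rel p.2 p.1.2)
  exact comp_entails _ _ _ _ _ (use_equiv hF _ _ h.left) (use_equiv hG _ _ h.right)

end FunRel

/-- Arrows of the effective topos are equivalence classes of functional relations. -/
instance : Category Eff where
  Hom X Y := Quotient (FunRel.setoid X Y)
  id X := Quotient.mk _ (FunRel.id X)
  comp := Quotient.map₂ FunRel.comp fun _ _ h _ _ h' => FunRel.comp_congr h h'
  id_comp {X Y} f := by
    induction f using Quotient.inductionOn with | _ F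
    refine Quotient.sound (FunRel.comp_equiv ?_)
    have h := Entails.refl fun p : (X.carrier × Y.carrier) × X.carrier =>
      conj ((FunRel.id X).rel p.1.1 p.2) (F.rel p.2 p.1.2)
    exact F.use_ext _ _ _ _ h.right (eq_symm _ _ h.left) (F.use_right _ _ h.right)
  comp_id {X Y} f := by
    induction f using Quotient.inductionOn with | _ F
    refine Quotient.sound (FunRel.comp_equiv ?_)
    have h := Entails.refl fun p : (X.carrier × Y.carrier) × Y.carrier =>
      conj (F.rel p.1.1 p.2) ((FunRel.id Y).rel p.2 p.1.2)
    exact F.use_ext _ _ _ _ h.left (F.use_left _ _ h.left) h.right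
  assoc {W X Y Z} f g k := by
    induction f using Quotient.inductionOn with | _ F
    induction g using Quotient.inductionOn with | _ G
    induction k using Quotient.inductionOn with | _ K
    refine Quotient.sound (FunRel.comp_equiv ?_)
    refine (Entails.refl _).left.exis_elim ?_
    have h := Entails.refl fun p : ((W.carrier × Z.carrier) × Y.carrier) × X.carrier =>
      conj (conj ((F.comp G).rel p.1.1.1 p.1.2) (K.rel p.1.2 p.1.1.2))
        (conj (F.rel p.1.1.1 p.2) (G.rel p.2 p.1.2))
    exact FunRel.comp_entails _ _ _ _ _ h.right.left
      (FunRel.comp_entails _ _ _ _ _ h.right.right h.left.right)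

/-- The arrow represented by a functional relation. -/
def FunRel.toHom (F : FunRel X Y) : X ⟶ Y := Quotient.mk _ F

theorem exists_toHom_eq (f : X ⟶ Y) : ∃ F : FunRel X Y, F.toHom = f := Quotient.exists_rep f

theorem toHom_eq_iff {F G : FunRel X Y} : F.toHom = G.toHom ↔ F ≈ G := Quotient.eq

theorem toHom_comp (F : FunRel X Y) (G : FunRel Y Z) :
    F.toHom ≫ G.toHom = (F.comp G).toHom := rfl

/-- The terminal object. -/
def unit : Eff where
  carrier := Unit
  eq _ _ := Set.univ
  symm := .of_subset fun _ _ _ => trivial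
  trans := .of_subset fun _ _ _ => trivial

/-- The relation from an object to the terminal object. -/
def toUnit (X : Eff) : FunRel X unit where
  rel x _ := X.eq x x
  strict := (Entails.refl _).and (.of_subset fun _ _ _ => trivial)
  ext := eq_right _ _ (Entails.refl _).right.left
  single := .of_subset fun _ _ _ => trivial
  total := Entails.exis_intro (fun _ => ()) (.refl _)

/-- The product of two objects. -/
def prod (X Y : Eff) : Eff where
  carrier := X.carrier × Y.carrier
  eq p q := conj (X.eq p.1 q.1) (Y.eq p.2 q.2)
  symm := by
    have h := Entails.refl fun p : (X.carrier × Y.carrier) × (X.carrier × Y.carrier) =>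
      conj (X.eq p.1.1 p.2.1) (Y.eq p.1.2 p.2.2)
    exact (eq_symm _ _ h.left).and (eq_symm _ _ h.right)
  trans := by
    have h := Entails.refl
      fun p : (X.carrier × Y.carrier) × (X.carrier × Y.carrier) × (X.carrier × Y.carrier) =>
      conj (conj (X.eq p.1.1 p.2.1.1) (Y.eq p.1.2 p.2.1.2))
        (conj (X.eq p.2.1.1 p.2.2.1) (Y.eq p.2.1.2 p.2.2.2))
    exact (eq_trans _ _ _ h.left.left h.right.left).and
      (eq_trans _ _ _ h.left.right h.right.right)

/-- The first projection. -/
def prodFst (X Y : Eff) : FunRel (prod X Y) X where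
  rel p x := conj (X.eq p.1 x) (Y.eq p.2 p.2)
  strict := by
    have h := Entails.refl fun p : (X.carrier × Y.carrier) × X.carrier =>
      conj (X.eq p.1.1 p.2) (Y.eq p.1.2 p.1.2)
    exact ((eq_left _ _ h.left).and h.right).and (eq_right _ _ h.left)
  ext := by
    have h := Entails.refl
      fun p : ((X.carrier × Y.carrier) × (X.carrier × Y.carrier)) × (X.carrier × X.carrier) =>
      conj (conj (X.eq p.1.1.1 p.2.1) (Y.eq p.1.1.2 p.1.1.2))
        (conj (conj (X.eq p.1.1.1 p.1.2.1) (Y.eq p.1.1.2 p.1.2.2)) (X.eq p.2.1 p.2.2))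
    exact (eq_trans _ _ _ (eq_symm _ _ h.right.left.left)
      (eq_trans _ _ _ h.left.left h.right.right)).and (eq_right _ _ h.right.left.right)
  single := by
    have h := Entails.refl fun p : (X.carrier × Y.carrier) × X.carrier × X.carrier =>
      conj (conj (X.eq p.1.1 p.2.1) (Y.eq p.1.2 p.1.2))
        (conj (X.eq p.1.1 p.2.2) (Y.eq p.1.2 p.1.2))
    exact eq_trans _ _ _ (eq_symm _ _ h.left.left) h.right.left
  total := Entails.exis_intro (fun p => p.1) (.refl _)

/-- The second projection. -/
def prodSnd (X Y : Eff) : FunRel (prod X Y) Y where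
  rel p y := conj (X.eq p.1 p.1) (Y.eq p.2 y)
  strict := by
    have h := Entails.refl fun p : (X.carrier × Y.carrier) × Y.carrier =>
      conj (X.eq p.1.1 p.1.1) (Y.eq p.1.2 p.2)
    exact (h.left.and (eq_left _ _ h.right)).and (eq_right _ _ h.right)
  ext := by
    have h := Entails.refl
      fun p : ((X.carrier × Y.carrier) × (X.carrier × Y.carrier)) × (Y.carrier × Y.carrier) =>
      conj (conj (X.eq p.1.1.1 p.1.1.1) (Y.eq p.1.1.2 p.2.1))
        (conj (conj (X.eq p.1.1.1 p.1.2.1) (Y.eq p.1.1.2 p.1.2.2)) (Y.eq p.2.1 p.2.2))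
    exact (eq_right _ _ h.right.left.left).and (eq_trans _ _ _
      (eq_symm _ _ h.right.left.right) (eq_trans _ _ _ h.left.right h.right.right))
  single := by
    have h := Entails.refl fun p : (X.carrier × Y.carrier) × Y.carrier × Y.carrier =>
      conj (conj (X.eq p.1.1 p.1.1) (Y.eq p.1.2 p.2.1))
        (conj (X.eq p.1.1 p.1.1) (Y.eq p.1.2 p.2.2))
    exact eq_trans _ _ _ (eq_symm _ _ h.left.right) h.right.right
  total := Entails.exis_intro (fun p => p.2) (.refl _)

/-- The pairing of two functional relations. -/
def prodLift (F : FunRel Z X) (G : FunRel Z Y) : FunRel Z (prod X Y) where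
  rel z p := conj (F.rel z p.1) (G.rel z p.2)
  strict := by
    have h := Entails.refl fun p : Z.carrier × (X.carrier × Y.carrier) =>
      conj (F.rel p.1 p.2.1) (G.rel p.1 p.2.2)
    exact (F.use_left _ _ h.left).and ((F.use_right _ _ h.left).and (G.use_right _ _ h.right))
  ext := by
    have h := Entails.refl
      fun p : (Z.carrier × Z.carrier) × ((X.carrier × Y.carrier) × (X.carrier × Y.carrier)) =>
      conj (conj (F.rel p.1.1 p.2.1.1) (G.rel p.1.1 p.2.1.2))
        (conj (Z.eq p.1.1 p.1.2) (conj (X.eq p.2.1.1 p.2.2.1) (Y.eq p.2.1.2 p.2.2.2)))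
    exact (F.use_ext _ _ _ _ h.left.left h.right.left h.right.right.left).and
      (G.use_ext _ _ _ _ h.left.right h.right.left h.right.right.right)
  single := by
    have h := Entails.refl
      fun p : Z.carrier × (X.carrier × Y.carrier) × (X.carrier × Y.carrier) =>
      conj (conj (F.rel p.1 p.2.1.1) (G.rel p.1 p.2.1.2))
        (conj (F.rel p.1 p.2.2.1) (G.rel p.1 p.2.2.2))
    exact (F.use_single _ _ _ h.left.left h.right.left).and
      (G.use_single _ _ _ h.left.right h.right.right)
  total := by
    refine (F.use_total _ (Entails.refl _)).exis_elim ?_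
    refine (G.use_total _ (Entails.refl _).left).exis_elim ?_
    have h := Entails.refl fun p : (Z.carrier × X.carrier) × Y.carrier =>
      conj (conj (Z.eq p.1.1 p.1.1) (F.rel p.1.1 p.1.2)) (G.rel p.1.1 p.2)
    exact Entails.exis_intro (fun p => (p.1.2, p.2)) (h.left.right.and h.right)

theorem prodLift_fst (F : FunRel Z X) (G : FunRel Z Y) :
    (prodLift F G).comp (prodFst X Y) ≈ F := by
  refine FunRel.comp_equiv ?_
  have h := Entails.refl fun p : (Z.carrier × X.carrier) × (X.carrier × Y.carrier) =>
    conj (conj (F.rel p.1.1 p.2.1) (G.rel p.1.1 p.2.2))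
      (conj (X.eq p.2.1 p.1.2) (Y.eq p.2.2 p.2.2))
  exact F.use_ext _ _ _ _ h.left.left (F.use_left _ _ h.left.left) h.right.left

theorem prodLift_snd (F : FunRel Z X) (G : FunRel Z Y) :
    (prodLift F G).comp (prodSnd X Y) ≈ G := by
  refine FunRel.comp_equiv ?_
  have h := Entails.refl fun p : (Z.carrier × Y.carrier) × (X.carrier × Y.carrier) =>
    conj (conj (F.rel p.1.1 p.2.1) (G.rel p.1.1 p.2.2))
      (conj (X.eq p.2.1 p.2.1) (Y.eq p.2.2 p.1.2))
  exact G.use_ext _ _ _ _ h.left.right (G.use_left _ _ h.left.right) h.right.right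

theorem equiv_prodLift (H : FunRel Z (prod X Y)) :
    H ≈ prodLift (H.comp (prodFst X Y)) (H.comp (prodSnd X Y)) := by
  refine FunRel.equiv_of_entails ?_
  have h := Entails.refl fun p : Z.carrier × (X.carrier × Y.carrier) => H.rel p.1 p.2
  have h' := H.use_right _ _ h
  exact (FunRel.comp_entails _ _ _ _ _ h h').and (FunRel.comp_entails _ _ _ _ _ h h')

theorem prodLift_congr {F F' : FunRel Z X} {G G' : FunRel Z Y} (hF : F ≈ F') (hG : G ≈ G') :
    prodLift F G ≈ prodLift F' G' := by
  refine FunRel.equiv_of_entails ?_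
  have h := Entails.refl fun p : Z.carrier × (X.carrier × Y.carrier) =>
    conj (F.rel p.1 p.2.1) (G.rel p.1 p.2.2)
  exact (FunRel.use_equiv hF _ _ h.left).and (FunRel.use_equiv hG _ _ h.right)

instance : CartesianMonoidalCategory Eff :=
  .ofChosenFiniteProducts
    ⟨asEmptyCone unit, IsTerminal.ofUniqueHom (fun X => (toUnit X).toHom) fun X m => by
      induction m using Quotient.inductionOn with | _ F
      refine Quotient.sound (FunRel.equiv_of_entails ?_)
      exact F.use_left Prod.fst Prod.snd (.refl _)⟩
    fun X Y => ⟨BinaryFan.mk (prodFst X Y).toHom (prodSnd X Y).toHom,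
      BinaryFan.IsLimit.mk _
        (Quotient.map₂ prodLift fun _ _ h _ _ h' => prodLift_congr h h')
        (fun f g => by
          induction f using Quotient.inductionOn with | _ F
          induction g using Quotient.inductionOn with | _ G
          exact Quotient.sound (prodLift_fst F G))
        (fun f g => by
          induction f using Quotient.inductionOn with | _ F
          induction g using Quotient.inductionOn with | _ G
          exact Quotient.sound (prodLift_snd F G))
        (by
          rintro T f g m rfl rfl
          induction m using Quotient.inductionOn with | _ H
          exact Quotient.sound (equiv_prodLift H))⟩

/-- The object on which two functional relations agree. -/
def equalizer (F G : FunRel X Y) : Eff where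
  carrier := X.carrier
  eq x x' := conj (X.eq x x') (exis fun y => conj (F.rel x y) (G.rel x y))
  symm := by
    refine (Entails.refl _).right.exis_elim ?_
    have h := Entails.refl fun p : (X.carrier × X.carrier) × Y.carrier =>
      conj (conj (X.eq p.1.1 p.1.2) (exis fun y => conj (F.rel p.1.1 y) (G.rel p.1.1 y)))
        (conj (F.rel p.1.1 p.2) (G.rel p.1.1 p.2))
    refine (eq_symm _ _ h.left.left).and (Entails.exis_intro (fun p => p.2) ?_)
    exact (F.use_ext _ _ _ _ h.right.left h.left.left (F.use_right _ _ h.right.left)).and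
      (G.use_ext _ _ _ _ h.right.right h.left.left (G.use_right _ _ h.right.right))
  trans := by
    have h := Entails.refl fun p : X.carrier × X.carrier × X.carrier =>
      conj (conj (X.eq p.1 p.2.1) (exis fun y => conj (F.rel p.1 y) (G.rel p.1 y)))
        (conj (X.eq p.2.1 p.2.2) (exis fun y => conj (F.rel p.2.1 y) (G.rel p.2.1 y)))
    exact (eq_trans _ _ _ h.left.left h.right.left).and h.left.right

/-- The inclusion of the equalizer. -/
def equalizerIncl (F G : FunRel X Y) : FunRel (equalizer F G) X where
  rel := (equalizer F G).eq
  strict := by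
    have h := Entails.refl fun p : X.carrier × X.carrier => (equalizer F G).eq p.1 p.2
    exact (eq_left (X := equalizer F G) _ _ h).and (eq_right _ _ h.left)
  ext := by
    have h := Entails.refl fun p : (X.carrier × X.carrier) × (X.carrier × X.carrier) =>
      conj ((equalizer F G).eq p.1.1 p.2.1)
        (conj ((equalizer F G).eq p.1.1 p.1.2) (X.eq p.2.1 p.2.2))
    have h' := eq_symm (X := equalizer F G) _ _ h.right.left
    exact (eq_trans _ _ _ h'.left (eq_trans _ _ _ h.left.left h.right.right)).and h'.right
  single := by
    have h := Entails.refl fun p : X.carrier × X.carrier × X.carrier =>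
      conj ((equalizer F G).eq p.1 p.2.1) ((equalizer F G).eq p.1 p.2.2)
    exact eq_trans _ _ _ (eq_symm _ _ h.left.left) h.right.left
  total := Entails.exis_intro (fun x => x) (.refl _)

theorem equalizer_condition (F G : FunRel X Y) :
    (equalizerIncl F G).comp F ≈ (equalizerIncl F G).comp G := by
  refine FunRel.comp_equiv ?_
  refine (Entails.refl _).left.right.exis_elim ?_
  have h := Entails.refl fun p : ((X.carrier × Y.carrier) × X.carrier) × Y.carrier =>
    conj (conj ((equalizer F G).eq p.1.1.1 p.1.2) (F.rel p.1.2 p.1.1.2))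
      (conj (F.rel p.1.1.1 p.2) (G.rel p.1.1.1 p.2))
  have hx := h.left.left.left
  have hF := F.use_ext _ _ _ _ h.right.left hx (F.use_right _ _ h.right.left)
  have hy := F.use_single _ _ _ hF h.left.right
  have hG := G.use_ext _ _ _ _ h.right.right hx hy
  exact FunRel.comp_entails _ _ _ _ _ h.left.left hG

/-- Factorization of a functional relation through the equalizer. -/
def equalizerLift (F G : FunRel X Y) (H : FunRel Z X) (hH : H.comp F ≈ H.comp G) :
    FunRel Z (equalizer F G) where
  rel := H.rel
  strict := by
    have h := Entails.refl fun p : Z.carrier × X.carrier => H.rel p.1 p.2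
    refine (H.use_left _ _ h).and ((H.use_right _ _ h).and ?_)
    refine (F.use_total _ (H.use_right _ _ h)).exis_elim ?_
    have h₁ := Entails.refl fun p : (Z.carrier × X.carrier) × Y.carrier =>
      conj (H.rel p.1.1 p.1.2) (F.rel p.1.2 p.2)
    have h₂ := FunRel.use_equiv hH _ _ (FunRel.comp_entails _ _ _ _ _ h₁.left h₁.right)
    refine h₂.exis_elim ?_
    have h₃ := Entails.refl fun p : ((Z.carrier × X.carrier) × Y.carrier) × X.carrier =>
      conj (conj (H.rel p.1.1.1 p.1.1.2) (F.rel p.1.1.2 p.1.2))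
        (conj (H.rel p.1.1.1 p.2) (G.rel p.2 p.1.2))
    have hx := H.use_single _ _ _ h₃.right.left h₃.left.left
    refine Entails.exis_intro (fun p => p.1.2) (h₃.left.right.and ?_)
    exact G.use_ext _ _ _ _ h₃.right.right hx (G.use_right _ _ h₃.right.right)
  ext := by
    have h := Entails.refl fun p : (Z.carrier × Z.carrier) × (X.carrier × X.carrier) =>
      conj (H.rel p.1.1 p.2.1) (conj (Z.eq p.1.1 p.1.2) ((equalizer F G).eq p.2.1 p.2.2))
    exact H.use_ext _ _ _ _ h.left h.right.left h.right.right.left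
  single := by
    have h := Entails.refl fun p : Z.carrier × X.carrier × X.carrier =>
      conj (H.rel p.1 p.2.1) (H.rel p.1 p.2.2)
    refine (H.use_single _ _ _ h.left h.right).and ?_
    refine (F.use_total _ (H.use_right _ _ h.left)).exis_elim ?_
    have h₁ := Entails.refl fun p : (Z.carrier × X.carrier × X.carrier) × Y.carrier =>
      conj (conj (H.rel p.1.1 p.1.2.1) (H.rel p.1.1 p.1.2.2)) (F.rel p.1.2.1 p.2)
    have h₂ := FunRel.use_equiv hH _ _ (FunRel.comp_entails _ _ _ _ _ h₁.left.left h₁.right)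
    refine h₂.exis_elim ?_
    have h₃ := Entails.refl
      fun p : ((Z.carrier × X.carrier × X.carrier) × Y.carrier) × X.carrier =>
      conj (conj (conj (H.rel p.1.1.1 p.1.1.2.1) (H.rel p.1.1.1 p.1.1.2.2))
        (F.rel p.1.1.2.1 p.1.2)) (conj (H.rel p.1.1.1 p.2) (G.rel p.2 p.1.2))
    have hx := H.use_single _ _ _ h₃.right.left h₃.left.left.left
    refine Entails.exis_intro (fun p => p.1.2) (h₃.left.right.and ?_)
    exact G.use_ext _ _ _ _ h₃.right.right hx (G.use_right _ _ h₃.right.right)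
  total := H.total

theorem equalizerLift_incl (F G : FunRel X Y) (H : FunRel Z X) (hH : H.comp F ≈ H.comp G) :
    (equalizerLift F G H hH).comp (equalizerIncl F G) ≈ H := by
  refine FunRel.comp_equiv ?_
  have h := Entails.refl fun p : (Z.carrier × X.carrier) × X.carrier =>
    conj (H.rel p.1.1 p.2) ((equalizer F G).eq p.2 p.1.2)
  exact H.use_ext _ _ _ _ h.left (H.use_left _ _ h.left) h.right.left

theorem equalizerIncl_mono (F G : FunRel X Y) : Mono (equalizerIncl F G).toHom where
  right_cancellation {Z} f g hfg := by
    induction f using Quotient.inductionOn with | _ H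
    induction g using Quotient.inductionOn with | _ K
    refine Quotient.sound (FunRel.equiv_of_entails ?_)
    have hfg' : H.comp (equalizerIncl F G) ≈ K.comp (equalizerIncl F G) := Quotient.exact hfg
    have h := Entails.refl fun p : Z.carrier × X.carrier => H.rel p.1 p.2
    have h' := FunRel.use_equiv hfg' _ _ (FunRel.comp_entails _ _ _ _ _ h (H.use_right _ _ h))
    refine h'.exis_elim ?_
    have h₁ := Entails.refl fun p : (Z.carrier × X.carrier) × X.carrier =>
      conj (H.rel p.1.1 p.1.2) (conj (K.rel p.1.1 p.2) ((equalizer F G).eq p.2 p.1.2))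
    exact K.use_ext _ _ _ _ h₁.right.left (K.use_left _ _ h₁.right.left) h₁.right.right

instance : HasEqualizers Eff :=
  have : ∀ {X Y : Eff} {f g : X ⟶ Y}, HasLimit (parallelPair f g) := fun {X Y f g} => by
    obtain ⟨F, rfl⟩ := exists_toHom_eq f
    obtain ⟨G, rfl⟩ := exists_toHom_eq g
    have := equalizerIncl_mono F G
    refine ⟨⟨⟨Fork.ofι (equalizerIncl F G).toHom
      (Quotient.sound (equalizer_condition F G)), Fork.IsLimit.mk' _ fun s => ?_⟩⟩⟩
    have hs : ∃ l : s.pt ⟶ equalizer F G, l ≫ (equalizerIncl F G).toHom = s.ι := by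
      obtain ⟨H, hH⟩ := exists_toHom_eq s.ι
      have hc := s.condition
      rw [← hH] at hc
      exact ⟨(equalizerLift F G H (Quotient.exact hc)).toHom,
        (Quotient.sound (equalizerLift_incl F G H _)).trans hH⟩
    exact ⟨hs.choose, hs.choose_spec, fun {m} hm => by
      rw [← cancel_mono (equalizerIncl F G).toHom]
      exact hm.trans hs.choose_spec.symm⟩
  hasEqualizers_of_hasLimit_parallelPair _

instance : HasPullbacks Eff := hasPullbacks_of_hasBinaryProducts_of_hasEqualizers _

end Eff

/-! ## Doctrines -/

section Doctrine

variable {C : Type u} [Category.{v} C]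

/-- Primary doctrines: contravariant functors to inf-semilattices with top. -/
abbrev Doctrine (C : Type u) [Category.{v} C] := Cᵒᵖ ⥤ SemilatInfCat.{w}

/-- The fibre of a doctrine. -/
abbrev Doctrine.Fib (P : Doctrine.{w} C) (A : C) : Type w := P.obj (op A)

/-- Reindexing (substitution) along an arrow. -/
def Doctrine.sub (P : Doctrine.{w} C) {A B : C} (f : A ⟶ B) : P.Fib B → P.Fib A :=
  fun α => (P.map f.op : InfTopHom (P.obj (op B)) (P.obj (op A))) α

/-- The doctrine of subobjects. -/
noncomputable def subobjectDoctrine (C : Type u) [Category.{v} C] [HasPullbacks C] :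
    Doctrine.{max u v} C where
  obj A := .of (Subobject A.unop)
  map f := (⟨⟨(Subobject.pullback f.unop).obj, fun a b => Subobject.inf_pullback f.unop a b⟩,
    Subobject.pullback_top f.unop⟩ : InfTopHom (Subobject _) (Subobject _))
  map_id _ := InfTopHom.ext fun x => Subobject.pullback_id x
  map_comp f g := InfTopHom.ext fun x => Subobject.pullback_comp g.unop f.unop x

theorem strongMono_of_isPullback {X Y Z W : C} {f : X ⟶ Y} {g : X ⟶ Z} {h : Y ⟶ W} {k : Z ⟶ W}
    (sq : IsPullback f g h k) (hh : StrongMono h) : StrongMono g where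
  mono := by
    have := hh.mono
    exact (MorphismProperty.monomorphisms C).of_isPullback sq this
  rlp _ _ z hz :=
    (MorphismProperty.epimorphisms C).rlp.of_isPullback sq (fun _ _ z hz => hh.rlp z) z hz

/-- The strong subobjects of an object: those represented by strong monomorphisms. -/
def StrongSubobject (A : C) : Type max u v := {S : Subobject A // StrongMono S.arrow}

theorem strongMono_top (A : C) : StrongMono (⊤ : Subobject A).arrow := inferInstance

variable [HasPullbacks C]

theorem strongMono_inf {A : C} (S T : Subobject A) (hS : StrongMono S.arrow)
    (hT : StrongMono T.arrow) : StrongMono (S ⊓ T).arrow := by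
  have h := strongMono_of_isPullback (Subobject.inf_isPullback S T) hS
  rw [← Subobject.inf_comp_right]
  infer_instance

noncomputable instance (A : C) : SemilatticeInf (StrongSubobject A) :=
  Subtype.semilatticeInf fun {S T} hS hT => strongMono_inf S T hS hT

noncomputable instance (A : C) : OrderTop (StrongSubobject A) where
  top := ⟨⊤, strongMono_top A⟩
  le_top S := (le_top : S.1 ≤ ⊤)

/-- The doctrine of strong subobjects. -/
noncomputable def strongSubobjectDoctrine (C : Type u) [Category.{v} C] [HasPullbacks C] :
    Doctrine.{max u v} C where
  obj A := .of (StrongSubobject A.unop)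
  map f := (⟨⟨fun S => ⟨(Subobject.pullback f.unop).obj S.1,
      strongMono_of_isPullback (Subobject.isPullback f.unop S.1) S.2⟩,
      fun S T => Subtype.ext (Subobject.inf_pullback f.unop S.1 T.1)⟩,
      Subtype.ext (Subobject.pullback_top f.unop)⟩ :
    InfTopHom (StrongSubobject _) (StrongSubobject _))
  map_id _ := InfTopHom.ext fun S => Subtype.ext (Subobject.pullback_id S.1)
  map_comp f g := InfTopHom.ext fun S => Subtype.ext (Subobject.pullback_comp g.unop f.unop S.1)

end Doctrine

section Variation

variable {C : Type u} [Category.{v} C]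

/-- The objects of the comma category over `A`, preordered by factorization: `f ≤ g` when `f`
factors through `g`. -/
def ArrowsInto (A : C) : Type max u v := Over A

namespace ArrowsInto

/-- The arrow underlying an object of the comma category. -/
def toOver {A : C} (f : ArrowsInto A) : Over A := f

instance (A : C) : Preorder (ArrowsInto A) where
  le f g := Nonempty (f.toOver ⟶ g.toOver)
  le_refl f := ⟨𝟙 f.toOver⟩
  le_trans _ _ _ := fun ⟨a⟩ ⟨b⟩ => ⟨a ≫ b⟩

theorem le_iff {A : C} {f g : ArrowsInto A} :
    f ≤ g ↔ ∃ k : f.toOver.left ⟶ g.toOver.left, k ≫ g.toOver.hom = f.toOver.hom := by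
  constructor
  · rintro ⟨k⟩
    exact ⟨k.left, Over.w k⟩
  · rintro ⟨k, hk⟩
    exact ⟨Over.homMk k hk⟩

/-- Postcomposition with an arrow. -/
def push {A B : C} (k : A ⟶ B) (f : ArrowsInto A) : ArrowsInto B :=
  Over.mk (f.toOver.hom ≫ k)

theorem push_comp {A B D : C} (k : A ⟶ B) (l : B ⟶ D) (f : ArrowsInto A) :
    push (k ≫ l) f = push l (push k f) :=
  congrArg Over.mk (Category.assoc _ _ _).symm

theorem push_id {A : C} (f : ArrowsInto A) : push (𝟙 A) f = f :=
  (congrArg Over.mk (Category.comp_id _)).trans rfl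

/-- The identity arrow. -/
def top (A : C) : ArrowsInto A := Over.mk (𝟙 A)

theorem le_top {A : C} (f : ArrowsInto A) : f ≤ top A :=
  le_iff.2 ⟨f.toOver.hom, Category.comp_id _⟩

variable [HasPullbacks C]

/-- Reindexing by pullback. -/
noncomputable def pull {A B : C} (k : A ⟶ B) (f : ArrowsInto B) : ArrowsInto A :=
  Over.mk (pullback.snd f.toOver.hom k)

/-- The meet: the diagonal of the pullback square. -/
noncomputable def meet {A : C} (f g : ArrowsInto A) : ArrowsInto A :=
  push g.toOver.hom (pull g.toOver.hom f)

theorem le_pull_iff {A B : C} (k : A ⟶ B) (f : ArrowsInto A) (g : ArrowsInto B) :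
    f ≤ pull k g ↔ push k f ≤ g := by
  rw [le_iff, le_iff]
  constructor
  · rintro ⟨l, hl⟩
    exact ⟨l ≫ pullback.fst g.toOver.hom k, (Category.assoc _ _ _).trans
      ((congrArg (l ≫ ·) pullback.condition).trans
        ((Category.assoc _ _ _).symm.trans (congrArg (· ≫ k) hl)))⟩
  · rintro ⟨l, hl⟩
    exact ⟨pullback.lift l f.toOver.hom hl, pullback.lift_snd _ _ _⟩

theorem le_meet_iff {A : C} (f g h : ArrowsInto A) : h ≤ meet f g ↔ h ≤ f ∧ h ≤ g := by
  constructor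
  · intro hh
    refine ⟨hh.trans ((le_pull_iff _ _ _).1 le_rfl), hh.trans (le_iff.2 ⟨_, rfl⟩)⟩
  · rintro ⟨hf, hg⟩
    obtain ⟨l, hl⟩ := le_iff.1 hf
    obtain ⟨m, hm⟩ := le_iff.1 hg
    exact le_iff.2 ⟨pullback.lift l m (hl.trans hm.symm),
      (pullback.lift_snd_assoc _ _ _ _).trans hm⟩

theorem pull_mono {A B : C} (k : A ⟶ B) : Monotone (pull k) := fun f _ h =>
  (le_pull_iff _ _ _).2 (((le_pull_iff k (pull k f) f).1 le_rfl).trans h)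

end ArrowsInto

/-- The variations of `A`: the poset reflection of the comma category over `A`. -/
abbrev Variation (A : C) : Type max u v := Antisymmetrization (ArrowsInto A) (· ≤ ·)

theorem Variation.eq_of_forall {A : C} {α β : Variation A}
    (h : ∀ f : ArrowsInto A, toAntisymmetrization (· ≤ ·) f ≤ α ↔
      toAntisymmetrization (· ≤ ·) f ≤ β) : α = β := by
  obtain ⟨a⟩ := α
  obtain ⟨b⟩ := β
  exact le_antisymm ((h a).1 le_rfl) ((h b).2 le_rfl)

instance (A : C) : OrderTop (Variation A) where
  top := toAntisymmetrization _ (ArrowsInto.top A)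
  le_top := by
    rintro ⟨f⟩
    exact ArrowsInto.le_top f

variable [HasPullbacks C]

noncomputable instance (A : C) : SemilatticeInf (Variation A) where
  inf := Quotient.map₂ ArrowsInto.meet fun f f' hf g g' hg => by
    constructor
    · have h := (ArrowsInto.le_meet_iff f g _).1 le_rfl
      exact (ArrowsInto.le_meet_iff _ _ _).2 ⟨h.1.trans hf.1, h.2.trans hg.1⟩
    · have h := (ArrowsInto.le_meet_iff f' g' _).1 le_rfl
      exact (ArrowsInto.le_meet_iff _ _ _).2 ⟨h.1.trans hf.2, h.2.trans hg.2⟩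
  inf_le_left := by
    rintro ⟨f⟩ ⟨g⟩
    exact ((ArrowsInto.le_meet_iff f g _).1 le_rfl).1
  inf_le_right := by
    rintro ⟨f⟩ ⟨g⟩
    exact ((ArrowsInto.le_meet_iff f g _).1 le_rfl).2
  le_inf := by
    rintro ⟨f⟩ ⟨g⟩ ⟨h⟩ hg hh
    exact (ArrowsInto.le_meet_iff g h f).2 ⟨hg, hh⟩

/-- Reindexing of variations. -/
noncomputable def Variation.pull {A B : C} (k : A ⟶ B) : Variation B → Variation A :=
  Quotient.map (ArrowsInto.pull k) fun _ _ h =>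
    ⟨ArrowsInto.pull_mono k h.1, ArrowsInto.pull_mono k h.2⟩

/-- Reindexing is right adjoint to postcomposition. -/
theorem Variation.le_pull_iff {A B : C} (k : A ⟶ B) (f : ArrowsInto A) (α : Variation B) :
    toAntisymmetrization (· ≤ ·) f ≤ Variation.pull k α ↔
      toAntisymmetrization (· ≤ ·) (f.push k) ≤ α := by
  obtain ⟨g⟩ := α
  exact ArrowsInto.le_pull_iff k f g

/-- The doctrine of variations. -/
noncomputable def variationDoctrine (C : Type u) [Category.{v} C] [HasPullbacks C] :
    Doctrine.{max u v} C where
  obj A := .of (Variation A.unop)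
  map k := (⟨⟨Variation.pull k.unop, fun α β => Variation.eq_of_forall fun f => by
      rw [le_inf_iff, Variation.le_pull_iff, Variation.le_pull_iff, Variation.le_pull_iff,
        le_inf_iff]⟩,
      top_unique ((Variation.le_pull_iff _ _ _).2 le_top)⟩ :
    InfTopHom (Variation _) (Variation _))
  map_id A := InfTopHom.ext fun α => Variation.eq_of_forall fun f => by
    change _ ≤ Variation.pull (𝟙 A.unop) α ↔ _ ≤ α
    rw [Variation.le_pull_iff, ArrowsInto.push_id]
  map_comp k l := InfTopHom.ext fun α => Variation.eq_of_forall fun f => by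
    change _ ≤ Variation.pull (l.unop ≫ k.unop) α ↔
      _ ≤ Variation.pull l.unop (Variation.pull k.unop α)
    rw [Variation.le_pull_iff, Variation.le_pull_iff, Variation.le_pull_iff,
      ArrowsInto.push_comp]

end Variation

/-! ## Primitive recursive terms and Kleene's predicate -/

/-- Terms for primitive recursive functions, by number of arguments. -/
inductive PrimrecTerm : ℕ → Type
  | zero : PrimrecTerm 0
  | succ : PrimrecTerm 1
  | proj {n : ℕ} (i : Fin n) : PrimrecTerm n
  | comp {m n : ℕ} (f : PrimrecTerm m) (g : Fin m → PrimrecTerm n) : PrimrecTerm n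
  | prec {n : ℕ} (f : PrimrecTerm n) (g : PrimrecTerm (n + 2)) : PrimrecTerm (n + 1)

/-- The function on the natural numbers denoted by a term. In `prec f g` the first argument is the
recursion variable; `g` takes the predecessor, the previous value and the parameters. -/
def PrimrecTerm.eval : {n : ℕ} → PrimrecTerm n → (Fin n → ℕ) → ℕ
  | _, .zero, _ => 0
  | _, .succ, v => v 0 + 1
  | _, .proj i, v => v i
  | _, .comp f g, v => f.eval fun i => (g i).eval v
  | _, .prec f g, v =>
      Nat.rec (f.eval (Fin.tail v))
        (fun k r => g.eval (Fin.cons k (Fin.cons r (Fin.tail v)))) (v 0)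

/-- `T` and `U` are primitive recursive terms for Kleene's test predicate and output function: the
`e`-th partial recursive function has value `z` at `x` exactly when some `y` passes the test
`T(e, x, y) = 1` and has output `U(y) = z`. -/
def IsKleenePair (T : PrimrecTerm 3) (U : PrimrecTerm 1) : Prop :=
  ∀ e x z : ℕ, z ∈ app e x ↔ ∃ y : ℕ, T.eval ![e, x, y] = 1 ∧ U.eval ![y] = z

/-- Every primitive recursive function is denoted by a term. -/
theorem PrimrecTerm.exists_eval_eq {n : ℕ} {f : List.Vector ℕ n → ℕ} (hf : Nat.Primrec' f) :
    ∃ t : PrimrecTerm n, ∀ v, t.eval v = f (List.Vector.ofFn v) := by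
  induction hf with
  | zero => exact ⟨.zero, fun v => rfl⟩
  | succ => exact ⟨.succ, fun v => by simp [PrimrecTerm.eval, List.Vector.ofFn]⟩
  | get i => exact ⟨.proj i, fun v => by simp [PrimrecTerm.eval]⟩
  | comp g hf hg ihf ihg =>
    obtain ⟨t, ht⟩ := ihf
    choose s hs using ihg
    exact ⟨.comp t s, fun v => by simp [PrimrecTerm.eval, ht, hs]⟩
  | prec hf hg ihf ihg =>
    obtain ⟨t, ht⟩ := ihf
    obtain ⟨s, hs⟩ := ihg
    refine ⟨.prec t s, fun v => ?_⟩
    simp only [PrimrecTerm.eval, ht, hs, List.Vector.ofFn, List.Vector.head_cons,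
      List.Vector.tail_cons, Fin.cons_zero, Fin.cons_succ]
    rfl

theorem exists_isKleenePair : ∃ T U, IsKleenePair T U := by
  have hU : Primrec fun v : List.Vector ℕ 1 => v.head.unpair.2 :=
    Primrec.snd.comp (Primrec.unpair.comp Primrec.vector_head)
  have hT : Primrec fun v : List.Vector ℕ 3 =>
      if Nat.Partrec.Code.evaln (v.get 2).unpair.1
        (Denumerable.ofNat Nat.Partrec.Code (v.get 0)) (v.get 1) = some (v.get 2).unpair.2
      then 1 else 0 := by
    have hv : ∀ i : Fin 3, Primrec fun v : List.Vector ℕ 3 => v.get i := fun i =>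
      Primrec.vector_get.comp Primrec.id (Primrec.const i)
    refine Primrec.ite (Primrec.eq.comp (Nat.Partrec.Code.primrec_evaln.comp
      (Primrec.pair (Primrec.pair (Primrec.fst.comp (Primrec.unpair.comp (hv 2)))
        ((Primrec.ofNat _).comp (hv 0))) (hv 1)))
      (Primrec.option_some.comp (Primrec.snd.comp (Primrec.unpair.comp (hv 2)))))
      (Primrec.const 1) (Primrec.const 0)
  obtain ⟨T, hT⟩ := PrimrecTerm.exists_eval_eq (Nat.Primrec'.of_prim hT)
  obtain ⟨U, hU⟩ := PrimrecTerm.exists_eval_eq (Nat.Primrec'.of_prim hU)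
  refine ⟨T, U, fun e x z => ?_⟩
  simp only [hT, hU, List.Vector.get_ofFn, app, Nat.Partrec.Code.evaln_complete]
  constructor
  · rintro ⟨k, hk⟩
    exact ⟨Nat.pair k z, by simpa using hk, by simp [List.Vector.ofFn]⟩
  · rintro ⟨y, hy, rfl⟩
    refine ⟨y.unpair.1, ?_⟩
    by_contra h
    rw [if_neg (by simpa [List.Vector.ofFn] using h)] at hy
    exact absurd hy (by decide)

/-! ## Arithmetic doctrines and Church's Thesis -/

section Arithmetic

variable {C : Type u} [Category.{v} C] [CartesianMonoidalCategory C]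

/-- A parameterized natural number object. -/
structure PNNO (C : Type u) [Category.{v} C] [CartesianMonoidalCategory C] where
  N : C
  zero : 𝟙_ C ⟶ N
  succ : N ⟶ N
  existsUnique {A X : C} (a : A ⟶ X) (f : X ⟶ X) : ∃! k : A ⊗ N ⟶ X,
    lift (𝟙 A) (toUnit A ≫ zero) ≫ k = a ∧ (A ◁ succ) ≫ k = k ≫ f

namespace PNNO

variable (𝒩 : PNNO C)

/-- The arrow defined by iteration. -/
noncomputable def iter {A X : C} (a : A ⟶ X) (f : X ⟶ X) : A ⊗ 𝒩.N ⟶ X :=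
  (𝒩.existsUnique a f).choose

/-- Interpretation of a primitive recursive term at generalized elements of the natural number
object. Primitive recursion over a parameter `Γ` iterates the map
`(c, k, r) ↦ (c, k + 1, g(k, r, c))` on `Γ × (N × N)`. -/
noncomputable def interp : {n : ℕ} → PrimrecTerm n → {Γ : C} → (Fin n → (Γ ⟶ 𝒩.N)) → (Γ ⟶ 𝒩.N)
  | _, .zero, Γ, _ => toUnit Γ ≫ 𝒩.zero
  | _, .succ, _, v => v 0 ≫ 𝒩.succ
  | _, .proj i, _, v => v i
  | _, .comp f g, _, v => interp f fun i => interp (g i) v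
  | _, .prec f g, Γ, v =>
      let start : Γ ⟶ Γ ⊗ (𝒩.N ⊗ 𝒩.N) :=
        lift (𝟙 Γ) (lift (toUnit Γ ≫ 𝒩.zero) (interp f (Fin.tail v)))
      let index : Γ ⊗ (𝒩.N ⊗ 𝒩.N) ⟶ 𝒩.N := snd _ _ ≫ fst _ _
      let value : Γ ⊗ (𝒩.N ⊗ 𝒩.N) ⟶ 𝒩.N := snd _ _ ≫ snd _ _
      let step : Γ ⊗ (𝒩.N ⊗ 𝒩.N) ⟶ Γ ⊗ (𝒩.N ⊗ 𝒩.N) :=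
        lift (fst _ _) (lift (index ≫ 𝒩.succ)
          (interp g (Fin.cons index (Fin.cons value fun i => fst _ _ ≫ Fin.tail v i))))
      lift (𝟙 Γ) (v 0) ≫ 𝒩.iter start step ≫ value

end PNNO

/-- `ev : W × A ⟶ B` is a weak evaluation: every `f : X × A ⟶ B` factors through it. -/
def IsWeakEvaluation {W A B : C} (ev : W ⊗ A ⟶ B) : Prop :=
  ∀ (X : C) (f : X ⊗ A ⟶ B), ∃ g : X ⟶ W, (g ▷ A) ≫ ev = f

/-- The structure of a weak hyperdoctrine on a doctrine `P`. All the operations are determined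
by `P`. -/
structure WeakHyperdoctrine (P : Doctrine.{w} C) where
  /-- The equality predicates. -/
  eq (A : C) : P.Fib (A ⊗ A)
  eq_adj (X A : C) (α : P.Fib (X ⊗ A)) (β : P.Fib ((X ⊗ A) ⊗ A)) :
    P.sub (fst (X ⊗ A) A) α ⊓
        P.sub (lift (fst (X ⊗ A) A ≫ snd X A) (snd (X ⊗ A) A)) (eq A) ≤ β ↔
      α ≤ P.sub (lift (𝟙 (X ⊗ A)) (snd X A)) β
  /-- The base is weakly cartesian closed. -/
  weak_exp (A B : C) : ∃ (W : C) (ev : W ⊗ A ⟶ B), IsWeakEvaluation ev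
  /-- The fibres are Heyting algebras and reindexing is a homomorphism. -/
  bot (A : C) : P.Fib A
  bot_le (A : C) (α : P.Fib A) : bot A ≤ α
  sub_bot {A B : C} (f : A ⟶ B) : P.sub f (bot B) = bot A
  sup {A : C} (α β : P.Fib A) : P.Fib A
  sup_le_iff {A : C} (α β γ : P.Fib A) : sup α β ≤ γ ↔ α ≤ γ ∧ β ≤ γ
  sub_sup {A B : C} (f : A ⟶ B) (α β : P.Fib B) :
    P.sub f (sup α β) = sup (P.sub f α) (P.sub f β)
  imp {A : C} (α β : P.Fib A) : P.Fib A
  le_imp_iff {A : C} (α β γ : P.Fib A) : γ ≤ imp α β ↔ γ ⊓ α ≤ β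
  sub_imp {A B : C} (f : A ⟶ B) (α β : P.Fib B) :
    P.sub f (imp α β) = imp (P.sub f α) (P.sub f β)
  /-- Existential quantification along `A × B ⟶ A`, with the Beck-Chevalley condition. -/
  ex {A : C} (B : C) (α : P.Fib (A ⊗ B)) : P.Fib A
  ex_le_iff {A : C} (B : C) (α : P.Fib (A ⊗ B)) (β : P.Fib A) :
    ex B α ≤ β ↔ α ≤ P.sub (fst A B) β
  sub_ex {X A : C} (f : X ⟶ A) (B : C) (α : P.Fib (A ⊗ B)) :
    P.sub f (ex B α) = ex B (P.sub (f ▷ B) α)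
  /-- Universal quantification along `A × B ⟶ A`, with the Beck-Chevalley condition. -/
  all {A : C} (B : C) (α : P.Fib (A ⊗ B)) : P.Fib A
  le_all_iff {A : C} (B : C) (α : P.Fib (A ⊗ B)) (β : P.Fib A) :
    β ≤ all B α ↔ P.sub (fst A B) β ≤ α
  sub_all {X A : C} (f : X ⟶ A) (B : C) (α : P.Fib (A ⊗ B)) :
    P.sub f (all B α) = all B (P.sub (f ▷ B) α)

/-- `k` is a comprehension of `α`: it is universal among the arrows along which `α` becomes
true. -/
def IsComprehension (P : Doctrine.{w} C) {A X : C} (k : X ⟶ A) (α : P.Fib A) : Prop :=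
  ⊤ ≤ P.sub k α ∧ ∀ (Z : C) (f : Z ⟶ A), ⊤ ≤ P.sub f α → ∃! f' : Z ⟶ X, f' ≫ k = f

/-- `k` is a full comprehension of `α`: moreover `α` entails whatever becomes true along `k`. -/
def IsFullComprehension (P : Doctrine.{w} C) {A X : C} (k : X ⟶ A) (α : P.Fib A) : Prop :=
  IsComprehension P k α ∧ ∀ β : P.Fib A, ⊤ ≤ P.sub k β → α ≤ β

/-- Diagonals are full comprehensions of the equality predicates. -/
def WeakHyperdoctrine.ComprehensiveDiagonals {P : Doctrine.{w} C} (H : WeakHyperdoctrine P) :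
    Prop :=
  ∀ A : C, IsFullComprehension P (lift (𝟙 A) (𝟙 A)) (H.eq A)

/-- The structure of an arithmetic doctrine: a weak hyperdoctrine with a parameterized natural
number object that satisfies induction. -/
structure ArithmeticDoctrine (P : Doctrine.{w} C) extends WeakHyperdoctrine P where
  nno : PNNO C
  induction (A : C) (φ : P.Fib (A ⊗ nno.N)) :
    ⊤ ≤ P.sub (lift (𝟙 A) (toUnit A ≫ nno.zero)) φ → φ ≤ P.sub (A ◁ nno.succ) φ → ⊤ ≤ φ

namespace ArithmeticDoctrine

variable {P : Doctrine.{w} C} (D : ArithmeticDoctrine P)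

/-- The object of natural numbers. -/
abbrev N : C := D.nno.N

/-- The formula `a = b` in context `Γ`. -/
def eqAt {Γ A : C} (a b : Γ ⟶ A) : P.Fib Γ := P.sub (lift a b) (D.eq A)

/-- The formula `T(e, x, y) = s(0)` in context `Γ`. -/
noncomputable def test (T : PrimrecTerm 3) {Γ : C} (e x y : Γ ⟶ D.N) : P.Fib Γ :=
  D.eqAt (D.nno.interp T ![e, x, y]) (toUnit Γ ≫ D.nno.zero ≫ D.nno.succ)

/-- The formula `T(e, x, y) = s(0) ∧ R(x, U(y), a)`, where the relation `R` may depend on a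
parameter `a : A`. -/
noncomputable def kleene (T : PrimrecTerm 3) (U : PrimrecTerm 1) {A : C}
    (R : P.Fib ((D.N ⊗ D.N) ⊗ A)) {Γ : C} (e x y : Γ ⟶ D.N) (a : Γ ⟶ A) : P.Fib Γ :=
  D.test T e x y ⊓ P.sub (lift (lift x (D.nno.interp U ![y])) a) R

/-- The formula `∃ e, ∀ x, ∃ y, T(e, x, y) = s(0) ∧ R(x, U(y), a)` in context `a : A`. -/
noncomputable def recursive (T : PrimrecTerm 3) (U : PrimrecTerm 1) {A : C}
    (R : P.Fib ((D.N ⊗ D.N) ⊗ A)) : P.Fib A :=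
  D.ex D.N <| D.all D.N <| D.ex D.N <|
    -- the context is `((a, e), x), y`
    D.kleene T U R (Γ := ((A ⊗ D.N) ⊗ D.N) ⊗ D.N)
      (fst _ _ ≫ fst _ _ ≫ snd _ _) (fst _ _ ≫ snd _ _) (snd _ _)
      (fst _ _ ≫ fst _ _ ≫ fst _ _)

/-- The formula `Rec(f)` in context `f : W`: the recursiveness formula for the relation
`n = ev(f, x)` in `x, n, f`. -/
noncomputable def recEv (T : PrimrecTerm 3) (U : PrimrecTerm 1) {W : C} (ev : W ⊗ D.N ⟶ D.N) :
    P.Fib W :=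
  D.recursive T U (A := W)
    (D.eqAt (fst _ _ ≫ snd _ _) (lift (snd _ _) (fst _ _ ≫ fst _ _) ≫ ev))

/-- Type-theoretic Church's Thesis: for some weak evaluation, `⊢ ∀ f, Rec(f)`. -/
def TCT (T : PrimrecTerm 3) (U : PrimrecTerm 1) : Prop :=
  ∃ (W : C) (ev : W ⊗ D.N ⟶ D.N), IsWeakEvaluation ev ∧
    ⊤ ≤ D.all (A := 𝟙_ C) W (P.sub (snd (𝟙_ C) W) (D.recEv T U ev))

/-- Church's Thesis: for every relation `R` on the natural numbers,
`⊢ (∀ x, ∃ n, R(x, n)) → ∃ e, ∀ x, ∃ y, T(e, x, y) = s(0) ∧ R(x, U(y))`. -/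
def CT (T : PrimrecTerm 3) (U : PrimrecTerm 1) : Prop :=
  ∀ R : P.Fib (D.N ⊗ D.N),
    ⊤ ≤ D.imp
      (D.all (A := 𝟙_ C) D.N (P.sub (snd (𝟙_ C) D.N) (D.ex D.N R)))
      (D.recursive T U (A := 𝟙_ C) (P.sub (fst (D.N ⊗ D.N) (𝟙_ C)) R))

end ArithmeticDoctrine

/-- `P` is an arithmetic doctrine with comprehensive diagonals that satisfies Type-theoretic
Church's Thesis, for all choices of primitive recursive terms for Kleene's predicate. -/
def SatisfiesTCT (P : Doctrine.{w} C) : Prop :=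
  ∃ D : ArithmeticDoctrine P, D.ComprehensiveDiagonals ∧
    ∀ T U, IsKleenePair T U → D.TCT T U

/-- `P` is an arithmetic doctrine with comprehensive diagonals that satisfies Church's Thesis,
for all choices of primitive recursive terms for Kleene's predicate. -/
def SatisfiesCT (P : Doctrine.{w} C) : Prop :=
  ∃ D : ArithmeticDoctrine P, D.ComprehensiveDiagonals ∧
    ∀ T U, IsKleenePair T U → D.CT T U

end Arithmetic

end ChurchThesis

namespace ChurchThesis

/-! ## Realizability connectives -/

/-! Each doctrine is first translated into predicates on underlying sets. A strong subobject of an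
assembly is an arbitrary subset carrying the induced realizers (`Asm.exists_strongSub_eq`), so its
logic is the classical logic of sets. A variation of a partitioned assembly is a `Set ℕ`-valued
predicate, ordered by uniform realizability from a realizer of the element (`PAsm.var_le`,
`PAsm.exists_var_eq`). A subobject in `Eff` is an extensional `Set ℕ`-valued predicate, ordered by
uniform realizability from a realizer of existence (`Eff.Pred.toFib_le`,
`Eff.Pred.exists_toFib_eq`). Connectives and quantifiers are then the pointwise set-theoretic or
realizability operations, and `WeakHyperdoctrine.ofStable` extracts the hyperdoctrine structure from
them.

In all three cases the natural number object is ℕ with each number realized by itself only, and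
primitive recursive terms take their standard values (`Asm.interp_toFun`, `PAsm.interp_toFun`,
`Eff.Represents.interp`). Hence the internal T and U are governed by `IsKleenePair`. Induction is
ordinary induction for subsets, and primitive recursion on realizers (`Entails.nat_rec`) in the
other two cases.

For variations and for `Eff`, Church's Thesis becomes `entails_church`. A realizer `r` of totality
sends `x` to a code of some `n` together with a realizer of `R(x, n)`. The first component is a
recursive function of `x` whose index is computable from `r` by the s-m-n theorem. A passing
computation `y` is found by unbounded search; its output `U(y)` is the value of that function,
namely `n`, so the realizer of `R(x, n)` serves for `R(x, U(y))`.

The argument is uniform in parameters. With a weak evaluation as parameterized relation it gives the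
type-theoretic form in `Eff` (`ParamCT.tct`). For assemblies the reason is different: the elements
of the exponential are by definition the recursive functions, and since quantifiers carry no
realizers an index may be chosen separately for each function. -/

theorem partrec₂_app : Partrec₂ app :=
  Nat.Partrec.Code.eval_part.comp₂ ((Computable.ofNat _).comp Computable.fst) Computable.snd

/-- Partial application: `app (curryIdx t n) k = app t ⟨n, k⟩`. -/
def curryIdx (t n : ℕ) : ℕ :=
  Encodable.encode (Nat.Partrec.Code.curry (Denumerable.ofNat Nat.Partrec.Code t) n)

theorem app_curryIdx (t n k : ℕ) : app (curryIdx t n) k = app t (Nat.pair n k) := by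
  simp [app, curryIdx, Nat.Partrec.Code.eval_curry]

theorem computable₂_curryIdx : Computable₂ curryIdx :=
  Computable.encode.comp (Nat.Partrec.Code.primrec₂_curry.to_comp.comp
    ((Computable.ofNat _).comp Computable.fst) Computable.snd)

/-- Implication: indices of functions transforming realizers. -/
def impl (a b : Set ℕ) : Set ℕ := {t | ∀ n ∈ a, ∃ m ∈ app t n, m ∈ b}

/-- Universal quantification: intersection of the sets of realizers. -/
def univ {Y : Type} (a : Y → Set ℕ) : Set ℕ := {n | ∀ y, n ∈ a y}

/-- Disjunction: tagged realizers. -/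
def disj (a b : Set ℕ) : Set ℕ :=
  {n | (n.unpair.1 = 0 ∧ n.unpair.2 ∈ a) ∨ (n.unpair.1 = 1 ∧ n.unpair.2 ∈ b)}

/-- Equality of natural numbers, realized by the common value. -/
def natEq (m n : ℕ) : Set ℕ := {k | m = n ∧ k = m}

namespace Entails

variable {I J Y : Type} {φ ψ χ : I → Set ℕ}

theorem of_partrec {f : ℕ →. ℕ} (hf : Partrec f) (h : ∀ i, ∀ n ∈ φ i, ∃ m ∈ f n, m ∈ ψ i) :
    Entails φ ψ := by
  obtain ⟨e, he⟩ := exists_app_eq (Partrec.nat_iff.1 hf)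
  exact ⟨e, fun i n hn => by rw [he]; exact h i n hn⟩

/-- Argue from the hypotheses as a generalized element. -/
theorem intro (h : Entails φ φ → Entails φ ψ) : Entails φ ψ := h (refl φ)

/-- Apply an entailment to generalized elements. The first argument only fixes the context. -/
theorem use {α β : J → Set ℕ} (_ : Entails φ χ) (h : Entails α β) (u : I → J)
    (k : Entails φ fun i => α (u i)) : Entails φ fun i => β (u i) :=
  k.trans (h.comap u)

theorem false_elim (h : Entails φ fun _ => ∅) : Entails φ ψ :=
  h.trans ⟨0, fun _ _ hn => hn.elim⟩

theorem const (m : ℕ) (h : ∀ i, (φ i).Nonempty → m ∈ ψ i) : Entails φ ψ :=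
  of_computable (fun _ => m) (Computable.const m) fun i _ hn => h i ⟨_, hn⟩

/-- The s-m-n theorem: an index of the curried function is computable from the realizer of the
context. -/
theorem impl_intro (h : Entails (fun i => conj (φ i) (ψ i)) χ) :
    Entails φ fun i => impl (ψ i) (χ i) := by
  obtain ⟨t, ht⟩ := h
  refine of_computable (curryIdx t)
    (computable₂_curryIdx.comp (Computable.const t) Computable.id) fun i n hn m hm => ?_
  rw [app_curryIdx]
  exact ht i _ (by simpa [conj] using ⟨hn, hm⟩)

theorem mp (h : Entails φ fun i => impl (ψ i) (χ i)) (h' : Entails φ ψ) : Entails φ χ := by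
  refine (h.and h').trans (of_partrec (f := fun n => app n.unpair.1 n.unpair.2)
    (partrec₂_app.comp (Computable.fst.comp Computable.unpair)
      (Computable.snd.comp Computable.unpair)) ?_)
  rintro i n ⟨h₁, h₂⟩
  exact h₁ _ h₂

theorem univ_intro {θ : I → Y → Set ℕ} (h : Entails (fun p : I × Y => φ p.1) fun p => θ p.1 p.2) :
    Entails φ fun i => univ (θ i) := by
  -- A realizer never sees `y`, so its output is the same for every `y`. When `Y` is empty, however,
  -- `t` need not converge at `n`, and a constant takes its place.
  by_cases hY : Nonempty Y
  · obtain ⟨y₀⟩ := hY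
    obtain ⟨t, ht⟩ := h
    refine ⟨t, fun i n hn => ?_⟩
    obtain ⟨m, hm, -⟩ := ht (i, y₀) n hn
    refine ⟨m, hm, fun y => ?_⟩
    obtain ⟨m', hm', h'⟩ := ht (i, y) n hn
    exact Part.mem_unique hm' hm ▸ h'
  · exact const 0 fun i _ y => (hY ⟨y⟩).elim

theorem univ_elim {θ : I → Y → Set ℕ} (h : Entails φ fun i => univ (θ i)) (y : I → Y) :
    Entails φ fun i => θ i (y i) :=
  h.trans (of_subset fun i _ hn => hn (y i))

theorem disj_inl (h : Entails φ ψ) : Entails φ fun i => disj (ψ i) (χ i) :=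
  h.trans (of_computable (Nat.pair 0)
    (Primrec₂.natPair.to_comp.comp (Computable.const 0) Computable.id)
    fun i n hn => by simp [disj, hn])

theorem disj_inr (h : Entails φ χ) : Entails φ fun i => disj (ψ i) (χ i) :=
  h.trans (of_computable (Nat.pair 1)
    (Primrec₂.natPair.to_comp.comp (Computable.const 1) Computable.id)
    fun i n hn => by simp [disj, hn])

theorem disj_elim {ω : I → Set ℕ} (h : Entails φ fun i => disj (ψ i) (χ i))
    (h₁ : Entails (fun i => conj (φ i) (ψ i)) ω) (h₂ : Entails (fun i => conj (φ i) (χ i)) ω) :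
    Entails φ ω := by
  refine ((refl φ).and h).trans ?_
  obtain ⟨s, hs⟩ := h₁
  obtain ⟨t, ht⟩ := h₂
  -- The tag of the disjunct selects the program; its payload is paired again with the realizer of
  -- the context.
  refine of_partrec (f := fun n => app (if n.unpair.2.unpair.1 = 0 then s else t)
    (Nat.pair n.unpair.1 n.unpair.2.unpair.2)) ?_ ?_
  · have h₂₁ : Primrec fun n : ℕ => n.unpair.2.unpair.1 :=
      Primrec.fst.comp (Primrec.unpair.comp (Primrec.snd.comp Primrec.unpair))
    have h₂₂ : Primrec fun n : ℕ => n.unpair.2.unpair.2 :=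
      Primrec.snd.comp (Primrec.unpair.comp (Primrec.snd.comp Primrec.unpair))
    exact partrec₂_app.comp
      (Primrec.ite (Primrec.eq.comp h₂₁ (Primrec.const 0)) (Primrec.const s)
        (Primrec.const t)).to_comp
      (Primrec₂.natPair.comp (Primrec.fst.comp Primrec.unpair) h₂₂).to_comp
  · rintro i n ⟨hn, h | h⟩
    · rw [if_pos h.1]
      exact hs i _ (by simpa [conj] using ⟨hn, h.2⟩)
    · rw [if_neg (by simp [h.1])]
      exact ht i _ (by simpa [conj] using ⟨hn, h.2⟩)

/-- Induction on the natural numbers is realized by primitive recursion. -/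
theorem nat_rec {θ : I → ℕ → Set ℕ} (h₀ : Entails φ fun i => θ i 0)
    (h₁ : Entails (fun p : I × ℕ => conj (conj (φ p.1) (natEq p.2 p.2)) (θ p.1 p.2))
      fun p => θ p.1 (p.2 + 1)) :
    Entails (fun p : I × ℕ => conj (φ p.1) (natEq p.2 p.2)) fun p => θ p.1 p.2 := by
  obtain ⟨s, hs⟩ := h₀
  obtain ⟨t, ht⟩ := h₁
  -- A number is realized by itself, so the depth of the recursion is read off the second component
  -- of `n`.
  let f : ℕ →. ℕ := fun n => n.unpair.2.rec (app s n.unpair.1) fun k r => r.bind fun m =>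
    app t (Nat.pair (Nat.pair n.unpair.1 k) m)
  have hf : Partrec f := by
    have hpair := Primrec₂.natPair.to_comp
    refine Partrec.nat_rec (f := fun n : ℕ => n.unpair.2) (g := fun n => app s n.unpair.1)
      (h := fun n p => app t (Nat.pair (Nat.pair n.unpair.1 p.1) p.2))
      (Computable.snd.comp Computable.unpair)
      (partrec₂_app.comp (Computable.const s) (Computable.fst.comp Computable.unpair)) ?_
    exact partrec₂_app.comp (Computable.const t) (hpair.comp (hpair.comp
      (Computable.fst.comp (Computable.unpair.comp Computable.fst))
      (Computable.fst.comp Computable.snd)) (Computable.snd.comp Computable.snd))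
  refine of_partrec hf ?_
  rintro ⟨i, k⟩ n ⟨hn, -, hk⟩
  simp only [f, hk]
  -- The realizer `n` stays fixed while `k` varies in the induction, so the equation tying `n` to
  -- `k` has to be dropped.
  clear hk
  replace hn : n.unpair.1 ∈ φ i := hn
  induction k with
  | zero => exact hs i _ hn
  | succ k ih =>
    obtain ⟨m, hm, hm'⟩ := ih
    obtain ⟨l, hl, hl'⟩ := ht (i, k) (Nat.pair (Nat.pair n.unpair.1 k) m)
      (by simpa [conj, natEq] using ⟨hn, hm'⟩)
    exact ⟨l, Part.mem_bind hm hl, hl'⟩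

/-- Substitution along an equality that holds wherever it is realized. -/
theorem eq_subst {a a' : I → Y} {θ : I → Y → Set ℕ} {S : I → ℕ → Prop}
    (h : Entails φ fun i => {k | a i = a' i ∧ S i k}) (h' : Entails φ fun i => θ i (a i)) :
    Entails φ fun i => θ i (a' i) :=
  (h.and h').trans (of_computable (fun k => k.unpair.2) (Computable.snd.comp Computable.unpair)
    fun _ _ hk => hk.1.1 ▸ hk.2)

theorem natEq_succ {m n : I → ℕ} (h : Entails φ fun i => natEq (m i) (n i)) :
    Entails φ fun i => natEq (m i + 1) (n i + 1) :=
  h.trans (of_computable Nat.succ Computable.succ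
    fun _ _ hk => ⟨congrArg Nat.succ hk.1, congrArg Nat.succ hk.2⟩)

end Entails

/-! ## Kleene's predicate and Church's Thesis -/

/-- Needed to make Kleene's test computable, so that one can search for a number passing it. -/
theorem PrimrecTerm.primrec'_eval : ∀ {n : ℕ} (t : PrimrecTerm n),
    Nat.Primrec' fun v : List.Vector ℕ n => t.eval v.get
  | _, .zero => Nat.Primrec'.zero
  | _, .succ => Nat.Primrec'.succ.of_eq fun v => by simp [PrimrecTerm.eval]
  | _, .proj i => Nat.Primrec'.get i
  | _, .comp f g => (Nat.Primrec'.comp _ f.primrec'_eval fun i => (g i).primrec'_eval).of_eq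
      fun v => by simp only [PrimrecTerm.eval]; congr 1; ext i; simp
  | _, .prec f g => (Nat.Primrec'.prec f.primrec'_eval g.primrec'_eval).of_eq fun v => by
      have h₁ : v.tail.get = Fin.tail v.get := funext fun i => List.Vector.get_tail_succ v i
      have h₂ : ∀ a b : ℕ, (a ::ᵥ b ::ᵥ v.tail).get = Fin.cons a (Fin.cons b (Fin.tail v.get)) := by
        intro a b
        funext i
        refine Fin.cases ?_ (fun j => Fin.cases ?_ (fun k => ?_) j) i <;> simp [← h₁]
        exact List.Vector.get_cons_succ _ _ 0
      simp [PrimrecTerm.eval, h₁, h₂]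

theorem primrec_kleene_test (T : PrimrecTerm 3) :
    Primrec fun p : ℕ × ℕ × ℕ => T.eval ![p.1, p.2.1, p.2.2] := by
  have h := Primrec.comp (f := fun v : List.Vector ℕ 3 => T.eval v.get) (g := fun p : ℕ × ℕ × ℕ =>
    p.1 ::ᵥ p.2.1 ::ᵥ p.2.2 ::ᵥ List.Vector.nil) T.primrec'_eval.to_prim
    (Primrec.vector_cons.comp Primrec.fst (Primrec.vector_cons.comp
      (Primrec.fst.comp Primrec.snd) (Primrec.vector_cons.comp (Primrec.snd.comp Primrec.snd)
        (Primrec.const _))))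
  refine h.of_eq fun p => congrArg T.eval (funext fun i => ?_)
  fin_cases i <;> rfl

/-- The computation of the `e`-th function at `x` that passes the test is found by search. -/
theorem exists_app_eq_search (T : PrimrecTerm 3) : ∃ d, ∀ e x,
    app d (Nat.pair e x) = Nat.rfind fun y => Part.some (decide (T.eval ![e, x, y] = 1)) := by
  have h : Primrec₂ fun p y : ℕ => decide (T.eval ![p.unpair.1, p.unpair.2, y] = 1) :=
    Primrec.eq.decide.comp ((primrec_kleene_test T).comp
      (((Primrec.fst.comp Primrec.unpair).comp Primrec.fst).pair
        (((Primrec.snd.comp Primrec.unpair).comp Primrec.fst).pair Primrec.snd)))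
      (Primrec.const 1)
  obtain ⟨d, hd⟩ := exists_app_eq (Partrec.nat_iff.1 (Partrec.rfind h.to_comp.partrec₂))
  exact ⟨d, fun e x => by
    rw [hd]
    simp only [Nat.unpair_pair]
    rfl⟩

/-- The given `y₀` only ensures that the search terminates. The number found may differ from it, and
nothing but the test is known of it; its output is settled later by `IsKleenePair`. -/
theorem app_search {T : PrimrecTerm 3} {d : ℕ}
    (hd : ∀ e x, app d (Nat.pair e x) =
      Nat.rfind fun y => Part.some (decide (T.eval ![e, x, y] = 1)))
    {e x y₀ : ℕ} (h : T.eval ![e, x, y₀] = 1) :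
    ∃ y ∈ app d (Nat.pair e x), T.eval ![e, x, y] = 1 := by
  have hdom : (app d (Nat.pair e x)).Dom := by
    rw [hd]
    exact Nat.rfind_dom.2 ⟨y₀, by simpa using h, fun _ => trivial⟩
  obtain ⟨y, hy⟩ := Part.dom_iff_mem.1 hdom
  refine ⟨y, hy, ?_⟩
  rw [hd] at hy
  simpa using Nat.rfind_spec hy

/-- Church's Thesis is realized: an index of a choice function is computed from a realizer of
totality, and the computation is found by unbounded search. -/
theorem entails_church {T : PrimrecTerm 3} {U : PrimrecTerm 1} (hTU : IsKleenePair T U)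
    {I : Type} (R : I → ℕ → ℕ → Set ℕ) :
    Entails
      (fun i => univ fun x => impl (natEq x x) (exis fun n => conj (natEq n n) (R i x n)))
      (fun i => exis fun e => conj (natEq e e) (univ fun x => impl (natEq x x)
        (exis fun y => conj (natEq y y)
          (conj (natEq (T.eval ![e, x, y]) 1) (R i x (U.eval ![y])))))) := by
  have hpair := Primrec₂.natPair.to_comp
  have hfst : Computable fun n : ℕ => n.unpair.1 := Computable.fst.comp Computable.unpair
  have hsnd : Computable fun n : ℕ => n.unpair.2 := Computable.snd.comp Computable.unpair
  have happ : Partrec fun p : ℕ => app p.unpair.1 p.unpair.2 := partrec₂_app.comp hfst hsnd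
  -- `app c ⟨r, x⟩` is the first component of `app r x`, so `curryIdx c r` is an index of the choice
  -- function contained in `r`.
  obtain ⟨c, hc⟩ := exists_app_eq (Partrec.nat_iff.1
    (happ.map (g := fun _ m : ℕ => m.unpair.1) (hfst.comp Computable.snd : Computable _)))
  obtain ⟨s, hs⟩ := exists_app_eq_search T
  -- From `⟨r, x⟩` and the output `m` of `r` at `x`: a passing computation `y`, the number 1 as
  -- realizer of `T(e, x, y) = 1`, and the realizer of `R` contained in `m`.
  have hsearch : Partrec₂ fun p m : ℕ => (app s (Nat.pair (curryIdx c p.unpair.1) p.unpair.2)).map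
      fun y => Nat.pair y (Nat.pair 1 m.unpair.2) :=
    Partrec.map (g := fun (q : ℕ × ℕ) (y : ℕ) => Nat.pair y (Nat.pair 1 q.2.unpair.2))
      (partrec₂_app.comp (Computable.const s) (hpair.comp
        (computable₂_curryIdx.comp (Computable.const c) (hfst.comp Computable.fst))
        (hsnd.comp Computable.fst)))
      (hpair.comp Computable.snd (hpair.comp (Computable.const 1)
        (hsnd.comp (Computable.snd.comp Computable.fst))))
  obtain ⟨d, hd⟩ := exists_app_eq (Partrec.nat_iff.1 (happ.bind hsearch))
  refine Entails.of_computable (fun r => Nat.pair (curryIdx c r) (curryIdx d r))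
    (hpair.comp (computable₂_curryIdx.comp (Computable.const c) Computable.id)
      (computable₂_curryIdx.comp (Computable.const d) Computable.id)) fun i r hr => ?_
  refine ⟨curryIdx c r, ⟨rfl, by simp⟩, ?_⟩
  rw [Nat.unpair_pair]
  rintro x k ⟨-, rfl⟩
  obtain ⟨m, hm, n, ⟨-, hmn⟩, hmR⟩ := hr k k ⟨rfl, rfl⟩
  have hn : ∀ z, z ∈ app (curryIdx c r) k ↔ z = n := fun z => by
    rw [app_curryIdx, hc]
    simp only [Nat.unpair_pair, Part.mem_map_iff]
    constructor
    · rintro ⟨m', hm', rfl⟩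
      rw [Part.mem_unique hm' hm, hmn]
    · rintro rfl
      exact ⟨m, hm, hmn⟩
  -- The choice function is defined at `k`, so some computation passes the test and the search
  -- terminates.
  obtain ⟨y₀, hy₀, -⟩ := (hTU _ _ _).1 ((hn n).2 rfl)
  obtain ⟨y, hy, hy₁⟩ := app_search hs hy₀
  -- The converse half of `IsKleenePair`: whichever `y` was found, its output is a value of the
  -- choice function at `k`, and that value is unique.
  have hy₂ : U.eval ![y] = n := (hn _).1 ((hTU _ _ _).2 ⟨y, hy₁, rfl⟩)
  refine ⟨Nat.pair y (Nat.pair 1 m.unpair.2), ?_, y, ⟨rfl, by simp⟩, ?_⟩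
  · rw [app_curryIdx, hd]
    simp only [Nat.unpair_pair]
    exact Part.mem_bind hm (Part.mem_map _ hy)
  · simpa [conj, natEq, hy₁, hy₂] using hmR

end ChurchThesis
namespace ChurchThesis

/-! ## Doctrines -/

namespace Doctrine

variable {C : Type u} [Category.{v} C] (P : Doctrine.{w} C) {A B X : C}

theorem sub_id (α : P.Fib A) : P.sub (𝟙 A) α = α := by
  simp only [sub, op_id, P.map_id]
  rfl

theorem sub_comp (f : X ⟶ A) (g : A ⟶ B) (α : P.Fib B) :
    P.sub (f ≫ g) α = P.sub f (P.sub g α) := by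
  simp only [sub, op_comp, P.map_comp]
  rfl

theorem sub_inf (f : A ⟶ B) (α β : P.Fib B) : P.sub f (α ⊓ β) = P.sub f α ⊓ P.sub f β :=
  (P.map f.op : InfTopHom (P.obj (op B)) (P.obj (op A))).map_inf' α β

theorem sub_top (f : A ⟶ B) : P.sub f ⊤ = ⊤ :=
  (P.map f.op : InfTopHom (P.obj (op B)) (P.obj (op A))).map_top'

theorem sub_mono (f : A ⟶ B) {α β : P.Fib B} (h : α ≤ β) : P.sub f α ≤ P.sub f β := by
  rw [← inf_eq_left] at h ⊢
  rw [← sub_inf, h]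

end Doctrine

section

variable {C : Type u} [Category.{v} C] [CartesianMonoidalCategory C] {P : Doctrine.{w} C}

namespace WeakHyperdoctrine

/-- A weak hyperdoctrine from connectives whose universal properties are stable under
reindexing. -/
noncomputable def ofStable (eq : ∀ A : C, P.Fib (A ⊗ A))
    (eq_adj : ∀ (X A : C) (α : P.Fib (X ⊗ A)) (β : P.Fib ((X ⊗ A) ⊗ A)),
      P.sub (fst (X ⊗ A) A) α ⊓
          P.sub (lift (fst (X ⊗ A) A ≫ snd X A) (snd (X ⊗ A) A)) (eq A) ≤ β ↔
        α ≤ P.sub (lift (𝟙 (X ⊗ A)) (snd X A)) β)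
    (weak_exp : ∀ A B : C, ∃ (W : C) (ev : W ⊗ A ⟶ B), IsWeakEvaluation ev)
    (bot : ∀ A : C, ∃ γ : P.Fib A, ∀ (X : C) (f : X ⟶ A) (δ : P.Fib X), P.sub f γ ≤ δ)
    (sup : ∀ {A : C} (α β : P.Fib A), ∃ γ : P.Fib A, ∀ (X : C) (f : X ⟶ A) (δ : P.Fib X),
      P.sub f γ ≤ δ ↔ P.sub f α ≤ δ ∧ P.sub f β ≤ δ)
    (imp : ∀ {A : C} (α β : P.Fib A), ∃ γ : P.Fib A, ∀ (X : C) (f : X ⟶ A) (δ : P.Fib X),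
      δ ≤ P.sub f γ ↔ δ ⊓ P.sub f α ≤ P.sub f β)
    (ex : ∀ {A : C} (B : C) (α : P.Fib (A ⊗ B)), ∃ γ : P.Fib A,
      ∀ (X : C) (f : X ⟶ A) (δ : P.Fib X),
        P.sub f γ ≤ δ ↔ P.sub (f ▷ B) α ≤ P.sub (fst X B) δ)
    (all : ∀ {A : C} (B : C) (α : P.Fib (A ⊗ B)), ∃ γ : P.Fib A,
      ∀ (X : C) (f : X ⟶ A) (δ : P.Fib X),
        δ ≤ P.sub f γ ↔ P.sub (fst X B) δ ≤ P.sub (f ▷ B) α) :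
    WeakHyperdoctrine P where
  eq := eq
  eq_adj := eq_adj
  weak_exp := weak_exp
  bot A := (bot A).choose
  bot_le A α := by simpa [Doctrine.sub_id] using (bot A).choose_spec A (𝟙 A) α
  sub_bot {A B} f := le_antisymm ((bot B).choose_spec _ f _) <| by
    simpa [Doctrine.sub_id] using (bot A).choose_spec A (𝟙 A) (P.sub f _)
  sup α β := (sup α β).choose
  sup_le_iff α β γ := by simpa [Doctrine.sub_id] using (sup α β).choose_spec _ (𝟙 _) γ
  -- Both sides have the same upper bounds: the left by the universal property at `f`, the right by
  -- that of the reindexed formulas at the identity. The Beck–Chevalley conditions arise in the same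
  -- way.
  sub_sup f α β := eq_of_forall_ge_iff fun δ => by
    rw [(sup α β).choose_spec]
    simpa [Doctrine.sub_id] using ((sup (P.sub f α) (P.sub f β)).choose_spec _ (𝟙 _) δ).symm
  imp α β := (imp α β).choose
  le_imp_iff α β γ := by simpa [Doctrine.sub_id] using (imp α β).choose_spec _ (𝟙 _) γ
  sub_imp f α β := eq_of_forall_le_iff fun δ => by
    rw [(imp α β).choose_spec]
    simpa [Doctrine.sub_id] using ((imp (P.sub f α) (P.sub f β)).choose_spec _ (𝟙 _) δ).symm
  ex B α := (ex B α).choose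
  ex_le_iff B α β := by simpa [Doctrine.sub_id] using (ex B α).choose_spec _ (𝟙 _) β
  sub_ex f B α := eq_of_forall_ge_iff fun δ => by
    rw [(ex B α).choose_spec]
    simpa [Doctrine.sub_id] using ((ex B (P.sub (f ▷ B) α)).choose_spec _ (𝟙 _) δ).symm
  all B α := (all B α).choose
  le_all_iff B α β := by simpa [Doctrine.sub_id] using (all B α).choose_spec _ (𝟙 _) β
  sub_all f B α := eq_of_forall_le_iff fun δ => by
    rw [(all B α).choose_spec]
    simpa [Doctrine.sub_id] using ((all B (P.sub (f ▷ B) α)).choose_spec _ (𝟙 _) δ).symm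

variable (H : WeakHyperdoctrine P) {A B : C}

/-- Adjoints between posets are unique. Quantifiers obtained by choice in `ofStable` can therefore
be computed by any formula with the right universal property. -/
theorem ex_eq {α : P.Fib (A ⊗ B)} {γ : P.Fib A}
    (h : ∀ β, γ ≤ β ↔ α ≤ P.sub (fst A B) β) : H.ex B α = γ :=
  eq_of_forall_ge_iff fun β => (H.ex_le_iff B α β).trans (h β).symm

theorem all_eq {α : P.Fib (A ⊗ B)} {γ : P.Fib A}
    (h : ∀ β, β ≤ γ ↔ P.sub (fst A B) β ≤ α) : H.all B α = γ :=
  eq_of_forall_le_iff fun β => (H.le_all_iff B α β).trans (h β).symm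

/-- Reflexivity is the unit of the equality adjunction at the terminal parameter and `⊤`. -/
theorem top_le_sub_diag (A : C) : ⊤ ≤ P.sub (lift (𝟙 A) (𝟙 A)) (H.eq A) := by
  have h := (H.eq_adj (𝟙_ C) A ⊤ _).1 inf_le_right
  have h' := P.sub_mono (lift (toUnit A) (𝟙 A)) h
  rw [P.sub_top, ← P.sub_comp, ← P.sub_comp] at h'
  convert h' using 2
  ext <;> simp

theorem eq_le_of_top_le (A : C) (β : P.Fib (A ⊗ A))
    (h : ⊤ ≤ P.sub (lift (𝟙 A) (𝟙 A)) β) : H.eq A ≤ β := by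
  -- The adjunction is available only over `(X × A) × A`, so `β` is moved to `(1 × A) × A`; the
  -- comparison arrow from `A × A` brings the result back.
  have h₁ := (H.eq_adj (𝟙_ C) A ⊤
    (P.sub (lift (fst (𝟙_ C ⊗ A) A ≫ snd (𝟙_ C) A) (snd (𝟙_ C ⊗ A) A)) β)).2 <| by
      have h' := P.sub_mono (snd (𝟙_ C) A) h
      rw [P.sub_top, ← P.sub_comp] at h'
      rw [← P.sub_comp]
      convert h' using 2
      ext <;> simp
  have h₂ := P.sub_mono (lift (lift (toUnit (A ⊗ A)) (fst A A)) (snd A A)) h₁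
  have h₃ : lift (lift (toUnit (A ⊗ A)) (fst A A)) (snd A A) ≫
      lift (fst (𝟙_ C ⊗ A) A ≫ snd (𝟙_ C) A) (snd (𝟙_ C ⊗ A) A) = 𝟙 (A ⊗ A) := by
    ext <;> simp
  rw [P.sub_inf, ← P.sub_comp, ← P.sub_comp, P.sub_top, ← P.sub_comp, top_inf_eq,
    h₃, P.sub_id, P.sub_id] at h₂
  exact h₂

/-- Comprehensive diagonals: internally equal arrows are equal. -/
theorem comprehensiveDiagonals
    (h : ∀ (Z A : C) (f g : Z ⟶ A), ⊤ ≤ P.sub (lift f g) (H.eq A) → f = g) :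
    H.ComprehensiveDiagonals := by
  refine fun A => ⟨⟨H.top_le_sub_diag A, fun Z f hf => ?_⟩, H.eq_le_of_top_le A⟩
  have hf' : f ≫ fst A A = f ≫ snd A A := h Z A _ _ (by simpa using hf)
  refine ⟨f ≫ fst A A, ?_, ?_⟩
  · ext <;> simp [hf']
  · rintro g rfl
    simp

end WeakHyperdoctrine

/-! ### Church's Thesis with parameters and its two consequences -/

namespace ArithmeticDoctrine

variable (D : ArithmeticDoctrine P) {T : PrimrecTerm 3} {U : PrimrecTerm 1}

/-- Church's Thesis for relations with parameters. -/
def ParamCT (T : PrimrecTerm 3) (U : PrimrecTerm 1) : Prop :=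
  ∀ (A : C) (R : P.Fib ((D.N ⊗ D.N) ⊗ A)),
    D.all D.N (D.ex D.N (P.sub (lift (lift (fst (A ⊗ D.N) D.N ≫ snd A D.N) (snd (A ⊗ D.N) D.N))
      (fst (A ⊗ D.N) D.N ≫ fst A D.N)) R)) ≤ D.recursive T U R

variable {D}

/-- The parameter object is terminal; what remains is to move the existential quantifier past a
substitution by Beck–Chevalley. -/
theorem ParamCT.ct (h : D.ParamCT T U) : D.CT T U := by
  intro R
  rw [D.le_imp_iff, top_inf_eq]
  refine le_trans (le_of_eq ?_) (h (𝟙_ C) (P.sub (fst (D.N ⊗ D.N) (𝟙_ C)) R))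
  rw [D.sub_ex, ← P.sub_comp]
  congr 3
  ext <;> simp

/-- The relation is the graph of a weak evaluation, with the function as parameter. It is total
because `ev` itself supplies the witness, so any weak evaluation works. -/
theorem ParamCT.tct (h : D.ParamCT T U) : D.TCT T U := by
  obtain ⟨W, ev, hev⟩ := D.weak_exp D.N D.N
  refine ⟨W, ev, hev, ?_⟩
  rw [D.le_all_iff, P.sub_top]
  rw [← P.sub_top (snd (𝟙_ C) W)]
  refine P.sub_mono _ (le_trans ?_ (h W _))
  rw [D.le_all_iff, P.sub_top]
  -- The unit of the existential adjunction, reindexed along `⟨id, ev⟩`, is existential introduction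
  -- with witness `ev`.
  have h₁ := P.sub_mono (lift (𝟙 _) ev) ((D.ex_le_iff (A := W ⊗ D.N) D.N _ _).1
    (le_refl (D.ex (A := W ⊗ D.N) D.N (P.sub (lift (lift (fst (W ⊗ D.N) D.N ≫ snd W D.N)
      (snd (W ⊗ D.N) D.N)) (fst (W ⊗ D.N) D.N ≫ fst W D.N))
        (D.eqAt (fst (D.N ⊗ D.N) W ≫ snd D.N D.N)
          (lift (snd (D.N ⊗ D.N) W) (fst (D.N ⊗ D.N) W ≫ fst D.N D.N) ≫ ev))))))
  rw [← P.sub_comp (lift (𝟙 _) ev) (fst _ _), lift_fst, P.sub_id] at h₁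
  refine le_trans ?_ h₁
  have h₂ := P.sub_mono ev (D.top_le_sub_diag D.N)
  rw [P.sub_top, ← P.sub_comp] at h₂
  simp only [eqAt]
  rw [← P.sub_comp, ← P.sub_comp]
  convert h₂ using 2
  have h₃ : lift (lift (snd W D.N) ev) (fst W D.N) ≫
      lift (snd (D.N ⊗ D.N) W) (fst (D.N ⊗ D.N) W ≫ fst D.N D.N) = 𝟙 _ := by
    ext <;> simp
  ext <;> simp [reassoc_of% h₃]

end ArithmeticDoctrine

end

end ChurchThesis
namespace ChurchThesis

/-! ### Factorization through subobjects, and iterates of functions -/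

theorem le_iff_forall_factors {C : Type u} [Category.{v} C] {A : C} {S T : Subobject A} :
    S ≤ T ↔ ∀ (Z : C) (g : Z ⟶ A), S.Factors g → T.Factors g :=
  ⟨fun h _ g => Subobject.factors_of_le g h,
    fun h => Subobject.le_of_factors (h _ _ S.factors_self)⟩

/-- The values of the iteration that interprets primitive recursion. -/
theorem iterate_prec {Γ : Type} {s : Γ × ℕ × ℕ} {h : Γ × ℕ × ℕ → Γ × ℕ × ℕ} {c : Γ} {r : ℕ}
    {g : ℕ → ℕ → ℕ} (hs : s = (c, 0, r)) (hh : ∀ k m, h (c, k, m) = (c, k + 1, g k m)) (n : ℕ) :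
    h^[n] s = (c, n, Nat.rec r g n) := by
  induction n with
  | zero => exact hs
  | succ n ih => rw [Function.iterate_succ_apply', ih, hh]

/-- The two recursion equations determine the values. This gives uniqueness in the natural number
objects of `Asm` and `PAsm`, and computes iterations known only through their universal property. -/
theorem eq_iterate {A : Type} {X : Type} {a : A → X} {f : X → X} {k : A × ℕ → X}
    (h₀ : ∀ x, k (x, 0) = a x) (h₁ : ∀ x n, k (x, n + 1) = f (k (x, n))) (p : A × ℕ) :
    k p = f^[p.2] (a p.1) := by
  obtain ⟨x, n⟩ := p
  induction n with
  | zero => exact h₀ x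
  | succ n ih => rw [h₁, ih, Function.iterate_succ_apply']

/-! ## Strong subobjects of assemblies -/

namespace Asm

/-- The set of realizers of an element. -/
def real (X : Asm) (x : X.carrier) : Set ℕ := {n | X.rel x n}

/-- Arrows are functions for which the realizers of an element entail those of its image. -/
def homMk {X Y : Asm} (f : X.carrier → Y.carrier) (h : Entails X.real fun x => Y.real (f x)) :
    X ⟶ Y := ⟨f, h⟩

theorem entails_hom {X Y : Asm} (f : X ⟶ Y) : Entails X.real fun x => Y.real (f.toFun x) :=
  f.tracked

/-- The point at an element. -/
def point {X : Asm} (x : X.carrier) : 𝟙_ Asm ⟶ X :=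
  homMk (fun _ => x) (.const (X.total x).choose fun _ _ => (X.total x).choose_spec)

/-- The assembly of natural numbers. -/
def nat : Asm := ⟨ℕ, fun n k => k = n, fun n => ⟨n, rfl⟩⟩

theorem isPartitioned_nat : IsPartitioned nat := by
  rintro _ _ _ rfl rfl
  rfl

/-- Iteration of an arrow. -/
def iterate {A X : Asm} (a : A ⟶ X) (f : X ⟶ X) : A ⊗ nat ⟶ X :=
  homMk (fun p => f.toFun^[p.2] (a.toFun p.1)) <| by
    refine Entails.trans (Entails.of_subset ?_) (Entails.nat_rec (φ := A.real)
      (θ := fun x n => X.real (f.toFun^[n] (a.toFun x))) (entails_hom a) ?_)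
    · rintro ⟨x, k⟩ n ⟨h₁, h₂⟩
      exact ⟨h₁, rfl, h₂⟩
    · simp only [Function.iterate_succ_apply']
      exact (Entails.refl _).right.trans ((entails_hom f).comap _)

/-- The natural number object of the category of assemblies. -/
def nno : PNNO Asm where
  N := nat
  zero := homMk (fun _ => (0 : ℕ)) (.const 0 fun _ _ => rfl)
  succ := homMk Nat.succ
    (.of_computable Nat.succ Computable.succ fun _ _ h => congrArg Nat.succ h)
  existsUnique {A X} a f := by
    refine ⟨iterate a f, ⟨rfl, ?_⟩, ?_⟩
    · ext p
      exact Function.iterate_succ_apply' _ _ _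
    · rintro k ⟨h₀, h₁⟩
      ext p
      exact eq_iterate (fun x => congrArg (fun g : A ⟶ X => g.toFun x) h₀)
        (fun x n => congrArg (fun g : A ⊗ nat ⟶ X => g.toFun (x, n)) h₁) p

theorem iter_toFun {A X : Asm} (a : A ⟶ X) (f : X ⟶ X) (p : (A ⊗ nno.N).carrier) :
    (nno.iter a f).toFun p = f.toFun^[p.2] (a.toFun p.1) := by
  have h := (nno.existsUnique a f).choose_spec.1
  exact eq_iterate (fun x => congrArg (fun g : A ⟶ X => g.toFun x) h.1)
    (fun x n => congrArg (fun g : A ⊗ nat ⟶ X => g.toFun (x, n)) h.2) p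

/-- Replaces the internal T and U by the numerical functions that `IsKleenePair` speaks about.
Primitive recursion is the last coordinate of the iterated triple (parameter, counter, value),
evaluated by `iterate_prec`. -/
theorem interp_toFun : ∀ {n : ℕ} (t : PrimrecTerm n) {Γ : Asm} (v : Fin n → (Γ ⟶ nno.N))
    (γ : Γ.carrier), (nno.interp t v).toFun γ = t.eval fun i => (v i).toFun γ
  | _, .zero, _, _, _ => rfl
  | _, .succ, _, _, _ => rfl
  | _, .proj _, _, _, _ => rfl
  | _, .comp f g, _, v, γ => (interp_toFun f _ γ).trans
      (congrArg f.eval (funext fun i => interp_toFun (g i) v γ))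
  | _, .prec f g, Γ, v, γ => by
      let start : Γ ⟶ Γ ⊗ (nno.N ⊗ nno.N) :=
        lift (𝟙 Γ) (lift (toUnit Γ ≫ nno.zero) (nno.interp f (Fin.tail v)))
      let step : Γ ⊗ (nno.N ⊗ nno.N) ⟶ Γ ⊗ (nno.N ⊗ nno.N) :=
        lift (fst _ _) (lift ((snd _ _ ≫ fst _ _) ≫ nno.succ)
          (nno.interp g (Fin.cons (snd _ _ ≫ fst _ _) (Fin.cons (snd _ _ ≫ snd _ _)
            fun i => fst _ _ ≫ Fin.tail v i))))
      have hs : start.toFun γ = (γ, (0 : ℕ), f.eval fun i => (Fin.tail v i).toFun γ) :=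
        congrArg (fun m => (γ, (0 : ℕ), m)) (interp_toFun f _ γ)
      have hg : ∀ k m : ℕ, step.toFun (γ, k, m) =
          (γ, k + 1, g.eval (Fin.cons k (Fin.cons m fun i => (Fin.tail v i).toFun γ))) :=
        fun k m => by
          refine congrArg (fun m => (γ, k + 1, m)) ((interp_toFun g _ _).trans
            (congrArg g.eval (funext fun i => ?_)))
          induction i using Fin.cases with
          | zero => rfl
          | succ j => induction j using Fin.cases <;> rfl
      have h := (iter_toFun start step (γ, (v 0).toFun γ)).trans (iterate_prec hs hg _)
      exact congrArg (fun q : Γ.carrier × ℕ × ℕ => q.2.2) h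

/-- Truth values with every number as realizer form an assembly into which every function is
tracked. After precomposition with the epimorphism `z`, the characteristic function of `S` along `w`
agrees with the constant truth; hence `w` already lands in `S`. -/
theorem strongMono_subIncl (X : Asm) (S : Set X.carrier) : StrongMono (subIncl X S) where
  mono := ⟨fun f g h => by
    ext z
    exact Subtype.ext (congrArg (fun k : _ ⟶ X => k.toFun z) h)⟩
  rlp P Q z hz := ⟨fun {u w} sq => by
    let Ω : Asm := ⟨Prop, fun _ _ => True, fun _ => ⟨0, trivial⟩⟩
    let χ (p : Q.carrier → Prop) : Q ⟶ Ω := homMk p (.of_subset fun _ _ _ => trivial)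
    have h : χ (fun q => w.toFun q ∈ S) = χ fun _ => True := by
      rw [← cancel_epi z]
      ext p
      have hp : (u.toFun p).1 = w.toFun (z.toFun p) :=
        congrArg (fun k : P ⟶ X => k.toFun p) sq.w
      exact ⟨fun _ => trivial, fun _ => Set.mem_of_eq_of_mem hp.symm (u.toFun p).2⟩
    have hS : ∀ q, w.toFun q ∈ S := fun q =>
      of_eq_true (congrArg (fun k : Q ⟶ Ω => k.toFun q) h)
    refine ⟨⟨⟨subLift S w hS, ?_, rfl⟩⟩⟩
    ext p
    exact Subtype.ext (congrArg (fun k : P ⟶ X => k.toFun p) sq.w).symm⟩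

instance (X : Asm) (S : Set X.carrier) : StrongMono (subIncl X S) := strongMono_subIncl X S

/-- The strong subobject on a set of elements. -/
noncomputable def strongSub {X : Asm} (S : Set X.carrier) :
    (strongSubobjectDoctrine Asm).Fib X :=
  (⟨Subobject.mk (subIncl X S), by
    rw [← Subobject.underlyingIso_hom_comp_eq_mk]
    infer_instance⟩ : StrongSubobject X)

theorem factors_mk_subIncl {X Z : Asm} (S : Set X.carrier) (g : Z ⟶ X) :
    (Subobject.mk (subIncl X S)).Factors g ↔ ∀ z, g.toFun z ∈ S := by
  rw [Subobject.mk_factors_iff]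
  constructor
  · rintro ⟨k, rfl⟩ z
    exact (k.toFun z).2
  · exact fun h => ⟨subLift S g h, rfl⟩

theorem strongSub_le {X : Asm} {S T : Set X.carrier} : strongSub S ≤ strongSub T ↔ S ⊆ T := by
  change Subobject.mk (subIncl X S) ≤ Subobject.mk (subIncl X T) ↔ _
  simp only [le_iff_forall_factors, factors_mk_subIncl]
  -- Points of the assembly are enough to test the inclusion.
  exact ⟨fun h x hx => h _ (point x) (fun _ => hx) (), fun h _ _ hg z => h (hg z)⟩

/-- The corestriction of an arrow to its image, with realizers induced from `X`, is surjective and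
so epi. For a strong monomorphism the lifting property then yields an inverse over `X`. -/
theorem exists_strongSub_eq {X : Asm} (α : (strongSubobjectDoctrine Asm).Fib X) :
    ∃ S, strongSub S = α := by
  obtain ⟨M, hM⟩ : StrongSubobject X := α
  refine ⟨Set.range M.arrow.toFun, Subtype.ext (le_antisymm ?_ ?_)⟩
  · let e : (M : Asm) ⟶ sub X (Set.range M.arrow.toFun) := subLift _ M.arrow fun z => ⟨z, rfl⟩
    have he : Epi e := ⟨fun g h hgh => by
      ext ⟨_, z, rfl⟩
      exact congrArg (fun k : (M : Asm) ⟶ _ => k.toFun z) hgh⟩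
    have sq : CommSq (𝟙 (M : Asm)) e M.arrow (subIncl X _) := ⟨rfl⟩
    have := hM.rlp e
    exact Subobject.mk_le_of_comm sq.lift sq.fac_right
  · exact Subobject.le_mk_of_comm (subLift _ M.arrow fun z => ⟨z, rfl⟩) rfl

theorem sub_strongSub {X Y : Asm} (f : X ⟶ Y) (S : Set Y.carrier) :
    (strongSubobjectDoctrine Asm).sub f (strongSub S) = strongSub (f.toFun ⁻¹' S) := by
  refine Subtype.ext ?_
  change (Subobject.pullback f).obj (Subobject.mk (subIncl Y S)) = Subobject.mk (subIncl X _)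
  refine le_antisymm ?_ ?_ <;>
  · simp only [le_iff_forall_factors, pullback_factors_iff, factors_mk_subIncl]
    exact fun _ _ h => h

theorem strongSub_inf {X : Asm} (S T : Set X.carrier) :
    strongSub S ⊓ strongSub T = strongSub (S ∩ T) :=
  eq_of_forall_le_iff fun α => by
    obtain ⟨R, rfl⟩ := exists_strongSub_eq α
    simp only [le_inf_iff, strongSub_le, Set.subset_inter_iff]

theorem strongSub_univ (X : Asm) : strongSub (Set.univ : Set X.carrier) = ⊤ :=
  top_unique <| by
    obtain ⟨R, hR⟩ := exists_strongSub_eq (⊤ : (strongSubobjectDoctrine Asm).Fib X)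
    rw [← hR, strongSub_le]
    exact Set.subset_univ R

/-- The exponential of assemblies. -/
def exp (A B : Asm) : Asm where
  carrier := A ⟶ B
  rel f t := Tracks A B t f.toFun
  total f := f.tracked

/-- Evaluation. -/
def expEv (A B : Asm) : exp A B ⊗ A ⟶ B :=
  homMk (fun p => Hom.toFun p.1 p.2) <| by
    refine .of_partrec (f := fun n => app n.unpair.1 n.unpair.2)
      (partrec₂_app.comp (Computable.fst.comp Computable.unpair)
        (Computable.snd.comp Computable.unpair)) ?_
    rintro p n ⟨h₁, h₂⟩
    exact h₁ _ _ h₂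

theorem isWeakEvaluation_expEv (A B : Asm) : IsWeakEvaluation (expEv A B) := by
  intro X f
  obtain ⟨t, ht⟩ := f.tracked
  have h : ∀ x n, X.rel x n → Tracks A B (curryIdx t n) fun a => f.toFun (x, a) := by
    intro x n hn a m hm
    rw [app_curryIdx]
    exact ht (x, a) _ (by exact ⟨by simpa using hn, by simpa using hm⟩)
  refine ⟨homMk (Y := exp A B) (fun x => ⟨fun a => f.toFun (x, a), _,
    h x _ (X.total x).choose_spec⟩) ?_, rfl⟩
  exact .of_computable (curryIdx t) (computable₂_curryIdx.comp (Computable.const t) Computable.id)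
    fun x n hn => h x n hn

/-- Strong subobjects of assemblies form a weak hyperdoctrine. -/
noncomputable def weakHyperdoctrine : WeakHyperdoctrine (strongSubobjectDoctrine Asm) :=
  .ofStable (fun A => strongSub {p : A.carrier × A.carrier | p.1 = p.2})
    (fun X A α β => by
      obtain ⟨S, rfl⟩ := exists_strongSub_eq α
      obtain ⟨T, rfl⟩ := exists_strongSub_eq β
      simp only [sub_strongSub, strongSub_inf, strongSub_le]
      constructor
      · exact fun h p hp => h ⟨hp, rfl⟩
      · rintro h ⟨⟨x, a⟩, a'⟩ ⟨hp, rfl : a = a'⟩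
        exact h hp)
    (fun A B => ⟨_, _, isWeakEvaluation_expEv A B⟩)
    (fun A => ⟨strongSub ∅, fun X f δ => by
      obtain ⟨D, rfl⟩ := exists_strongSub_eq δ
      rw [sub_strongSub, strongSub_le]
      exact fun _ h => h.elim⟩)
    (fun {A} α β => by
      obtain ⟨S, rfl⟩ := exists_strongSub_eq α
      obtain ⟨T, rfl⟩ := exists_strongSub_eq β
      refine ⟨strongSub (S ∪ T), fun X f δ => ?_⟩
      obtain ⟨D, rfl⟩ := exists_strongSub_eq δ
      simp only [sub_strongSub, strongSub_le]
      exact Set.union_subset_iff)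
    (fun {A} α β => by
      obtain ⟨S, rfl⟩ := exists_strongSub_eq α
      obtain ⟨T, rfl⟩ := exists_strongSub_eq β
      refine ⟨strongSub {a | a ∈ S → a ∈ T}, fun X f δ => ?_⟩
      obtain ⟨D, rfl⟩ := exists_strongSub_eq δ
      simp only [sub_strongSub, strongSub_inf, strongSub_le]
      exact ⟨fun h x hx => h hx.1 hx.2, fun h x hx hS => h ⟨hx, hS⟩⟩)
    (fun {A} B α => by
      obtain ⟨S, rfl⟩ := exists_strongSub_eq α
      refine ⟨strongSub {a | ∃ b, (a, b) ∈ S}, fun X f δ => ?_⟩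
      obtain ⟨D, rfl⟩ := exists_strongSub_eq δ
      simp only [sub_strongSub, strongSub_le]
      exact ⟨fun h p hp => h ⟨p.2, hp⟩, fun h x ⟨b, hb⟩ => h (a := (x, b)) hb⟩)
    (fun {A} B α => by
      obtain ⟨S, rfl⟩ := exists_strongSub_eq α
      refine ⟨strongSub {a | ∀ b, (a, b) ∈ S}, fun X f δ => ?_⟩
      obtain ⟨D, rfl⟩ := exists_strongSub_eq δ
      simp only [sub_strongSub, strongSub_le]
      exact ⟨fun h p hp => h hp p.2, fun h x hx b => h (a := (x, b)) hx⟩)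

/-- Strong subobjects of assemblies form an arithmetic doctrine. -/
noncomputable def arithmeticDoctrine : ArithmeticDoctrine (strongSubobjectDoctrine Asm) where
  toWeakHyperdoctrine := weakHyperdoctrine
  nno := nno
  induction A φ h₀ h₁ := by
    obtain ⟨S, rfl⟩ := exists_strongSub_eq φ
    rw [sub_strongSub, ← strongSub_univ, strongSub_le] at *
    rintro ⟨x, n⟩ -
    -- Predicates here are plain subsets, so ordinary induction suffices and no realizer has to be
    -- produced.
    induction n with
    | zero => exact h₀ trivial
    | succ n ih => exact h₁ ih

theorem ex_strongSub {A B : Asm} (S : Set (A ⊗ B).carrier) :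
    arithmeticDoctrine.ex B (strongSub S) =
      strongSub {a | ∃ b, ((a, b) : A.carrier × B.carrier) ∈ S} :=
  arithmeticDoctrine.ex_eq fun δ => by
    obtain ⟨D, rfl⟩ := exists_strongSub_eq δ
    rw [sub_strongSub, strongSub_le, strongSub_le]
    exact ⟨fun h p hp => h ⟨p.2, hp⟩, fun h x ⟨b, hb⟩ => h (a := (x, b)) hb⟩

theorem all_strongSub {A B : Asm} (S : Set (A ⊗ B).carrier) :
    arithmeticDoctrine.all B (strongSub S) =
      strongSub {a | ∀ b, ((a, b) : A.carrier × B.carrier) ∈ S} :=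
  arithmeticDoctrine.all_eq fun δ => by
    obtain ⟨D, rfl⟩ := exists_strongSub_eq δ
    rw [sub_strongSub, strongSub_le, strongSub_le]
    exact ⟨fun h p hp => h hp p.2, fun h x hx b => h (a := (x, b)) hx⟩

theorem eqAt_eq {Γ A : Asm} (f g : Γ ⟶ A) :
    arithmeticDoctrine.eqAt f g = strongSub {γ | f.toFun γ = g.toFun γ} := sub_strongSub _ _

theorem kleene_strongSub (T : PrimrecTerm 3) (U : PrimrecTerm 1) {A Γ : Asm}
    (S : Set ((nat ⊗ nat) ⊗ A).carrier) (e x y : Γ ⟶ nat) (a : Γ ⟶ A) :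
    arithmeticDoctrine.kleene T U (strongSub S) e x y a =
      strongSub {γ | T.eval ![e.toFun γ, x.toFun γ, y.toFun γ] = 1 ∧
        (((x.toFun γ, U.eval ![y.toFun γ]), a.toFun γ) : (ℕ × ℕ) × A.carrier) ∈ S} := by
  have hT : ∀ γ, (nno.interp T ![e, x, y]).toFun γ =
      T.eval ![e.toFun γ, x.toFun γ, y.toFun γ] := fun γ => (interp_toFun T _ γ).trans
    (congrArg T.eval (funext fun i => by fin_cases i <;> rfl))
  have hU : ∀ γ, (nno.interp U ![y]).toFun γ = U.eval ![y.toFun γ] := fun γ =>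
    (interp_toFun U _ γ).trans (congrArg U.eval (funext fun i => by fin_cases i; rfl))
  refine ((congrArg₂ (· ⊓ ·) (eqAt_eq _ _) (sub_strongSub _ _)).trans
    (strongSub_inf _ _)).trans (congrArg strongSub (Set.ext fun γ => and_congr ?_ ?_))
  · exact Eq.congr_left (hT γ)
  · exact iff_of_eq (congrArg (fun n => (((x.toFun γ, n), a.toFun γ) : (ℕ × ℕ) × A.carrier) ∈ S)
      (hU γ))

theorem recursive_strongSub (T : PrimrecTerm 3) (U : PrimrecTerm 1) {A : Asm}
    (S : Set ((nat ⊗ nat) ⊗ A).carrier) :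
    arithmeticDoctrine.recursive T U (strongSub S) =
      strongSub {a | ∃ e : ℕ, ∀ x : ℕ, ∃ y : ℕ, T.eval ![e, x, y] = 1 ∧
        (((x, U.eval ![y]), a) : (ℕ × ℕ) × A.carrier) ∈ S} :=
  (congrArg (fun α => arithmeticDoctrine.ex nat (arithmeticDoctrine.all nat
    (arithmeticDoctrine.ex nat α))) (kleene_strongSub T U S _ _ _ _)).trans <| by
      rw [ex_strongSub, all_strongSub, ex_strongSub]
      rfl

theorem satisfiesTCT : SatisfiesTCT (strongSubobjectDoctrine Asm) := by
  refine ⟨arithmeticDoctrine, WeakHyperdoctrine.comprehensiveDiagonals _ fun Z A f g h => ?_,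
    fun T U hTU => ?_⟩
  · have h' : ⊤ ≤ arithmeticDoctrine.eqAt f g := h
    rw [eqAt_eq, ← strongSub_univ, strongSub_le] at h'
    ext z
    exact h' trivial
  · refine ⟨_, _, isWeakEvaluation_expEv nat nat, ?_⟩
    rw [arithmeticDoctrine.le_all_iff]
    refine le_trans le_top ((Doctrine.sub_top _ _).symm.le.trans (Doctrine.sub_mono _ _ ?_))
    refine le_of_le_of_eq ?_ ((congrArg (arithmeticDoctrine.recursive T U) (eqAt_eq _ _)).trans
      (recursive_strongSub T U _)).symm
    rw [← strongSub_univ, strongSub_le]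
    rintro f -
    -- The index is any tracker of `f`; it need not be computed from `f`, because the existential
    -- quantifier is that of sets.
    obtain ⟨e, he⟩ := f.tracked
    refine ⟨e, fun x => ?_⟩
    -- The number `x` is its own realizer, and the only realizer of `f x` is `f x`, so the tracker
    -- computes `f` itself.
    obtain ⟨m, hm, hm'⟩ := he x x rfl
    obtain ⟨y, hy, hy'⟩ := (hTU e x m).1 hm
    exact ⟨y, hy, hy'.trans hm'⟩

end Asm

end ChurchThesis
namespace ChurchThesis

/-! ## Variations of partitioned assemblies -/

namespace PAsm

variable {A B X : PAsm}

/-- The set of realizers of an element. -/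
abbrev real (A : PAsm) : A.obj.carrier → Set ℕ := A.obj.real

/-- The total space of a predicate. -/
def total (φ : A.obj.carrier → Set ℕ) : PAsm where
  obj :=
    { carrier := {p : A.obj.carrier × ℕ // p.2 ∈ φ p.1}
      rel p k := A.obj.rel p.1.1 k.unpair.1 ∧ k.unpair.2 = p.1.2
      total p := by
        obtain ⟨n, hn⟩ := A.obj.total p.1.1
        exact ⟨Nat.pair n p.1.2, by simpa using hn⟩ }
  property := by
    rintro p m n ⟨h₁, h₂⟩ ⟨h₃, h₄⟩
    rw [← Nat.pair_unpair m, ← Nat.pair_unpair n, A.property _ _ _ h₁ h₃, h₂, h₄]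

/-- The projection from the total space of a predicate. -/
def totalProj (φ : A.obj.carrier → Set ℕ) : total φ ⟶ A :=
  ObjectProperty.homMk (Asm.homMk (fun p => p.1.1)
    (.of_computable _ (Computable.fst.comp Computable.unpair) fun _ _ h => h.1))

/-- The projection from the total space, as an object over the base. -/
def totalOver (φ : A.obj.carrier → Set ℕ) : ArrowsInto A := Over.mk (totalProj φ)

/-- A factorization through the total space assigns to each `z` a realizer of `φ` and is tracked by
a program computing that realizer. Conversely, a program turns the realizer of `z` into a point of
the total space. -/
theorem le_totalOver_iff {f : ArrowsInto A} {φ : A.obj.carrier → Set ℕ} :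
    f ≤ totalOver φ ↔
      Entails f.toOver.left.real fun z => φ (f.toOver.hom.hom.toFun z) := by
  rw [ArrowsInto.le_iff]
  constructor
  · rintro ⟨k, hk⟩
    rw [← hk]
    refine (Asm.entails_hom k.hom).trans (.of_computable _
      (Computable.snd.comp Computable.unpair) fun z n hn => ?_)
    exact Set.mem_of_eq_of_mem hn.2 (k.hom.toFun z).2
  · rintro h
    have h' : ∃ t, ∀ z n, f.toOver.left.obj.rel z n →
        ∃ m ∈ app t n, A.obj.rel (f.toOver.hom.hom.toFun z) m.unpair.1 ∧
          m.unpair.2 ∈ φ (f.toOver.hom.hom.toFun z) :=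
      (Asm.entails_hom f.toOver.hom.hom).and h
    obtain ⟨t, ht⟩ := h'
    -- This is where partitionedness enters: the output of the program becomes part of the value at
    -- `z`, so it must not depend on which realizer of `z` is fed in.
    choose r hr using f.toOver.left.obj.total
    choose m hm hm' using fun z => ht z (r z) (hr z)
    refine ⟨ObjectProperty.homMk ⟨fun z => ⟨(_, (m z).unpair.2), (hm' z).2⟩, t, fun z n hn => ?_⟩,
      rfl⟩
    obtain rfl := f.toOver.left.property _ _ _ hn (hr z)
    exact ⟨m z, hm z, (hm' z).1, rfl⟩

/-- The variation given by a predicate with values in sets of realizers. -/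
def var (φ : A.obj.carrier → Set ℕ) : (variationDoctrine PAsm).Fib A :=
  (toAntisymmetrization (· ≤ ·) (totalOver φ) : Variation A)

/-- A point of the total space is realized by a code of a realizer of `a` and a realizer of `φ a`;
hence the extra hypothesis `A.real a`. -/
theorem var_le {φ ψ : A.obj.carrier → Set ℕ} :
    var φ ≤ var ψ ↔ Entails (fun a => conj (A.real a) (φ a)) ψ := by
  refine (le_totalOver_iff (f := totalOver φ)).trans ⟨?_, ?_⟩
  · rintro ⟨t, ht⟩
    exact ⟨t, fun a n hn => ht ⟨(a, n.unpair.2), hn.2⟩ n ⟨hn.1, rfl⟩⟩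
  · rintro ⟨t, ht⟩
    exact ⟨t, fun p n hn => ht p.1.1 n ⟨hn.1, Set.mem_of_eq_of_mem hn.2 p.2⟩⟩

/-- An arrow into `A` is equivalent to the predicate sending `a` to the set of realizers of the
elements lying over `a`. -/
theorem exists_var_eq (α : (variationDoctrine PAsm).Fib A) : ∃ φ, var φ = α := by
  obtain ⟨f⟩ : Variation A := α
  let φ : A.obj.carrier → Set ℕ := fun a =>
    {n | ∃ z, f.toOver.hom.hom.toFun z = a ∧ f.toOver.left.obj.rel z n}
  refine ⟨φ, Quotient.sound ⟨?_, le_totalOver_iff.2 (.of_subset fun z n hn => ⟨z, rfl, hn⟩)⟩⟩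
  -- The element over `a` is chosen without computation, but it has `n` as a realizer and `n` is
  -- part of the input, so the choice is tracked by a projection.
  refine ArrowsInto.le_iff.2 ⟨ObjectProperty.homMk (Asm.homMk (fun p => p.2.choose)
    (.of_computable _ (Computable.snd.comp Computable.unpair) fun p n hn => ?_)), ?_⟩
  · exact Set.mem_of_eq_of_mem hn.2 p.2.choose_spec.2
  · ext p
    exact p.2.choose_spec.1

/-- By the adjunction with postcomposition, an arrow `g` into `A` lies below either side exactly
when realizers of `φ (f (g z))` are computable from those of `z`. -/
theorem sub_var (f : A ⟶ B) (φ : B.obj.carrier → Set ℕ) :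
    (variationDoctrine PAsm).sub f (var φ) = var fun a => φ (f.hom.toFun a) :=
  Variation.eq_of_forall fun g => by
    refine (Variation.le_pull_iff f g (var φ)).trans ?_
    exact (le_totalOver_iff (f := g.push f)).trans
      (le_totalOver_iff (f := g) (φ := fun a => φ (f.hom.toFun a))).symm

theorem var_inf (φ ψ : A.obj.carrier → Set ℕ) :
    var φ ⊓ var ψ = var fun a => conj (φ a) (ψ a) :=
  eq_of_forall_le_iff fun α => by
    obtain ⟨χ, rfl⟩ := exists_var_eq α
    simp only [le_inf_iff, var_le]
    exact ⟨fun h => h.1.and h.2, fun h => ⟨h.left, h.right⟩⟩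

theorem top_le_var {φ : A.obj.carrier → Set ℕ} : ⊤ ≤ var φ ↔ Entails A.real φ :=
  le_totalOver_iff (f := ArrowsInto.top A)

/-- The natural numbers object of the category of partitioned assemblies. -/
def nat : PAsm := ⟨Asm.nat, Asm.isPartitioned_nat⟩

/-- The natural number object of the category of partitioned assemblies. -/
def nno : PNNO PAsm where
  N := nat
  zero := ObjectProperty.homMk Asm.nno.zero
  succ := ObjectProperty.homMk Asm.nno.succ
  existsUnique {A X} a f := by
    refine ⟨ObjectProperty.homMk (Asm.iterate a.hom f.hom), ⟨rfl, ?_⟩, ?_⟩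
    · ext p
      exact Function.iterate_succ_apply' _ _ _
    · rintro k ⟨h₀, h₁⟩
      ext p
      exact eq_iterate (fun x => congrArg (fun g : A ⟶ X => g.hom.toFun x) h₀)
        (fun x n => congrArg (fun g : A ⊗ nat ⟶ X => g.hom.toFun (x, n)) h₁) p

theorem iter_toFun (a : A ⟶ X) (f : X ⟶ X) (p : (A ⊗ nno.N).obj.carrier) :
    (nno.iter a f).hom.toFun p = f.hom.toFun^[p.2] (a.hom.toFun p.1) := by
  have h := (nno.existsUnique a f).choose_spec.1
  exact eq_iterate (fun x => congrArg (fun g : A ⟶ X => g.hom.toFun x) h.1)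
    (fun x n => congrArg (fun g : A ⊗ nat ⟶ X => g.hom.toFun (x, n)) h.2) p

theorem interp_toFun : ∀ {n : ℕ} (t : PrimrecTerm n) {Γ : PAsm} (v : Fin n → (Γ ⟶ nno.N))
    (γ : Γ.obj.carrier), (nno.interp t v).hom.toFun γ = t.eval fun i => (v i).hom.toFun γ
  | _, .zero, _, _, _ => rfl
  | _, .succ, _, _, _ => rfl
  | _, .proj _, _, _, _ => rfl
  | _, .comp f g, _, v, γ => (interp_toFun f _ γ).trans
      (congrArg f.eval (funext fun i => interp_toFun (g i) v γ))
  | _, .prec f g, Γ, v, γ => by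
      let start : Γ ⟶ Γ ⊗ (nno.N ⊗ nno.N) :=
        lift (𝟙 Γ) (lift (toUnit Γ ≫ nno.zero) (nno.interp f (Fin.tail v)))
      let step : Γ ⊗ (nno.N ⊗ nno.N) ⟶ Γ ⊗ (nno.N ⊗ nno.N) :=
        lift (fst _ _) (lift ((snd _ _ ≫ fst _ _) ≫ nno.succ)
          (nno.interp g (Fin.cons (snd _ _ ≫ fst _ _) (Fin.cons (snd _ _ ≫ snd _ _)
            fun i => fst _ _ ≫ Fin.tail v i))))
      have hs : start.hom.toFun γ = (γ, (0 : ℕ), f.eval fun i => (Fin.tail v i).hom.toFun γ) :=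
        congrArg (fun m => (γ, (0 : ℕ), m)) (interp_toFun f _ γ)
      have hg : ∀ k m : ℕ, step.hom.toFun (γ, k, m) =
          (γ, k + 1, g.eval (Fin.cons k (Fin.cons m fun i => (Fin.tail v i).hom.toFun γ))) :=
        fun k m => by
          refine congrArg (fun m => (γ, k + 1, m)) ((interp_toFun g _ _).trans
            (congrArg g.eval (funext fun i => ?_)))
          induction i using Fin.cases with
          | zero => rfl
          | succ j => induction j using Fin.cases <;> rfl
      have h := (iter_toFun start step (γ, (v 0).hom.toFun γ)).trans (iterate_prec hs hg _)
      exact congrArg (fun q : Γ.obj.carrier × ℕ × ℕ => q.2.2) h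

/-- The weak exponential of partitioned assemblies: functions with an index tracking them. -/
def exp (A B : PAsm) : PAsm where
  obj :=
    { carrier := {p : ℕ × (A.obj.carrier → B.obj.carrier) // Asm.Tracks A.obj B.obj p.1 p.2}
      rel p k := k = p.1.1
      total p := ⟨_, rfl⟩ }
  property := by
    rintro p _ _ rfl rfl
    rfl

/-- Evaluation. -/
def expEv (A B : PAsm) : exp A B ⊗ A ⟶ B :=
  ObjectProperty.homMk <| Asm.homMk (fun p => p.1.1.2 p.2) <| by
    refine .of_partrec (f := fun n => app n.unpair.1 n.unpair.2)
      (partrec₂_app.comp (Computable.fst.comp Computable.unpair)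
        (Computable.snd.comp Computable.unpair)) ?_
    rintro ⟨⟨⟨t, f⟩, ht⟩, a⟩ n ⟨h₁ : _ = t, h₂⟩
    rw [h₁]
    exact ht _ _ h₂

theorem isWeakEvaluation_expEv (A B : PAsm) : IsWeakEvaluation (expEv A B) := by
  intro X f
  obtain ⟨t, ht⟩ := f.hom.tracked
  -- An element of the exponential contains its index, and the index attached to `x` is computed
  -- from a realizer of `x`. It is computed correctly because that realizer is unique.
  choose r hr using X.obj.total
  have h : ∀ x, Asm.Tracks A.obj B.obj (curryIdx t (r x)) fun a => f.hom.toFun (x, a) := by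
    intro x a m hm
    rw [app_curryIdx]
    exact ht (x, a) _ (by exact ⟨by simpa using hr x, by simpa using hm⟩)
  refine ⟨ObjectProperty.homMk (Asm.homMk (Y := (exp A B).obj) (fun x => ⟨(_, _), h x⟩) ?_), rfl⟩
  refine .of_computable (curryIdx t)
    (computable₂_curryIdx.comp (Computable.const t) Computable.id) fun x n hn => ?_
  exact congrArg (curryIdx t) (X.property _ _ _ hn (hr x))

/-- Stated over an arbitrary `f`, as `ofStable` requires, so that the Beck–Chevalley condition is
included. Realizers of pairs are pairs of realizers, and the two sides differ only by regrouping. -/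
theorem ex_adj (f : X ⟶ A) (φ : (A ⊗ B).obj.carrier → Set ℕ) (δ : X.obj.carrier → Set ℕ) :
    Entails (fun x => conj (X.real x)
      (exis fun b => conj (B.real b) (φ (f.hom.toFun x, b)))) δ ↔
    Entails (fun p : (X ⊗ B).obj.carrier => conj ((X ⊗ B).real p) (φ (f.hom.toFun p.1, p.2)))
      fun p => δ p.1 := by
  constructor
  · intro h
    refine .trans (.intro fun k => ?_)
      (h.comap fun p : (X ⊗ B).obj.carrier => p.1)
    exact k.left.left.and (.exis_intro (fun p => p.2) (k.left.right.and k.right))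
  · intro h
    refine (Entails.refl _).right.exis_elim (.trans (.intro fun k => ?_) h)
    exact (k.left.left.and k.right.left).and k.right.right

theorem all_adj (f : X ⟶ A) (φ : (A ⊗ B).obj.carrier → Set ℕ) (δ : X.obj.carrier → Set ℕ) :
    Entails (fun x => conj (X.real x) (δ x))
      (fun x => univ fun b => impl (B.real b) (φ (f.hom.toFun x, b))) ↔
    Entails (fun p : (X ⊗ B).obj.carrier => conj ((X ⊗ B).real p) (δ p.1))
      fun p => φ (f.hom.toFun p.1, p.2) := by
  constructor
  · intro h
    refine .intro fun k => ?_
    exact ((k.left.left.and k.right).trans (h.comap fun p : (X ⊗ B).obj.carrier => p.1)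
      |>.univ_elim fun p => p.2).mp k.left.right
  · intro h
    refine .univ_intro (.impl_intro (.trans (.intro fun k => ?_) h))
    exact (k.left.left.and k.right).and k.left.right

/-- Variations of partitioned assemblies form a weak hyperdoctrine. -/
noncomputable def weakHyperdoctrine : WeakHyperdoctrine (variationDoctrine PAsm) :=
  .ofStable (fun A => var fun p : (A ⊗ A).obj.carrier =>
      {k | p.1 = p.2 ∧ A.obj.rel p.1 k})
    (fun X A α β => by
      obtain ⟨φ, rfl⟩ := exists_var_eq α
      obtain ⟨ψ, rfl⟩ := exists_var_eq β
      simp only [sub_var, var_inf, var_le]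
      constructor
      · intro h
        refine .trans (.intro fun k => ?_) (h.comap fun q : (X ⊗ A).obj.carrier => (q, q.2))
        exact (k.left.and k.left.right).and (k.right.and
          (k.left.right.trans (.of_subset fun _ _ hn => ⟨rfl, hn⟩)))
      · intro h
        refine .intro fun k => ?_
        exact k.right.right.eq_subst (θ := fun p a => ψ (p.1, a)) (.trans
          (k.left.left.and k.right.left) (h.comap fun p : ((X ⊗ A) ⊗ A).obj.carrier => p.1)))
    (fun A B => ⟨_, _, isWeakEvaluation_expEv A B⟩)
    (fun A => ⟨var fun _ => ∅, fun X f δ => by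
      obtain ⟨δ, rfl⟩ := exists_var_eq δ
      rw [sub_var, var_le]
      exact (Entails.refl _).right.false_elim⟩)
    (fun {A} α β => by
      obtain ⟨φ, rfl⟩ := exists_var_eq α
      obtain ⟨ψ, rfl⟩ := exists_var_eq β
      refine ⟨var fun a => disj (φ a) (ψ a), fun X f δ => ?_⟩
      obtain ⟨δ, rfl⟩ := exists_var_eq δ
      simp only [sub_var, var_le]
      constructor
      · exact fun h => ⟨.trans (.intro fun k => k.left.and k.right.disj_inl) h,
          .trans (.intro fun k => k.left.and k.right.disj_inr) h⟩
      · rintro ⟨h₁, h₂⟩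
        exact (Entails.refl _).right.disj_elim (.trans (.intro fun k => k.left.left.and k.right) h₁)
          (.trans (.intro fun k => k.left.left.and k.right) h₂))
    (fun {A} α β => by
      obtain ⟨φ, rfl⟩ := exists_var_eq α
      obtain ⟨ψ, rfl⟩ := exists_var_eq β
      refine ⟨var fun a => impl (φ a) (ψ a), fun X f δ => ?_⟩
      obtain ⟨δ, rfl⟩ := exists_var_eq δ
      simp only [sub_var, var_inf, var_le]
      constructor
      · exact fun h => .intro fun k => ((k.left.and k.right.left).trans h).mp k.right.right
      · exact fun h => .impl_intro (.trans
          (.intro fun k => k.left.left.and (k.left.right.and k.right)) h))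
    (fun {A} B α => by
      obtain ⟨φ, rfl⟩ := exists_var_eq α
      refine ⟨var fun a => exis fun b => conj (B.real b) (φ (a, b)), fun X f δ => ?_⟩
      obtain ⟨δ, rfl⟩ := exists_var_eq δ
      simp only [sub_var, var_le]
      exact ex_adj f φ δ)
    (fun {A} B α => by
      obtain ⟨φ, rfl⟩ := exists_var_eq α
      refine ⟨var fun a => univ fun b => impl (B.real b) (φ (a, b)), fun X f δ => ?_⟩
      obtain ⟨δ, rfl⟩ := exists_var_eq δ
      simp only [sub_var, var_le]
      exact all_adj f φ δ)

theorem real_nat (n : ℕ) : nat.real n = natEq n n :=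
  Set.ext fun _ => ⟨fun h => ⟨rfl, h⟩, fun h => h.2⟩

/-- Variations of partitioned assemblies form an arithmetic doctrine. -/
noncomputable def arithmeticDoctrine : ArithmeticDoctrine (variationDoctrine PAsm) where
  toWeakHyperdoctrine := weakHyperdoctrine
  nno := nno
  induction A φ h₀ h₁ := by
    obtain ⟨φ, rfl⟩ := exists_var_eq φ
    rw [sub_var, top_le_var] at h₀
    rw [sub_var, var_le] at h₁
    rw [top_le_var]
    have h := Entails.nat_rec (φ := A.real) (θ := fun a n => φ (a, n)) h₀
      (.trans (.intro fun k => (k.left.left.and (k.left.right.trans (.of_subset fun p _ h =>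
        (real_nat p.2).symm.subset h))).and k.right) h₁)
    refine .trans (.of_subset fun p n h' => ?_) h
    exact ⟨h'.1, (real_nat p.2).subset h'.2⟩

theorem ex_var (φ : (A ⊗ B).obj.carrier → Set ℕ) :
    arithmeticDoctrine.ex B (var φ) = var fun a => exis fun b => conj (B.real b) (φ (a, b)) :=
  arithmeticDoctrine.ex_eq fun δ => by
    obtain ⟨δ, rfl⟩ := exists_var_eq δ
    rw [sub_var, var_le, var_le]
    exact ex_adj (𝟙 A) φ δ

theorem all_var (φ : (A ⊗ B).obj.carrier → Set ℕ) :
    arithmeticDoctrine.all B (var φ) = var fun a => univ fun b => impl (B.real b) (φ (a, b)) :=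
  arithmeticDoctrine.all_eq fun δ => by
    obtain ⟨δ, rfl⟩ := exists_var_eq δ
    rw [sub_var, var_le, var_le]
    exact all_adj (𝟙 A) φ δ

theorem eqAt_eq (f g : X ⟶ A) : arithmeticDoctrine.eqAt f g =
    var fun x => {k | f.hom.toFun x = g.hom.toFun x ∧ A.obj.rel (f.hom.toFun x) k} := sub_var _ _

theorem kleene_var (T : PrimrecTerm 3) (U : PrimrecTerm 1)
    (ρ : ((nat ⊗ nat) ⊗ A).obj.carrier → Set ℕ) (e x y : X ⟶ nat) (a : X ⟶ A) :
    arithmeticDoctrine.kleene T U (var ρ) e x y a =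
      var fun γ => conj
        (natEq (T.eval ![e.hom.toFun γ, x.hom.toFun γ, y.hom.toFun γ]) 1)
        (ρ (((x.hom.toFun γ, U.eval ![y.hom.toFun γ]), a.hom.toFun γ) :
          (ℕ × ℕ) × A.obj.carrier)) := by
  have hT : ∀ γ, (nno.interp T ![e, x, y]).hom.toFun γ =
      T.eval ![e.hom.toFun γ, x.hom.toFun γ, y.hom.toFun γ] := fun γ =>
    (interp_toFun T _ γ).trans (congrArg T.eval (funext fun i => by fin_cases i <;> rfl))
  have hU : ∀ γ, (nno.interp U ![y]).hom.toFun γ = U.eval ![y.hom.toFun γ] := fun γ =>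
    (interp_toFun U _ γ).trans (congrArg U.eval (funext fun i => by fin_cases i; rfl))
  refine ((congrArg₂ (· ⊓ ·) (eqAt_eq _ _) (sub_var _ _)).trans
    (var_inf _ _)).trans (congrArg var (funext fun γ => congrArg₂ conj ?_ ?_))
  · exact congrArg (fun n => natEq n 1) (hT γ)
  · exact congrArg (fun n => ρ (((x.hom.toFun γ, n), a.hom.toFun γ) :
      (ℕ × ℕ) × A.obj.carrier)) (hU γ)

theorem recursive_var (T : PrimrecTerm 3) (U : PrimrecTerm 1)
    (ρ : ((nat ⊗ nat) ⊗ A).obj.carrier → Set ℕ) :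
    arithmeticDoctrine.recursive T U (var ρ) =
      var fun a => exis fun e : ℕ => conj (nat.real e) (univ fun x : ℕ => impl (nat.real x)
        (exis fun y : ℕ => conj (nat.real y) (conj (natEq (T.eval ![e, x, y]) 1)
          (ρ (((x, U.eval ![y]), a) : (ℕ × ℕ) × A.obj.carrier))))) :=
  (congrArg (fun α => arithmeticDoctrine.ex nat (arithmeticDoctrine.all nat
    (arithmeticDoctrine.ex nat α))) (kleene_var T U ρ _ _ _ _)).trans <| by
      rw [ex_var, all_var, ex_var]
      rfl

/-- Once both formulas are computed, this is `entails_church` with the elements of `A` as index set.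
The realizer of the parameter is discarded. -/
theorem paramCT {T : PrimrecTerm 3} {U : PrimrecTerm 1} (hTU : IsKleenePair T U) :
    arithmeticDoctrine.ParamCT T U := by
  intro A R
  obtain ⟨ρ, rfl⟩ := exists_var_eq R
  have h : var (A := A) (fun a => univ fun x : ℕ => impl (nat.real x) (exis fun n : ℕ =>
      conj (nat.real n) (ρ (((x, n), a) : (ℕ × ℕ) × A.obj.carrier)))) ≤
      arithmeticDoctrine.recursive T U (var ρ) := by
    refine le_of_le_of_eq ?_ (recursive_var T U ρ).symm
    rw [var_le]
    simp only [real_nat]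
    exact (Entails.refl _).right.trans (entails_church hTU _)
  refine le_of_eq_of_le ?_ h
  rw [sub_var]
  exact (congrArg (arithmeticDoctrine.all nat) (ex_var _)).trans (all_var _)

theorem satisfiesCT : SatisfiesCT (variationDoctrine PAsm) := by
  refine ⟨arithmeticDoctrine, WeakHyperdoctrine.comprehensiveDiagonals _ fun Z A f g h => ?_,
    fun T U hTU => (paramCT hTU).ct⟩
  have h' : ⊤ ≤ arithmeticDoctrine.eqAt f g := h
  rw [eqAt_eq, top_le_var] at h'
  obtain ⟨t, ht⟩ := h'
  ext z
  -- Internal equality has no realizers off the diagonal, so a single realizer at `z` forces actual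
  -- equality.
  obtain ⟨n, hn⟩ := Z.obj.total z
  obtain ⟨m, -, hm, -⟩ := ht z n hn
  exact hm

end PAsm

end ChurchThesis
namespace ChurchThesis

/-! ## Subobjects in the effective topos -/

theorem mk_le_iff_factors {C : Type u} [Category.{v} C] {A B : C} {f : B ⟶ A} [Mono f]
    {S : Subobject A} : Subobject.mk f ≤ S ↔ S.Factors f := by
  refine ⟨fun h => Subobject.factors_of_le f h (Subobject.mk_factors_self f),
    fun h => le_iff_forall_factors.2 fun Z g hg => ?_⟩
  obtain ⟨k, rfl⟩ := (Subobject.mk_factors_iff f g).1 hg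
  exact Subobject.factors_of_factors_right k h

namespace Eff

variable {I : Type} {ξ : I → Set ℕ} {X Y Z : Eff}

/-- Extensional predicates on an object of the effective topos. -/
structure Pred (X : Eff) : Type where
  val : X.carrier → Set ℕ
  ext : Entails (fun p : X.carrier × X.carrier => conj (val p.1) (X.eq p.1 p.2)) fun p => val p.2

namespace Pred

variable (φ ψ : Pred X)

theorem use_ext {x x' : I → X.carrier} (h : Entails ξ fun i => φ.val (x i))
    (h' : Entails ξ fun i => X.eq (x i) (x' i)) : Entails ξ fun i => φ.val (x' i) :=
  (h.and h').trans (φ.ext.comap fun i => (x i, x' i))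

/-- The object on which a predicate holds. -/
def obj : Eff where
  carrier := X.carrier
  eq x x' := conj (X.eq x x') (φ.val x)
  symm := .intro fun h => (eq_symm _ _ h.left).and (φ.use_ext h.right h.left)
  trans := .intro fun h => (eq_trans _ _ _ h.left.left h.right.left).and h.left.right

/-- The inclusion of the object on which a predicate holds. -/
def incl : FunRel φ.obj X where
  rel := φ.obj.eq
  strict := .intro fun h => (eq_left (X := φ.obj) _ _ h).and (eq_right _ _ h.left)
  ext := .intro fun h =>
    have h' := eq_symm (X := φ.obj) _ _ h.right.left
    (eq_trans _ _ _ h'.left (eq_trans _ _ _ h.left.left h.right.right)).and h'.right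
  single := .intro fun h => eq_trans _ _ _ (eq_symm _ _ h.left.left) h.right.left
  total := .exis_intro (fun x => x) (.refl _)

/-- Factorization through the object on which a predicate holds. -/
def factor (F : FunRel Z X)
    (h : Entails (fun p : Z.carrier × X.carrier => F.rel p.1 p.2) fun p => φ.val p.2) :
    FunRel Z φ.obj where
  rel := F.rel
  strict := .intro fun k => (F.use_left _ _ k).and ((F.use_right _ _ k).and (k.trans h))
  ext := .intro fun k => F.use_ext _ _ _ _ k.left k.right.left k.right.right.left
  single := .intro fun k => (F.use_single _ _ _ k.left k.right).and
    (k.use h (fun p => (p.1, p.2.1)) k.left)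
  total := F.total

instance : Mono φ.incl.toHom where
  right_cancellation {Z} f g hfg := by
    obtain ⟨H, rfl⟩ := exists_toHom_eq f
    obtain ⟨K, rfl⟩ := exists_toHom_eq g
    refine Quotient.sound (FunRel.equiv_of_entails (.intro fun h => ?_))
    have h' := FunRel.use_equiv (toHom_eq_iff.1 hfg) _ _
      (FunRel.comp_entails _ _ _ _ _ h (H.use_right _ _ h))
    refine h'.exis_elim (.intro fun k => ?_)
    exact K.use_ext _ _ _ _ k.right.left (K.use_left _ _ k.right.left) k.right.right

/-- The subobject on which a predicate holds. -/
noncomputable def toFib : (subobjectDoctrine Eff).Fib X := Subobject.mk φ.incl.toHom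

/-- The factorization is the same relation with a new codomain, so it exists as soon as the values
of `F` realizably satisfy `φ`. -/
theorem factors_toFib (F : FunRel Z X) : Subobject.Factors φ.toFib F.toHom ↔
    Entails (fun p : Z.carrier × X.carrier => F.rel p.1 p.2) fun p => φ.val p.2 := by
  refine (Subobject.mk_factors_iff _ _).trans ⟨?_, fun h => ⟨(φ.factor F h).toHom, ?_⟩⟩
  · rintro ⟨g, hg⟩
    obtain ⟨G, rfl⟩ := exists_toHom_eq g
    refine (toHom_eq_iff.1 hg).2.trans ((Entails.refl _).exis_elim (.intro fun k => ?_))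
    exact φ.use_ext k.right.right.right k.right.right.left
  · refine toHom_eq_iff.2 (FunRel.comp_equiv ?_)
    have k := Entails.refl fun p : (Z.carrier × X.carrier) × X.carrier =>
      conj (F.rel p.1.1 p.2) (φ.obj.eq p.2 p.1.2)
    exact F.use_ext _ _ _ _ k.left (F.use_left _ _ k.left) k.right.left

variable {φ ψ}

/-- Predicates are not required to be strict; the existence of `x` is supplied by the equality of
`φ.obj`, hence the extra hypothesis. -/
theorem toFib_le : φ.toFib ≤ ψ.toFib ↔
    Entails (fun x => conj (X.eq x x) (φ.val x)) ψ.val := by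
  refine mk_le_iff_factors.trans ((factors_toFib ψ φ.incl).trans ⟨fun h => ?_, fun h => ?_⟩)
  · exact h.comap fun x => (x, x)
  · have k := Entails.refl fun p : X.carrier × X.carrier => φ.obj.eq p.1 p.2
    exact ψ.use_ext (k.use h (fun p => p.1) ((eq_left _ _ k.left).and k.right)) k.left

theorem top_le_toFib : ⊤ ≤ φ.toFib ↔ Entails (fun x => X.eq x x) φ.val := by
  have h : (⊤ : Subobject X) ≤ φ.toFib ↔ Subobject.Factors φ.toFib (FunRel.id X).toHom := by
    rw [Subobject.top_eq_id]
    exact mk_le_iff_factors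
  refine h.trans ((factors_toFib φ _).trans ⟨fun h => h.comap fun x => (x, x), fun h => ?_⟩)
  have k := Entails.refl fun p : X.carrier × X.carrier => X.eq p.1 p.2
  exact φ.use_ext (k.use h (fun p => p.1) (eq_left _ _ k)) k

variable (φ ψ)

/-- Conjunction. -/
def and : Pred X where
  val x := conj (φ.val x) (ψ.val x)
  ext := .intro fun h => (φ.use_ext h.left.left h.right).and (ψ.use_ext h.left.right h.right)

/-- Reindexing. -/
def pull (F : FunRel Z X) : Pred Z where
  val z := exis fun x => conj (F.rel z x) (φ.val x)
  ext := (Entails.refl _).left.exis_elim <| .intro fun h => .exis_intro (fun p => p.2) <|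
    (F.use_ext _ _ _ _ h.right.left h.left.right (F.use_right _ _ h.right.left)).and h.right.right

/-- Reindexing along a function. -/
def comap (g : Z.carrier → X.carrier)
    (hg : Entails (fun p : Z.carrier × Z.carrier => Z.eq p.1 p.2) fun p => X.eq (g p.1) (g p.2)) :
    Pred Z where
  val z := φ.val (g z)
  ext := .intro fun h => φ.use_ext h.left (h.right.trans hg)

/-- A pulled-back subobject is determined by which arrows factor through it. Totality of `F` gives
one direction, single-valuedness the other. -/
theorem factors_pull (F : FunRel Z X) {W : Eff} (G : FunRel W Z) :
    Subobject.Factors (φ.pull F).toFib G.toHom ↔ Subobject.Factors φ.toFib (G.comp F).toHom := by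
  rw [factors_toFib, factors_toFib]
  constructor
  · intro h
    refine (Entails.refl _).exis_elim (.intro fun k => ?_)
    have hz := k.use h (fun p => (p.1.1, p.2)) k.right.left
    refine Entails.exis_elim hz (.intro fun l => ?_)
    exact φ.use_ext l.right.right (F.use_single _ _ _ l.right.left l.left.right.right)
  · intro h
    refine (F.use_total _ (G.use_right _ _ (.refl _))).exis_elim (.intro fun k => ?_)
    exact .exis_intro (fun p => p.2) (k.right.and (k.use h (fun p => (p.1.1, p.2))
      (FunRel.comp_entails _ _ _ _ _ k.left k.right)))

theorem sub_toFib (F : FunRel Z X) :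
    (subobjectDoctrine Eff).sub F.toHom φ.toFib = (φ.pull F).toFib := by
  have h : (Subobject.pullback F.toHom).obj φ.toFib = (φ.pull F).toFib := by
    refine le_antisymm (le_iff_forall_factors.2 fun W g hg => ?_)
      (le_iff_forall_factors.2 fun W g hg => ?_)
    · obtain ⟨G, rfl⟩ := exists_toHom_eq g
      exact (φ.factors_pull F G).2 ((pullback_factors_iff F.toHom _ _).1 hg)
    · obtain ⟨G, rfl⟩ := exists_toHom_eq g
      exact (pullback_factors_iff F.toHom _ _).2 ((φ.factors_pull F G).1 hg)
  exact h

/-- The image of a functional relation. -/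
def image (F : FunRel Z X) : Pred X where
  val x := exis fun z => F.rel z x
  ext := (Entails.refl _).left.exis_elim <| .intro fun h => .exis_intro (fun p => p.2) <|
    F.use_ext _ _ _ _ h.right (F.use_left _ _ h.right) h.left.right

/-- The kernel pair of a functional relation. -/
def kernel (F : FunRel Z X) : Pred (prod Z Z) where
  val p := exis fun x => conj (F.rel p.1 x) (F.rel p.2 x)
  ext := (Entails.refl _).left.exis_elim <| .intro fun h => .exis_intro (fun p => p.2) <|
    (F.use_ext _ _ _ _ h.right.left h.left.right.left (F.use_right _ _ h.right.left)).and
      (F.use_ext _ _ _ _ h.right.right h.left.right.right (F.use_right _ _ h.right.left))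

/-- The two projections of the kernel pair of `F` become equal after composition with `F`, so they
are equal. Read at the pair of two elements with a common image, this is injectivity with a uniform
realizer. -/
theorem mono_single (F : FunRel Z X) [hF : Mono F.toHom] :
    Entails (fun p : (Z.carrier × Z.carrier) × X.carrier =>
      conj (F.rel p.1.1 p.2) (F.rel p.1.2 p.2)) fun p => Z.eq p.1.1 p.1.2 := by
  have h : ((kernel F).incl.comp (prodFst Z Z)).toHom = ((kernel F).incl.comp (prodSnd Z Z)).toHom := by
    rw [← cancel_mono F.toHom]
    refine Quotient.sound (FunRel.comp_equiv ?_)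
    refine (Entails.refl _).left.exis_elim ?_
    refine (Entails.refl _).right.left.right.exis_elim (.intro fun k => ?_)
    have hF₁ := F.use_ext _ _ _ _ k.left.left.right (eq_symm _ _ (eq_trans _ _ _
      k.left.right.left.left.left k.left.right.right.left)) (F.use_right _ _ k.left.left.right)
    have hF₂ := F.use_ext _ _ _ _ k.right.right (F.use_left _ _ k.right.right)
      (F.use_single _ _ _ k.right.left hF₁)
    have h₁ := F.use_left _ _ hF₁
    have h₂ := F.use_left _ _ hF₂
    have hκ := FunRel.comp_entails (I := ((((Z.carrier × Z.carrier) × X.carrier) × Z.carrier) ×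
      (Z.carrier × Z.carrier)) × X.carrier) (kernel F).incl (prodSnd Z Z) (fun p => p.1.1.1.1)
      (fun p => p.1.1.1.1) (fun p => p.1.1.1.1.2)
      ((h₁.and h₂).and (.exis_intro (fun p => p.2) k.right)) (h₁.and h₂)
    exact FunRel.comp_entails _ _ _ _ _ hκ hF₂
  -- The pair `p.1` lies in the kernel pair and is sent to `p.1.1` by the first projection, hence
  -- also by the second, whose value is `p.1.2`.
  refine .intro fun k => ?_
  have h₁ := F.use_left _ _ k.left
  have h₂ := F.use_left _ _ k.right
  have h₃ := FunRel.comp_entails (kernel F).incl (prodFst Z Z)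
    (fun p : (Z.carrier × Z.carrier) × X.carrier => p.1) (fun p => p.1) (fun p => p.1.1)
    ((h₁.and h₂).and (.exis_intro (fun p => p.2) k)) (h₁.and h₂)
  refine (FunRel.use_equiv (toHom_eq_iff.1 h) _ _ h₃).exis_elim (.intro fun l => ?_)
  exact eq_symm _ _ (eq_trans _ _ _ l.right.left.left.right l.right.right.right)

/-- The inverse of a monomorphism on its image. -/
def imageInv (F : FunRel Z X) [Mono F.toHom] : FunRel (image F).obj Z where
  rel x z := F.rel z x
  strict := .intro fun h => ((F.use_right _ _ h).and (.exis_intro (fun p => p.2) h)).and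
    (F.use_left _ _ h)
  ext := .intro fun h => F.use_ext _ _ _ _ h.left h.right.right h.right.left.left
  single := (mono_single F).comap fun p : X.carrier × Z.carrier × Z.carrier => (p.2, p.1)
  total := (Entails.refl _).right

/-- A monomorphism is isomorphic over `X` to the inclusion of its image; the inverse is the opposite
relation, single-valued by `mono_single`. -/
theorem exists_toFib_eq (α : (subobjectDoctrine Eff).Fib X) : ∃ φ : Pred X, φ.toFib = α := by
  obtain ⟨Z, f, hf, rfl⟩ : ∃ (Z : Eff) (f : Z ⟶ X) (_ : Mono f), Subobject.mk f = α :=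
    ⟨_, (show Subobject X from α).arrow, inferInstance, Subobject.mk_arrow _⟩
  obtain ⟨F, rfl⟩ := exists_toHom_eq f
  refine ⟨image F, le_antisymm ?_ ?_⟩
  · refine mk_le_iff_factors.2 ((Subobject.mk_factors_iff _ _).2 ⟨(imageInv F).toHom, ?_⟩)
    refine toHom_eq_iff.2 (FunRel.comp_equiv (.intro fun k => ?_))
    exact (F.use_single _ _ _ k.left k.right).and (.exis_intro (fun p => p.2) k.left)
  · exact mk_le_iff_factors.2 ((factors_toFib _ F).2 (.exis_intro (fun p => p.1) (.refl _)))

theorem toFib_inf : φ.toFib ⊓ ψ.toFib = (φ.and ψ).toFib :=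
  eq_of_forall_le_iff fun α => by
    obtain ⟨χ, rfl⟩ := exists_toFib_eq α
    simp only [le_inf_iff, toFib_le]
    exact ⟨fun h => h.1.and h.2, fun h => ⟨Entails.left h, Entails.right h⟩⟩

variable {φ ψ}

/-- Since `F` is total and single-valued, "some value satisfies φ" and "every value satisfies φ" are
equivalent. The existential reading suits bounds from above, the universal one in `le_sub` bounds
from below. -/
theorem sub_le {F : FunRel Z X} {δ : Pred Z} :
    (subobjectDoctrine Eff).sub F.toHom φ.toFib ≤ δ.toFib ↔
      Entails (fun p : Z.carrier × X.carrier => conj (F.rel p.1 p.2) (φ.val p.2))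
        fun p => δ.val p.1 := by
  rw [sub_toFib, toFib_le]
  constructor
  · exact fun h => .intro fun k => k.use h (fun p => p.1) ((F.use_left _ _ k.left).and
      (.exis_intro (fun p => p.2) k))
  · exact fun h => (Entails.refl _).right.exis_elim ((Entails.refl _).right.trans h)

theorem le_sub {F : FunRel Z X} {δ : Pred Z} :
    δ.toFib ≤ (subobjectDoctrine Eff).sub F.toHom φ.toFib ↔
      Entails (fun p : Z.carrier × X.carrier => conj (F.rel p.1 p.2) (δ.val p.1))
        fun p => φ.val p.2 := by
  rw [sub_toFib, toFib_le]
  constructor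
  · intro h
    have h₀ := Entails.refl fun p : Z.carrier × X.carrier => conj (F.rel p.1 p.2) (δ.val p.1)
    have h' := h₀.use h (fun p => p.1) ((F.use_left _ _ h₀.left).and h₀.right)
    refine Entails.exis_elim h' (.intro fun k => ?_)
    exact φ.use_ext k.right.right (F.use_single _ _ _ k.right.left k.left.left)
  · intro h
    refine (F.use_total _ (Entails.refl _).left).exis_elim (.intro fun k => ?_)
    exact .exis_intro (fun p => p.2) (k.right.and (k.use h (fun p => (p.1, p.2)) (k.right.and k.left.right)))

end Pred

end Eff

end ChurchThesis
namespace ChurchThesis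

namespace Eff

variable {I : Type} {ξ : I → Set ℕ} {A B W X Y Z : Eff}

/-! ## Arrows of the effective topos given by functions -/

/-- The functional relation given by a function. -/
def ofFun (g : X.carrier → Y.carrier)
    (hg : Entails (fun p : X.carrier × X.carrier => X.eq p.1 p.2) fun p => Y.eq (g p.1) (g p.2)) :
    FunRel X Y where
  rel x y := conj (X.eq x x) (Y.eq (g x) y)
  strict := .intro fun k => k.left.and (eq_right _ _ k.right)
  ext := .intro fun k => (eq_right _ _ k.right.left).and (eq_trans _ _ _
    (k.use hg (fun p => (p.1.2, p.1.1)) (eq_symm _ _ k.right.left))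
    (eq_trans _ _ _ k.left.right k.right.right))
  single := .intro fun k => eq_trans _ _ _ (eq_symm _ _ k.left.right) k.right.right
  total := .exis_intro g ((Entails.refl _).and (hg.comap fun x => (x, x)))

/-- `f` is the arrow given by the function `g`. -/
structure Represents (f : X ⟶ Y) (g : X.carrier → Y.carrier) : Prop where
  resp : Entails (fun p : X.carrier × X.carrier => X.eq p.1 p.2) fun p => Y.eq (g p.1) (g p.2)
  eq : f = (ofFun g resp).toHom

namespace Represents

theorem unique {f f' : X ⟶ Y} {g : X.carrier → Y.carrier} (h : Represents f g)
    (h' : Represents f' g) : f = f' := h.eq.trans h'.eq.symm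

theorem of_entails {F : FunRel X Y} {g : X.carrier → Y.carrier}
    (resp : Entails (fun p : X.carrier × X.carrier => X.eq p.1 p.2) fun p => Y.eq (g p.1) (g p.2))
    (h : Entails (fun p : X.carrier × Y.carrier => F.rel p.1 p.2) fun p => Y.eq (g p.1) p.2) :
    Represents F.toHom g :=
  ⟨resp, Quotient.sound (FunRel.equiv_of_entails
    ((F.use_left Prod.fst Prod.snd (Entails.refl _)).and h))⟩

theorem ofFun (g : X.carrier → Y.carrier)
    (hg : Entails (fun p : X.carrier × X.carrier => X.eq p.1 p.2) fun p => Y.eq (g p.1) (g p.2)) :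
    Represents (Eff.ofFun g hg).toHom g := ⟨hg, rfl⟩

theorem id (X : Eff) : Represents (𝟙 X) fun x => x := of_entails (.refl _) (.refl _)

theorem toUnit (X : Eff) : Represents (SemiCartesianMonoidalCategory.toUnit X)
    fun _ => (() : unit.carrier) :=
  of_entails (F := Eff.toUnit X) (.of_subset fun _ _ _ => trivial) (.of_subset fun _ _ _ => trivial)

theorem fst (X Y : Eff) : Represents (fst X Y) Prod.fst :=
  of_entails (F := prodFst X Y) (Entails.refl _).left (Entails.refl _).left

theorem snd (X Y : Eff) : Represents (snd X Y) Prod.snd :=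
  of_entails (F := prodSnd X Y) (Entails.refl _).right (Entails.refl _).right

theorem comp {f : X ⟶ Y} {f' : Y ⟶ Z} {g : X.carrier → Y.carrier} {g' : Y.carrier → Z.carrier}
    (h : Represents f g) (h' : Represents f' g') : Represents (f ≫ f') fun x => g' (g x) := by
  obtain ⟨hg, rfl⟩ := h
  obtain ⟨hg', rfl⟩ := h'
  refine ⟨hg.use hg' (fun p => (g p.1, g p.2)) hg, ?_⟩
  refine Quotient.sound (FunRel.comp_equiv ?_)
  have k := Entails.refl fun p : (X.carrier × Z.carrier) × Y.carrier =>
    conj ((Eff.ofFun g hg).rel p.1.1 p.2) ((Eff.ofFun g' hg').rel p.2 p.1.2)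
  exact k.left.left.and (eq_trans _ _ _ (k.use hg' (fun p => (g p.1.1, p.2)) k.left.right)
    k.right.right)

theorem lift {f : Z ⟶ X} {f' : Z ⟶ Y} {g : Z.carrier → X.carrier} {g' : Z.carrier → Y.carrier}
    (h : Represents f g) (h' : Represents f' g') :
    Represents (lift f f') fun z => ((g z, g' z) : X.carrier × Y.carrier) := by
  rw [h.eq, h'.eq]
  exact of_entails (F := prodLift _ _) (h.resp.and h'.resp)
    (.intro fun k => k.left.right.and k.right.right)

/-- Along an arrow given by a function, reindexing is plain substitution and the existential over
values disappears. This keeps the later formulas computable by hand. -/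
theorem sub {f : X ⟶ Y} {g : X.carrier → Y.carrier} (h : Represents f g) (φ : Pred Y) :
    (subobjectDoctrine Eff).sub f φ.toFib = (φ.comap g h.resp).toFib := by
  obtain ⟨hg, rfl⟩ := h
  refine le_antisymm (Pred.sub_le.2 (.intro fun k => ?_)) (Pred.le_sub.2 (.intro fun k => ?_))
  · exact φ.use_ext k.right (eq_symm _ _ k.left.right)
  · exact φ.use_ext k.right k.left.right

end Represents

/-- The product of a functional relation with an identity. -/
def whisker (F : FunRel X Y) (A : Eff) : FunRel (prod X A) (prod Y A) where
  rel p q := conj (F.rel p.1 q.1) (A.eq p.2 q.2)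
  strict := .intro fun k => ((F.use_left _ _ k.left).and (eq_left _ _ k.right)).and
    ((F.use_right _ _ k.left).and (eq_right _ _ k.right))
  ext := .intro fun k => (F.use_ext _ _ _ _ k.left.left k.right.left.left k.right.right.left).and
    (eq_trans _ _ _ (eq_symm _ _ k.right.left.right)
      (eq_trans _ _ _ k.left.right k.right.right.right))
  single := .intro fun k => (F.use_single _ _ _ k.left.left k.right.left).and
    (eq_trans _ _ _ (eq_symm _ _ k.left.right) k.right.right)
  total := (F.use_total _ (Entails.refl _).left).exis_elim <| .intro fun k =>
    .exis_intro (fun p => (p.2, p.1.2)) (k.right.and k.left.right)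

theorem toHom_whiskerRight (F : FunRel X Y) (A : Eff) : F.toHom ▷ A = (whisker F A).toHom := by
  have h : F.toHom ▷ A = lift (fst _ _ ≫ F.toHom) (snd _ _) := by ext <;> simp
  refine h.trans (Quotient.sound (Setoid.symm (FunRel.equiv_of_entails (.intro fun k => ?_))))
  have h₁ := eq_left _ _ k.right
  have h₂ := F.use_left _ _ k.left
  exact (FunRel.comp_entails (prodFst X A) F (fun p => p.1) (fun p => p.1.1) _ (h₂.and h₁)
    k.left).and (h₂.and k.right)

/-! ## The hyperdoctrine structure of subobjects -/

namespace Pred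

/-- The equality predicate. -/
def equality (A : Eff) : Pred (A ⊗ A) where
  val p := A.eq p.1 p.2
  ext := .intro fun k => eq_trans _ _ _ (eq_symm _ _ k.right.left)
    (eq_trans _ _ _ k.left k.right.right)

/-- Falsity. -/
def bot (A : Eff) : Pred A where
  val _ := ∅
  ext := (Entails.refl _).left

/-- Disjunction. -/
def or (φ ψ : Pred A) : Pred A where
  val a := disj (φ.val a) (ψ.val a)
  ext := (Entails.refl _).left.disj_elim
    (.intro fun k => (φ.use_ext k.right k.left.right).disj_inl)
    (.intro fun k => (ψ.use_ext k.right k.left.right).disj_inr)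

/-- Implication. -/
def imp (φ ψ : Pred A) : Pred A where
  val a := impl (φ.val a) (ψ.val a)
  ext := .impl_intro <| .intro fun k => ψ.use_ext
    (k.left.left.mp (φ.use_ext k.right (eq_symm _ _ k.left.right))) k.left.right

/-- Existential quantification. -/
def ex (B : Eff) (φ : Pred (A ⊗ B)) : Pred A where
  val a := exis fun b => conj (B.eq b b) (φ.val (a, b))
  ext := (Entails.refl _).left.exis_elim <| .intro fun k => .exis_intro (fun p => p.2) <|
    k.right.left.and (φ.use_ext k.right.right (k.left.right.and k.right.left))

/-- Universal quantification. -/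
def all (B : Eff) (φ : Pred (A ⊗ B)) : Pred A where
  val a := univ fun b => impl (B.eq b b) (φ.val (a, b))
  ext := .univ_intro <| .impl_intro <| .intro fun k =>
    φ.use_ext ((k.left.left.univ_elim fun p => p.2).mp k.right) (k.left.right.and k.right)

theorem ex_adj (F : FunRel X A) (φ : Pred (A ⊗ B)) (δ : Pred X) :
    (subobjectDoctrine Eff).sub F.toHom (ex B φ).toFib ≤ δ.toFib ↔
      (subobjectDoctrine Eff).sub (F.toHom ▷ B) φ.toFib ≤
        (subobjectDoctrine Eff).sub (fst X B) δ.toFib := by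
  rw [toHom_whiskerRight, (Represents.fst X B).sub, sub_le]
  refine Iff.trans ⟨fun h => ?_, fun h => ?_⟩ sub_le.symm
  · refine .intro fun k => k.use h (fun p => (p.1.1, p.2.1)) ?_
    exact k.left.left.and (.exis_intro (fun p => p.2.2)
      ((eq_right _ _ k.left.right).and k.right))
  · refine (Entails.refl _).right.exis_elim (.intro fun k => ?_)
    exact k.use h (fun p => ((p.1.1, p.2), (p.1.2, p.2)))
      ((k.left.left.and k.right.left).and k.right.right)

theorem all_adj (F : FunRel X A) (φ : Pred (A ⊗ B)) (δ : Pred X) :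
    δ.toFib ≤ (subobjectDoctrine Eff).sub F.toHom (all B φ).toFib ↔
      (subobjectDoctrine Eff).sub (fst X B) δ.toFib ≤
        (subobjectDoctrine Eff).sub (F.toHom ▷ B) φ.toFib := by
  rw [toHom_whiskerRight, (Represents.fst X B).sub, le_sub]
  refine Iff.trans ⟨fun h => ?_, fun h => ?_⟩ le_sub.symm
  · refine .intro fun k => ?_
    exact ((k.use h (fun p => (p.1.1, p.2.1)) (k.left.left.and k.right)).univ_elim
      fun p => p.2.2).mp (eq_right _ _ k.left.right)
  · refine .univ_intro (.impl_intro (.intro fun k => ?_))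
    exact k.use h (fun p => ((p.1.1, p.2), (p.1.2, p.2)))
      ((k.left.left.and k.right).and k.left.right)

end Pred

/-! ### Exponentials -/

/-- Realizers of strictness, extensionality, single-valuedness and totality. -/
def isFun (G : A.carrier → B.carrier → Set ℕ) : Set ℕ :=
  conj
    (conj
      (univ fun p : A.carrier × B.carrier =>
        impl (G p.1 p.2) (conj (A.eq p.1 p.1) (B.eq p.2 p.2)))
      (univ fun p : (A.carrier × A.carrier) × (B.carrier × B.carrier) =>
        impl (conj (G p.1.1 p.2.1) (conj (A.eq p.1.1 p.1.2) (B.eq p.2.1 p.2.2))) (G p.1.2 p.2.2)))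
    (conj
      (univ fun p : A.carrier × B.carrier × B.carrier =>
        impl (conj (G p.1 p.2.1) (G p.1 p.2.2)) (B.eq p.2.1 p.2.2))
      (univ fun a : A.carrier => impl (A.eq a a) (exis (G a))))

/-- Realizers of an inclusion of relations. -/
def incl (G G' : A.carrier → B.carrier → Set ℕ) : Set ℕ :=
  univ fun p : A.carrier × B.carrier => impl (G p.1 p.2) (G' p.1 p.2)

theorem incl_refl (G : I → A.carrier → B.carrier → Set ℕ) :
    Entails ξ fun i => incl (G i) (G i) :=
  .univ_intro (.impl_intro (Entails.refl _).right)

theorem incl_trans {G G' G'' : I → A.carrier → B.carrier → Set ℕ}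
    (h : Entails ξ fun i => incl (G i) (G' i)) (h' : Entails ξ fun i => incl (G' i) (G'' i)) :
    Entails ξ fun i => incl (G i) (G'' i) :=
  (h.and h').trans <| .univ_intro <| .impl_intro <| .intro fun k =>
    (k.left.right.univ_elim fun p => p.2).mp ((k.left.left.univ_elim fun p => p.2).mp k.right)

theorem use_incl {G G' : I → A.carrier → B.carrier → Set ℕ}
    (h : Entails ξ fun i => incl (G i) (G' i)) (a : I → A.carrier) (b : I → B.carrier)
    (k : Entails ξ fun i => G i (a i) (b i)) : Entails ξ fun i => G' i (a i) (b i) :=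
  (h.univ_elim fun i => (a i, b i)).mp k

/-- The exponential object of functional relations. -/
def exp (A B : Eff) : Eff where
  carrier := A.carrier → B.carrier → Set ℕ
  eq G G' := conj (conj (isFun G) (isFun G')) (conj (incl G G') (incl G' G))
  symm := .intro fun k => (k.left.right.and k.left.left).and (k.right.right.and k.right.left)
  trans := .intro fun k => (k.left.left.left.and k.right.left.right).and
    ((incl_trans k.left.right.left k.right.right.left).and
      (incl_trans k.right.right.right k.left.right.right))

/-- Evaluation. -/
def expEv (A B : Eff) : FunRel (prod (exp A B) A) B where
  rel p b := conj (isFun p.1) (p.1 p.2 b)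
  strict := .intro fun k => by
    have h := (k.left.left.left.univ_elim fun p => (p.1.2, p.2)).mp k.right
    exact (((k.left.and k.left).and ((incl_refl _).and (incl_refl _))).and h.left).and h.right
  ext := .intro fun k => by
    have h := k.right.left.left.right.left.univ_elim (fun p => (p.1.1.2, p.2.1))
    refine k.right.left.left.left.right.and ?_
    exact (k.right.left.left.left.right.left.right.univ_elim fun p =>
      ((p.1.1.2, p.1.2.2), (p.2.1, p.2.2))).mp
        ((h.mp k.left.right).and (k.right.left.right.and k.right.right))
  single := .intro fun k => (k.left.left.right.left.univ_elim fun p => (p.1.2, p.2.1, p.2.2)).mp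
    (k.left.right.and k.right.right)
  total := .intro fun k => by
    have h := (k.left.left.left.right.right.univ_elim fun p => p.2).mp k.right
    exact h.exis_elim (.intro fun l => .exis_intro (fun p => p.2)
      (l.left.left.left.left.and l.right))

/-- The four realizers belonging to `F` specialize to its section at `x` once the existence of `x`
is realized. -/
theorem entails_isFun_section (F : FunRel (prod X A) B) (x : I → X.carrier)
    (h : Entails ξ fun i => X.eq (x i) (x i)) :
    Entails ξ fun i => isFun (A := A) (B := B) fun a b => F.rel (x i, a) b := by
  refine h.trans (.and (.and ?_ ?_) (.and ?_ ?_))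
  · refine .univ_intro (.impl_intro (.intro fun k => ?_))
    exact (F.use_left _ _ k.right).right.and (F.use_right _ _ k.right)
  · refine .univ_intro (.impl_intro (.intro fun k => ?_))
    exact F.use_ext (fun p => (x p.1, p.2.1.1)) (fun p => (x p.1, p.2.1.2)) _ _
      k.right.left (k.left.and k.right.right.left) k.right.right.right
  · refine .univ_intro (.impl_intro (.intro fun k => ?_))
    exact F.use_single _ _ _ k.right.left k.right.right
  · refine .univ_intro (.impl_intro (.intro fun k => ?_))
    exact F.use_total (I := I × A.carrier) (fun p => (x p.1, p.2)) (k.left.and k.right)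

theorem entails_incl_section (F : FunRel (prod X A) B) (x x' : I → X.carrier)
    (h : Entails ξ fun i => X.eq (x i) (x' i)) :
    Entails ξ fun i => incl (A := A) (B := B) (fun a b => F.rel (x i, a) b)
      fun a b => F.rel (x' i, a) b := by
  refine h.trans (.univ_intro (.impl_intro (.intro fun k => ?_)))
  exact F.use_ext (I := I × A.carrier × B.carrier) (fun p => (x p.1, p.2.1)) (fun p => (x' p.1, p.2.1)) _ _ k.right
    (k.left.and (F.use_left _ _ k.right).right) (F.use_right _ _ k.right)

/-- Currying. -/
def curry (F : FunRel (prod X A) B) : FunRel X (exp A B) :=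
  ofFun (fun x a b => F.rel (x, a) b) <| .intro fun k =>
    have k' := eq_symm _ _ k
    ((entails_isFun_section F _ (eq_left _ _ k)).and
      (entails_isFun_section F _ (eq_right _ _ k))).and
    ((entails_incl_section F _ _ k).and (entails_incl_section F _ _ k'))

theorem isWeakEvaluation_expEv (A B : Eff) :
    IsWeakEvaluation (W := exp A B) (A := A) (expEv A B).toHom := by
  intro X f
  obtain ⟨F, rfl⟩ := exists_toHom_eq f
  refine ⟨(curry F).toHom, ?_⟩
  rw [toHom_whiskerRight]
  refine Quotient.sound (FunRel.comp_equiv ?_)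
  have k := Entails.refl fun p : ((X.carrier × A.carrier) × B.carrier) ×
      ((A.carrier → B.carrier → Set ℕ) × A.carrier) =>
    conj ((whisker (curry F) A).rel p.1.1 p.2) ((expEv A B).rel p.2 p.1.2)
  -- The evaluated relation is only internally equal to the section of `F`; the inclusion contained
  -- in that equality carries its values over.
  have h := use_incl k.left.left.right.right.right _ _ k.right.right
  exact F.use_ext (I := ((X.carrier × A.carrier) × B.carrier) ×
      ((A.carrier → B.carrier → Set ℕ) × A.carrier)) _ (fun p => p.1.1) _ (fun p => p.1.2) h
    (k.left.left.left.and (eq_symm _ _ k.left.right)) (F.use_right (X := prod X A) _ _ h)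

/-- Subobjects in the effective topos form a weak hyperdoctrine. -/
noncomputable def weakHyperdoctrine : WeakHyperdoctrine (subobjectDoctrine Eff) :=
  .ofStable (fun A => (Pred.equality A).toFib)
    (fun X A α β => by
      obtain ⟨φ, rfl⟩ := Pred.exists_toFib_eq α
      obtain ⟨ψ, rfl⟩ := Pred.exists_toFib_eq β
      rw [(Represents.fst _ _).sub, (((Represents.fst _ _).comp (.snd _ _)).lift (.snd _ _)).sub,
        ((Represents.id _).lift (.snd _ _)).sub, Pred.toFib_inf, Pred.toFib_le, Pred.toFib_le]
      constructor
      · exact fun h => .intro fun k => k.use h (fun q => (q, q.2))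
          ((k.left.and k.left.right).and (k.right.and k.left.right))
      · intro h
        have k := Entails.refl fun p : (X.carrier × A.carrier) × A.carrier =>
          conj (((X ⊗ A) ⊗ A).eq p p) (conj (φ.val p.1) (A.eq p.1.2 p.2))
        exact ψ.use_ext (k.use h (fun p => p.1) (k.left.left.and k.right.left))
          (k.left.left.and k.right.right))
    (fun A B => ⟨_, _, isWeakEvaluation_expEv A B⟩)
    (fun A => ⟨(Pred.bot A).toFib, fun X f δ => by
      obtain ⟨δ, rfl⟩ := Pred.exists_toFib_eq δ
      obtain ⟨F, rfl⟩ := exists_toHom_eq f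
      exact Pred.sub_le.2 (Entails.refl _).right.false_elim⟩)
    (fun {A} α β => by
      obtain ⟨φ, rfl⟩ := Pred.exists_toFib_eq α
      obtain ⟨ψ, rfl⟩ := Pred.exists_toFib_eq β
      refine ⟨(φ.or ψ).toFib, fun X f δ => ?_⟩
      obtain ⟨δ, rfl⟩ := Pred.exists_toFib_eq δ
      obtain ⟨F, rfl⟩ := exists_toHom_eq f
      rw [Pred.sub_le, Pred.sub_le, Pred.sub_le]
      constructor
      · exact fun h => ⟨.trans (.intro fun k => k.left.and k.right.disj_inl) h,
          .trans (.intro fun k => k.left.and k.right.disj_inr) h⟩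
      · rintro ⟨h₁, h₂⟩
        exact (Entails.refl _).right.disj_elim (.trans (.intro fun k => k.left.left.and k.right) h₁)
          (.trans (.intro fun k => k.left.left.and k.right) h₂))
    (fun {A} α β => by
      obtain ⟨φ, rfl⟩ := Pred.exists_toFib_eq α
      obtain ⟨ψ, rfl⟩ := Pred.exists_toFib_eq β
      refine ⟨(φ.imp ψ).toFib, fun X f δ => ?_⟩
      obtain ⟨δ, rfl⟩ := Pred.exists_toFib_eq δ
      obtain ⟨F, rfl⟩ := exists_toHom_eq f
      rw [Pred.le_sub, Pred.sub_toFib, Pred.toFib_inf, Pred.le_sub]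
      constructor
      -- The reindexed hypothesis provides its own value of `F`; single-valuedness moves `φ` to the
      -- value at hand.
      · refine fun h => (Entails.refl _).right.right.exis_elim (.intro fun k => ?_)
        have h' := F.use_single _ _ _ k.right.left k.left.left
        exact (k.use h (fun p => p.1) (k.left.left.and k.left.right.left)).mp
          (φ.use_ext k.right.right h')
      · exact fun h => .impl_intro (.trans (.intro fun k => k.left.left.and
          (k.left.right.and (.exis_intro (fun p => p.2) (k.left.left.and k.right)))) h))
    (fun {A} B α => by
      obtain ⟨φ, rfl⟩ := Pred.exists_toFib_eq α
      refine ⟨(φ.ex B).toFib, fun X f δ => ?_⟩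
      obtain ⟨δ, rfl⟩ := Pred.exists_toFib_eq δ
      obtain ⟨F, rfl⟩ := exists_toHom_eq f
      exact Pred.ex_adj F φ δ)
    (fun {A} B α => by
      obtain ⟨φ, rfl⟩ := Pred.exists_toFib_eq α
      refine ⟨(φ.all B).toFib, fun X f δ => ?_⟩
      obtain ⟨δ, rfl⟩ := Pred.exists_toFib_eq δ
      obtain ⟨F, rfl⟩ := exists_toHom_eq f
      exact Pred.all_adj F φ δ)

end Eff

end ChurchThesis
namespace ChurchThesis

namespace Eff

variable {I : Type} {ξ : I → Set ℕ} {A B W X Y Z : Eff}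

/-! ### The natural number object -/

/-- The object of natural numbers. -/
def nat : Eff where
  carrier := ℕ
  eq := natEq
  symm := .of_subset fun _ _ h => ⟨h.1.symm, h.2.trans h.1⟩
  trans := .of_computable _ (Computable.fst.comp Computable.unpair)
    fun _ _ h => ⟨h.1.1.trans h.2.1, h.1.2⟩

/-- Internal induction for a natural number that varies with the context, given a realizer of it. -/
theorem nat_ind {n : I → ℕ} {θ : I → ℕ → Set ℕ} (hn : Entails ξ fun i => natEq (n i) (n i))
    (h₀ : Entails ξ fun i => θ i 0)
    (h₁ : Entails (fun p : I × ℕ => conj (conj (ξ p.1) (natEq p.2 p.2)) (θ p.1 p.2))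
      fun p => θ p.1 (p.2 + 1)) : Entails ξ fun i => θ i (n i) :=
  hn.use (h₀.nat_rec h₁) (fun i => (i, n i)) ((Entails.refl _).and hn)

/-- The relation between a point and the values of the `n`-th iterate. -/
def iterRel (a : FunRel A X) (f : FunRel X X) (n : ℕ) : A.carrier → X.carrier → Set ℕ :=
  Nat.rec a.rel (fun _ r x y => exis fun z => conj (r x z) (f.rel z y)) n

section

variable (a : FunRel A X) (f : FunRel X X) {n : I → ℕ} {x x' : I → A.carrier}
  {y y' : I → X.carrier}

/-- This and the next three properties are proved by `nat_ind`: induction outside the logic would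
give a realizer for each `n`, whereas one uniform in `n` is needed. The values are quantified inside
the induction formula because the intermediate ones change. -/
theorem iterRel_strict (hn : Entails ξ fun i => natEq (n i) (n i))
    (h : Entails ξ fun i => iterRel a f (n i) (x i) (y i)) :
    Entails ξ fun i => conj (A.eq (x i) (x i)) (X.eq (y i) (y i)) := by
  refine (Entails.univ_elim (nat_ind (θ := fun i k => univ fun y => impl (iterRel a f k (x i) y)
    (conj (A.eq (x i) (x i)) (X.eq y y))) hn ?_ ?_) y).mp h
  · refine .univ_intro (.impl_intro (.intro fun k => ?_))
    exact (a.use_left _ _ k.right).and (a.use_right _ _ k.right)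
  · refine .univ_intro (.impl_intro ((Entails.refl _).right.exis_elim (.intro fun k => ?_)))
    exact ((k.left.left.right.univ_elim fun p => p.2).mp k.right.left).left.and
      (f.use_right _ _ k.right.right)

theorem iterRel_ext (hn : Entails ξ fun i => natEq (n i) (n i))
    (h : Entails ξ fun i => iterRel a f (n i) (x i) (y i))
    (hx : Entails ξ fun i => A.eq (x i) (x' i)) (hy : Entails ξ fun i => X.eq (y i) (y' i)) :
    Entails ξ fun i => iterRel a f (n i) (x' i) (y' i) := by
  refine (Entails.univ_elim (nat_ind (θ := fun i k => univ fun q : X.carrier × X.carrier =>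
    impl (conj (iterRel a f k (x i) q.1) (X.eq q.1 q.2)) (iterRel a f k (x' i) q.2)) hn ?_ ?_)
    fun i => (y i, y' i)).mp (h.and hy)
  · refine .univ_intro (.impl_intro (.intro fun k => ?_))
    exact a.use_ext _ _ _ _ k.right.left (k.left.trans (hx.comap _)) k.right.right
  · refine .univ_intro (.impl_intro ((Entails.refl _).right.left.exis_elim (.intro fun k => ?_)))
    have hz := f.use_left _ _ k.right.right
    -- The intermediate value is kept: the induction hypothesis changes only the starting point, and
    -- extensionality of `f` changes the last value.
    refine .exis_intro (fun p => p.2) (.and ?_ ?_)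
    · exact (k.left.left.right.univ_elim fun p => (p.2, p.2)).mp (k.right.left.and hz)
    · exact f.use_ext _ _ _ _ k.right.right hz k.left.right.right

theorem iterRel_single (hn : Entails ξ fun i => natEq (n i) (n i))
    (h : Entails ξ fun i => iterRel a f (n i) (x i) (y i))
    (h' : Entails ξ fun i => iterRel a f (n i) (x i) (y' i)) :
    Entails ξ fun i => X.eq (y i) (y' i) := by
  refine (Entails.univ_elim (nat_ind (θ := fun i k => univ fun q : X.carrier × X.carrier =>
    impl (conj (iterRel a f k (x i) q.1) (iterRel a f k (x i) q.2)) (X.eq q.1 q.2)) hn ?_ ?_)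
    fun i => (y i, y' i)).mp (h.and h')
  · refine .univ_intro (.impl_intro (.intro fun k => ?_))
    exact a.use_single _ _ _ k.right.left k.right.right
  · refine .univ_intro (.impl_intro ((Entails.refl _).right.left.exis_elim
      ((Entails.refl _).left.right.right.exis_elim (.intro fun k => ?_))))
    have hz := (k.left.left.left.right.univ_elim fun p => (p.1.2, p.2)).mp
      (k.left.right.left.and k.right.left)
    exact f.use_single _ _ _ (f.use_ext _ _ _ _ k.left.right.right hz
      (f.use_right _ _ k.left.right.right)) k.right.right

theorem iterRel_total (hn : Entails ξ fun i => natEq (n i) (n i))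
    (hx : Entails ξ fun i => A.eq (x i) (x i)) :
    Entails ξ fun i => exis (iterRel a f (n i) (x i)) := by
  refine nat_ind (θ := fun i k => exis (iterRel a f k (x i))) hn (a.use_total _ hx) ?_
  refine (Entails.refl _).right.exis_elim (.intro fun k => ?_)
  have hy := (iterRel_strict a f k.left.left.right k.right).right
  refine (f.use_total _ hy).exis_elim (.intro fun l => ?_)
  exact .exis_intro (fun p => p.2) (.exis_intro (fun p => p.1.2) (l.left.right.and l.right))

/-- Iteration of a functional relation. -/
def iterate : FunRel (prod A nat) X where
  rel p y := conj (natEq p.2 p.2) (iterRel a f p.2 p.1 y)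
  strict := .intro fun k =>
    have h := iterRel_strict a f k.left k.right
    (h.left.and k.left).and h.right
  ext := .intro fun k =>
    (eq_right (X := nat) _ _ k.right.left.right).and (k.right.left.right.eq_subst
      (θ := fun p n => iterRel a f n p.1.2.1 p.2.2)
      (iterRel_ext a f k.left.left k.left.right k.right.left.left k.right.right))
  single := .intro fun k => iterRel_single a f k.left.left k.left.right k.right.right
  total := .intro fun k => (iterRel_total a f k.right k.left).exis_elim <| .intro fun l =>
    .exis_intro (fun p => p.2) (l.left.right.and l.right)

end

/-! ### Composition with arrows given by functions -/

namespace Represents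

/-- Precomposing with a function is substitution, so the equations for zero and successor become
entailments about `K` at explicit arguments. -/
theorem comp_toHom_eq {f : X ⟶ Y} {g : X.carrier → Y.carrier} (h : Represents f g)
    {K : FunRel Y Z} {L : FunRel X Z}
    (hKL : Entails (fun p : X.carrier × Z.carrier => conj (X.eq p.1 p.1) (K.rel (g p.1) p.2))
      fun p => L.rel p.1 p.2) : f ≫ K.toHom = L.toHom := by
  obtain ⟨hg, rfl⟩ := h
  refine Quotient.sound (FunRel.comp_equiv ?_)
  have k := Entails.refl fun p : (X.carrier × Z.carrier) × Y.carrier =>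
    conj ((Eff.ofFun g hg).rel p.1.1 p.2) (K.rel p.2 p.1.2)
  exact k.use hKL (fun p => p.1) (k.left.left.and (K.use_ext _ _ _ _ k.right
    (eq_symm _ _ k.left.right) (K.use_right _ _ k.right)))

theorem entails_of_comp_toHom_eq {f : X ⟶ Y} {g : X.carrier → Y.carrier} (h : Represents f g)
    {K : FunRel Y Z} {L : FunRel X Z} (hKL : f ≫ K.toHom = L.toHom) :
    Entails (fun p : X.carrier × Z.carrier => L.rel p.1 p.2) fun p => K.rel (g p.1) p.2 := by
  obtain ⟨hg, rfl⟩ := h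
  refine (toHom_eq_iff.1 hKL).2.trans ((Entails.refl _).exis_elim (.intro fun k => ?_))
  exact K.use_ext _ _ _ _ k.right.right (eq_symm _ _ k.right.left.right)
    (K.use_right _ _ k.right.right)

theorem whiskerLeft {f : X ⟶ Y} {g : X.carrier → Y.carrier} (h : Represents f g) (A : Eff) :
    Represents (A ◁ f) fun p => ((p.1, g p.2) : A.carrier × Y.carrier) := by
  have h' : A ◁ f = CartesianMonoidalCategory.lift (CartesianMonoidalCategory.fst _ _)
      (CartesianMonoidalCategory.snd _ _ ≫ f) := by
    ext <;> simp
  rw [h']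
  exact (fst A X).lift ((snd A X).comp h)

theorem zero : Represents (Y := nat)
    (Eff.ofFun (X := unit) (Y := nat) (fun _ => (0 : ℕ)) (.const 0 fun _ _ => ⟨rfl, rfl⟩)).toHom
    fun _ => (0 : ℕ) := ofFun _ _

theorem succ : Represents
    (Eff.ofFun (X := nat) (Y := nat) Nat.succ (Entails.refl _).natEq_succ).toHom Nat.succ :=
  ofFun _ _

theorem point (A : Eff) : Represents (CartesianMonoidalCategory.lift (𝟙 A)
    (SemiCartesianMonoidalCategory.toUnit A ≫ (Eff.ofFun (X := unit) (Y := nat)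
      (fun _ => (0 : ℕ)) (.const 0 fun _ _ => ⟨rfl, rfl⟩)).toHom))
    fun x => ((x, 0) : A.carrier × ℕ) :=
  (id A).lift ((toUnit A).comp zero)

end Represents

/-- The natural number object of the effective topos. -/
noncomputable def nno : PNNO Eff where
  N := nat
  zero := (ofFun (X := unit) (Y := nat) (fun _ => (0 : ℕ)) (.const 0 fun _ _ => ⟨rfl, rfl⟩)).toHom
  succ := (ofFun (X := nat) (Y := nat) Nat.succ (Entails.refl _).natEq_succ).toHom
  existsUnique {A X} a f := by
    obtain ⟨a, rfl⟩ := exists_toHom_eq a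
    obtain ⟨f, rfl⟩ := exists_toHom_eq f
    refine ⟨(iterate a f).toHom, ⟨(Represents.point A).comp_toHom_eq ?_, ?_⟩, ?_⟩
    · exact (Entails.refl _).right.right
    · refine (Represents.succ.whiskerLeft A).comp_toHom_eq (L := (iterate a f).comp f) ?_
      refine .intro fun k => k.right.right.exis_elim (.intro fun l => ?_)
      exact .exis_intro (fun p => p.2) ((l.left.left.right.and l.right.left).and l.right.right)
    · rintro k ⟨h₀, h₁⟩
      obtain ⟨K, rfl⟩ := exists_toHom_eq k
      replace h₀ := (Represents.point A).entails_of_comp_toHom_eq h₀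
      replace h₁ := (Represents.succ.whiskerLeft A).entails_of_comp_toHom_eq
        (L := K.comp f) h₁
      refine Quotient.sound (Setoid.symm (FunRel.equiv_of_entails ?_))
      have l := Entails.refl fun p : (A.carrier × ℕ) × X.carrier => (iterate a f).rel p.1 p.2
      -- Uniqueness: by internal induction, the iterates are contained in any solution `K`. One
      -- containment suffices between functional relations.
      have h := nat_ind (n := fun p : (A.carrier × ℕ) × X.carrier => p.1.2)
        (θ := fun p n => univ fun y => impl (iterRel a f n p.1.1 y) (K.rel (p.1.1, n) y))
        l.left ?_ ?_
      · exact (h.univ_elim fun p => p.2).mp l.right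
      · refine .univ_intro (.impl_intro (.intro fun k => ?_))
        exact k.use h₀ (fun p => (p.1.1.1, p.2)) k.right
      · refine .univ_intro (.impl_intro ((Entails.refl _).right.exis_elim (.intro fun k => ?_)))
        exact k.use h₁ (fun p => ((p.1.1.1.1.1, p.1.1.2), p.1.2)) (.exis_intro (fun p => p.2)
          (((k.left.left.right.univ_elim fun p => p.2).mp k.right.left).and k.right.right))

/-! ### Iteration and primitive recursion through representing functions -/

namespace Represents

/-- The arrow given by the iterated function satisfies the two recursion equations, so by uniqueness
it is the one chosen by the universal property. -/
theorem iter {a : A ⟶ X} {f : X ⟶ X} {g : A.carrier → X.carrier} {h : X.carrier → X.carrier}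
    (ha : Represents a g) (hf : Represents f h) :
    Represents (nno.iter a f) fun p : A.carrier × ℕ => h^[p.2] (g p.1) := by
  have hk : Represents (Eff.ofFun (X := A ⊗ nat) (Y := X)
      (fun p : A.carrier × ℕ => h^[p.2] (g p.1)) ?_).toHom _ := ofFun _ _
  · refine cast ?_ hk
    refine congrArg (fun k => Represents k _)
      ((nno.existsUnique a f).unique ⟨?_, ?_⟩ (nno.existsUnique a f).choose_spec.1)
    · exact ((point A).comp hk).unique ha
    · refine ((succ.whiskerLeft A).comp hk).unique ?_
      exact cast (congrArg (Represents _)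
        (funext fun p => (Function.iterate_succ_apply' h p.2 (g p.1)).symm)) (hk.comp hf)
  -- Internally equal natural numbers are equal, which leaves a common exponent on both sides; that
  -- case is an internal induction.
  · refine .intro fun k => k.right.eq_subst
      (θ := fun p n => X.eq (h^[p.1.2] (g p.1.1)) (h^[n] (g p.2.1))) ?_
    have h₀ : Entails _ fun p : (A.carrier × ℕ) × (A.carrier × ℕ) => X.eq (g p.1.1) (g p.2.1) :=
      k.use ha.resp (fun p => (p.1.1, p.2.1)) k.left
    refine nat_ind (n := fun p : (A.carrier × ℕ) × (A.carrier × ℕ) => p.1.2)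
      (θ := fun p n => X.eq (h^[n] (g p.1.1)) (h^[n] (g p.2.1)))
      (eq_left (X := nat) _ _ k.right) h₀ ?_
    simp only [Function.iterate_succ_apply']
    exact .intro fun l => l.use hf.resp (fun p => (h^[p.2] (g p.1.1.1), h^[p.2] (g p.1.2.1))) l.right

/-- Arrows of `Eff` have no underlying functions, so the standard values of a term are expressed by
representation, relative to functions representing its arguments. -/
theorem interp : ∀ {n : ℕ} (t : PrimrecTerm n) {Γ : Eff} {v : Fin n → (Γ ⟶ nno.N)}
    {w : Fin n → Γ.carrier → ℕ} (_ : ∀ i, Represents (v i) (w i)),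
    Represents (nno.interp t v) fun γ => t.eval fun i => w i γ
  | _, .zero, _, _, _, _ => (toUnit _).comp zero
  | _, .succ, _, _, _, h => (h 0).comp succ
  | _, .proj i, _, _, _, h => h i
  | _, .comp f g, _, _, _, h => interp f fun i => interp (g i) h
  | _, .prec f g, Γ, v, w, h => by
      have hstart := (id Γ).lift (((toUnit Γ).comp zero).lift
        (interp f (v := Fin.tail v) (w := Fin.tail w) fun i => h i.succ))
      have hindex := (snd Γ (nno.N ⊗ nno.N)).comp (fst nno.N nno.N)
      have hvalue := (snd Γ (nno.N ⊗ nno.N)).comp (snd nno.N nno.N)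
      have hstep := (fst Γ (nno.N ⊗ nno.N)).lift ((hindex.comp succ).lift (interp g
        (Γ := Γ ⊗ (nno.N ⊗ nno.N))
        (v := Fin.cons (CartesianMonoidalCategory.snd _ _ ≫ CartesianMonoidalCategory.fst _ _)
          (Fin.cons (CartesianMonoidalCategory.snd _ _ ≫ CartesianMonoidalCategory.snd _ _)
            fun i => CartesianMonoidalCategory.fst _ _ ≫ Fin.tail v i))
        (w := (Fin.cons (fun p => p.2.1) (Fin.cons (fun p => p.2.2) fun i p => w i.succ p.1) :
          Fin _ → Γ.carrier × ℕ × ℕ → ℕ))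
        (Fin.cases hindex (Fin.cases hvalue fun i => (fst Γ (nno.N ⊗ nno.N)).comp (h i.succ)))))
      have hk := ((id Γ).lift (h 0)).comp ((hstart.iter hstep).comp hvalue)
      refine cast (congrArg (Represents _) (funext fun γ => ?_)) hk
      refine congrArg (fun q : Γ.carrier × ℕ × ℕ => q.2.2) (iterate_prec rfl (fun k m => ?_) _)
      refine congrArg (fun m => (γ, k + 1, m)) (congrArg g.eval (funext fun i => ?_))
      induction i using Fin.cases with
      | zero => rfl
      | succ j => induction j using Fin.cases <;> rfl

end Represents

/-- Subobjects in the effective topos form an arithmetic doctrine. -/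
noncomputable def arithmeticDoctrine : ArithmeticDoctrine (subobjectDoctrine Eff) where
  toWeakHyperdoctrine := weakHyperdoctrine
  nno := nno
  induction A φ h₀ h₁ := by
    obtain ⟨φ, rfl⟩ := Pred.exists_toFib_eq φ
    have h₀' := h₀.trans_eq ((Represents.point A).sub φ)
    have h₁' := h₁.trans_eq ((Represents.succ.whiskerLeft A).sub φ)
    -- Existence of a pair in `A ⊗ nat` is, by definition, existence of `x` together with `natEq n
    -- n`, which is exactly the context of `nat_rec`.
    exact Pred.top_le_toFib.2 (Entails.nat_rec (φ := fun x => A.eq x x)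
      (θ := fun x n => φ.val (x, n)) (Pred.top_le_toFib.1 h₀') (Pred.toFib_le.1 h₁'))

theorem ex_toFib (φ : Pred (A ⊗ B)) : arithmeticDoctrine.ex B φ.toFib = (φ.ex B).toFib :=
  arithmeticDoctrine.ex_eq fun δ => by
    obtain ⟨δ, rfl⟩ := Pred.exists_toFib_eq δ
    have h := Pred.ex_adj (FunRel.id A) φ δ
    rwa [show (FunRel.id A).toHom = 𝟙 A from rfl, Doctrine.sub_id, id_whiskerRight,
      Doctrine.sub_id] at h

theorem all_toFib (φ : Pred (A ⊗ B)) : arithmeticDoctrine.all B φ.toFib = (φ.all B).toFib :=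
  arithmeticDoctrine.all_eq fun δ => by
    obtain ⟨δ, rfl⟩ := Pred.exists_toFib_eq δ
    have h := Pred.all_adj (FunRel.id A) φ δ
    rwa [show (FunRel.id A).toHom = 𝟙 A from rfl, Doctrine.sub_id, id_whiskerRight,
      Doctrine.sub_id] at h

/-- Only the values of the predicate matter afterwards; the existential form leaves its
extensionality proof unspecified. -/
theorem exists_kleene_eq (T : PrimrecTerm 3) (U : PrimrecTerm 1) (ρ : Pred ((nat ⊗ nat) ⊗ A))
    {e x y : X ⟶ nat} {a : X ⟶ A} {e' x' y' : X.carrier → ℕ} {a' : X.carrier → A.carrier}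
    (he : Represents e e') (hx : Represents x x') (hy : Represents y y') (ha : Represents a a') :
    ∃ κ : Pred X, κ.val = (fun γ => conj (natEq (T.eval ![e' γ, x' γ, y' γ]) 1)
        (ρ.val (((x' γ, U.eval ![y' γ]), a' γ) : (ℕ × ℕ) × A.carrier))) ∧
      arithmeticDoctrine.kleene T U ρ.toFib e x y a = κ.toFib := by
  have hT := Represents.interp T (v := ![e, x, y]) (w := ![e', x', y'])
    (fun i => by fin_cases i <;> assumption)
  have hU := Represents.interp U (v := ![y]) (w := ![y']) (fun i => by fin_cases i; assumption)
  have h₁ : Represents (SemiCartesianMonoidalCategory.toUnit X ≫ nno.zero ≫ nno.succ)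
    fun _ => (1 : ℕ) := (Represents.toUnit X).comp (Represents.zero.comp Represents.succ)
  refine ⟨_, ?_, (congrArg₂ (· ⊓ ·) ((hT.lift h₁).sub (Pred.equality nat))
    (((hx.lift hU).lift ha).sub ρ)).trans (Pred.toFib_inf _ _)⟩
  have hT' : ∀ γ, (fun i => ![e', x', y'] i γ) = ![e' γ, x' γ, y' γ] := fun γ =>
    funext fun i => by fin_cases i <;> rfl
  have hU' : ∀ γ, (fun i => ![y'] i γ) = ![y' γ] := fun γ =>
    funext fun i => by fin_cases i; rfl
  exact funext fun γ => congrArg₂ conj (congrArg (fun n => natEq n 1) (congrArg T.eval (hT' γ)))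
    (congrArg (fun n => ρ.val (((x' γ, n), a' γ) : (ℕ × ℕ) × A.carrier))
      (congrArg U.eval (hU' γ)))

theorem paramCT {T : PrimrecTerm 3} {U : PrimrecTerm 1} (hTU : IsKleenePair T U) :
    arithmeticDoctrine.ParamCT T U := by
  intro A R
  obtain ⟨ρ, rfl⟩ := Pred.exists_toFib_eq R
  obtain ⟨κ, hκ, h⟩ := exists_kleene_eq (A := A) T U ρ
    ((Represents.fst ((A ⊗ nat) ⊗ nat) nat).comp
      ((Represents.fst (A ⊗ nat) nat).comp (.snd A nat)))
    ((Represents.fst ((A ⊗ nat) ⊗ nat) nat).comp (.snd _ _))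
    (Represents.snd ((A ⊗ nat) ⊗ nat) nat)
    ((Represents.fst ((A ⊗ nat) ⊗ nat) nat).comp
      ((Represents.fst (A ⊗ nat) nat).comp (.fst A nat)))
  have hR := (((Represents.fst (A ⊗ nat) nat).comp (.snd _ _)).lift (.snd _ _)).lift
    ((Represents.fst (A ⊗ nat) nat).comp (.fst _ _))
  have h' := (congrArg (fun α => arithmeticDoctrine.ex nat (arithmeticDoctrine.all nat
    (arithmeticDoctrine.ex nat α))) h).trans ((congrArg (fun α => arithmeticDoctrine.ex nat
      (arithmeticDoctrine.all nat α)) (ex_toFib κ)).trans ((congrArg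
        (fun α => arithmeticDoctrine.ex nat α) (all_toFib _)).trans (ex_toFib _)))
  refine le_of_eq_of_le ((congrArg (fun α => arithmeticDoctrine.all nat
    (arithmeticDoctrine.ex nat α)) (hR.sub ρ)).trans ((congrArg
      (fun α => arithmeticDoctrine.all nat α) (ex_toFib _)).trans (all_toFib _)))
    (le_of_le_of_eq (Pred.toFib_le.2 ?_) h'.symm)
  simp only [Pred.ex, Pred.all, hκ]
  exact (Entails.refl _).right.trans (entails_church hTU _)

theorem arithmeticDoctrine_comprehensiveDiagonals : arithmeticDoctrine.ComprehensiveDiagonals := by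
  refine WeakHyperdoctrine.comprehensiveDiagonals _ fun Z A f g h => ?_
  obtain ⟨F, rfl⟩ := exists_toHom_eq f
  obtain ⟨G, rfl⟩ := exists_toHom_eq g
  have h' : ⊤ ≤ ((Pred.equality A).pull (prodLift F G)).toFib :=
    h.trans_eq (Pred.sub_toFib (Pred.equality A) (prodLift F G))
  rw [Pred.top_le_toFib] at h'
  refine Quotient.sound (FunRel.equiv_of_entails (.intro fun k => ?_))
  have hz := F.use_left _ _ k
  -- Internal equality of `f` and `g` provides internally equal values of `F` and `G` at the same
  -- point; single-valuedness of `F` identifies its value with the given one.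
  refine Entails.exis_elim (k.use h' (fun p => p.1) hz) (.intro fun l => ?_)
  exact G.use_ext _ _ _ _ l.right.left.right (G.use_left _ _ l.right.left.right)
    (eq_trans _ _ _ (eq_symm _ _ l.right.right) (F.use_single _ _ _ l.right.left.left l.left))

theorem satisfiesTCT : SatisfiesTCT (subobjectDoctrine Eff) :=
  ⟨arithmeticDoctrine, arithmeticDoctrine_comprehensiveDiagonals, fun _ _ hTU => (paramCT hTU).tct⟩

theorem satisfiesCT : SatisfiesCT (subobjectDoctrine Eff) :=
  ⟨arithmeticDoctrine, arithmeticDoctrine_comprehensiveDiagonals, fun _ _ hTU => (paramCT hTU).ct⟩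

end Eff

end ChurchThesis


theorem corollary4p8 :
    (ChurchThesis.SatisfiesTCT (ChurchThesis.strongSubobjectDoctrine ChurchThesis.Asm) ∧
      ChurchThesis.SatisfiesTCT (ChurchThesis.subobjectDoctrine ChurchThesis.Eff)) ∧
    (ChurchThesis.SatisfiesCT (ChurchThesis.variationDoctrine ChurchThesis.PAsm) ∧
      ChurchThesis.SatisfiesCT (ChurchThesis.subobjectDoctrine ChurchThesis.Eff)) :=
  ⟨⟨ChurchThesis.Asm.satisfiesTCT, ChurchThesis.Eff.satisfiesTCT⟩,
    ChurchThesis.PAsm.satisfiesCT, ChurchThesis.Eff.satisfiesCT⟩
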